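/- **Theorem 2** (Gaussian approximation for partial sums under a dependency graph). Let $\kappa>0$, $\gamma_1\ge 1$ and $K_3>0$. There is a constant $C>0$, depending only on $\kappa,\gamma_1,K_3$, such that the following holds for all integers $n\ge 1$ and $p\ge 2$ with $p\ge n^{\kappa}$ and every real $B_n\ge 1$. Let $X_1,\dots,X_n$ be random vectors in $\mathbb{R}^p$ with mean zero, $X_t=(X_{t,1},\dots,X_{t,p})$, defined on a common probability space. Let $G_n=(V_n,E_n)$ be a dependency graph of $X_1,\dots,X_n$: an undirected graph on $V_n=\{1,\dots,n\}$, with the convention $(t,t)\in E_n$ for all $t$, such that $(X_t)_{t\in A}$ and $(X_t)_{t\in B}$ are independent whenever $A,B\subset V_n$ are disjoint and no edge joins $A$ to $B$. Put $\mathcal{N}_t=\{s:(t,s)\in E_n\}$ and $$D_n=\max_{t}|\mathcal{N}_t|,\qquad D_n^*=\max_{t}\Big|\bigcup_{\ell\in\mathcal{N}_t}\mathcal{N}_\ell\Big| .$$ Let $S_{n,x}=n^{-1/2}\sum_{t=1}^nX_t$, and let $G\sim N(0,\operatorname{Cov}(S_{n,x}))$ be independent of $(X_1,\dots,X_n)$.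 Assume * (sub-exponential tails) $\|X_{t,j}\|_{\psi_{\gamma_1}}\le B_n$ for all $t\in\{1,\dots,n\}$ and $j\in\{1,\dots,p\}$, where $\|\xi\|_{\psi_{\gamma}}=\inf\{\lambda>0:\mathbb{E}[\exp\{(|\xi|/\lambda)^{\gamma}\}-1]\le 1\}$; * (non-degenerate long-run variances) $\operatorname{Var}\big(n^{-1/2}\sum_{t=1}^nX_{t,j}\big)\ge K_3$ for all $j\in\{1,\dots,p\}$. Then $$\varrho_n:=\sup_{u\in\mathbb{R}^p,\ \nu\in[0,1]}\Big|\mathbb{P}\big(\sqrt{\nu}\,S_{n,x}+\sqrt{1-\nu}\,G\le u\big)-\mathbb{P}(G\le u)\Big|\ \le\ C\,\frac{B_n(D_nD_n^*)^{1/3}(\log p)^{7/6}}{n^{1/6}},$$ where inequalities between vectors are meant coordinatewise. In particular $\varrho_n\lesssim B_n(D_nD_n^*)^{1/3}(\log p)^{7/6}n^{-1/6}$ as $n\to\infty$. -/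

import Mathlib

open MeasureTheory ProbabilityTheory

/-- The Orlicz (quasi-)norm `‖ξ‖_{ψ_γ} = inf {l > 0 : E[ψ_γ(|ξ| / l)] ≤ 1}`, where
`ψ_γ(x) = exp(x ^ γ) - 1`, of a real random variable `ξ`. It takes values in `[0, ∞]`, so that the
infimum over the empty set is `∞`, and the expectation of the nonnegative variable is a Lebesgue
integral with values in `[0, ∞]`. -/
noncomputable def psiNorm {Ω : Type*} [MeasurableSpace Ω] (P : Measure Ω) (γ : ℝ) (ξ : Ω → ℝ) :
    ENNReal :=
  sInf {a : ENNReal | ∃ l : ℝ, 0 < l ∧ a = ENNReal.ofReal l ∧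
    ∫⁻ ω, ENNReal.ofReal (Real.exp ((|ξ ω| / l) ^ γ) - 1) ∂P ≤ 1}

/-- The normalized sum `S = n ^ (-1/2) ∑ t, X t`. -/
noncomputable def normSum {Ω : Type*} {n p : ℕ} (X : Fin n → Ω → EuclideanSpace ℝ (Fin p)) (ω : Ω) :
    EuclideanSpace ℝ (Fin p) :=
  (Real.sqrt n)⁻¹ • ∑ t, X t ω

/-- The long-run covariance matrix `Ξ = Cov(S)` of the sequence `X`. -/
noncomputable def longRunCov {Ω : Type*} [MeasurableSpace Ω] (P : Measure Ω) {n p : ℕ}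
    (X : Fin n → Ω → EuclideanSpace ℝ (Fin p)) : Matrix (Fin p) (Fin p) ℝ :=
  Matrix.of fun j k => cov[fun ω => normSum X ω j, fun ω => normSum X ω k; P]

/-- The long-run variance `V_j = Var(n ^ (-1/2) ∑ t, X t j)` of the `j`-th coordinate sequence. -/
noncomputable def longRunVar {Ω : Type*} [MeasurableSpace Ω] (P : Measure Ω) {n p : ℕ}
    (X : Fin n → Ω → EuclideanSpace ℝ (Fin p)) (j : Fin p) : ℝ :=
  Var[fun ω => (Real.sqrt n)⁻¹ * ∑ t, X t ω j; P]

/-- `E` is a dependency graph of the sequence `X`: the families `(X t)_{t ∈ A}` and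
`(X t)_{t ∈ B}` are independent whenever `A` and `B` are disjoint sets of nodes with no edge
between them. -/
def IsDependencyGraph {Ω : Type*} [MeasurableSpace Ω] (P : Measure Ω) {n p : ℕ}
    (X : Fin n → Ω → EuclideanSpace ℝ (Fin p)) (E : SimpleGraph (Fin n)) : Prop :=
  ∀ A B : Set (Fin n), Disjoint A B → (∀ a ∈ A, ∀ b ∈ B, ¬ E.Adj a b) →
    IndepFun (fun ω (a : A) => X a ω) (fun ω (b : B) => X b ω) P

/-- The neighbour nodes `N_t` of `t`, where every node counts as a neighbour of itself. -/
def nbhd {n : ℕ} (E : SimpleGraph (Fin n)) (t : Fin n) : Set (Fin n) :=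
  {s | s = t ∨ E.Adj t s}

/-- The maximum degree of the first-degree connections: the maximum over `t` of the
cardinality of `N_t`. -/
noncomputable def maxDegOne {n : ℕ} (E : SimpleGraph (Fin n)) : ℕ :=
  Finset.univ.sup fun t => (nbhd E t).ncard

/-- The maximum degree of the second-degree connections: the maximum over `t` of the
cardinality of the union of the `N_l`, for `l` in `N_t`. -/
noncomputable def maxDegTwo {n : ℕ} (E : SimpleGraph (Fin n)) : ℕ :=
  Finset.univ.sup fun t => (⋃ l ∈ nbhd E t, nbhd E l).ncard

/-- The approximation error: the supremum over `u` in `ℝ^p` and `ν` in `[0, 1]` of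
`|P(√ν S + √(1 - ν) G ≤ u) - P(G ≤ u)|`, inequalities between vectors being meant coordinatewise.
(The numbers over which the supremum is taken lie in `[0, 1]`.) -/
noncomputable def gaussApproxError {Ω : Type*} [MeasurableSpace Ω] (P : Measure Ω) {n p : ℕ}
    (X : Fin n → Ω → EuclideanSpace ℝ (Fin p)) (G : Ω → EuclideanSpace ℝ (Fin p)) : ℝ :=
  ⨆ q : EuclideanSpace ℝ (Fin p) × Set.Icc (0 : ℝ) 1,
    |P.real {ω | ∀ j, Real.sqrt q.2 * normSum X ω j + Real.sqrt (1 - q.2) * G ω j ≤ q.1 j} -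
      P.real {ω | ∀ j, G ω j ≤ q.1 j}|

/-- The maximum of the coordinates of `z` lies in `[-a, a]`. -/
def MaxNear {ι : Type*} (a : ℝ) (z : ι → ℝ) : Prop := (∀ j, z j ≤ a) ∧ ∃ j, -a ≤ z j

lemma MaxNear.of_close {ι : Type*} {a c : ℝ} {z z' : ι → ℝ} (hz : MaxNear a z) (h : ∀ j, |z j - z' j| ≤ c) :
    MaxNear (a + c) z' := by
  obtain ⟨h1, j, h2⟩ := hz
  refine ⟨fun k => ?_, j, ?_⟩
  · linarith [(abs_le.1 (h k)).1, h1 k]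
  · linarith [(abs_le.1 (h j)).2]

section Softmax

variable {ι : Type*} [Fintype ι]

/-- The softmax weights `exp (L z_j) / ∑ k, exp (L z_k)`. -/
noncomputable def softmaxWeight (L : ℝ) (z : ι → ℝ) (j : ι) : ℝ :=
  Real.exp (L * z j) / ∑ k, Real.exp (L * z k)

/-- The average of `v` under the softmax weights of `z`. -/
noncomputable def softmaxAvg (L : ℝ) (z v : ι → ℝ) : ℝ :=
  ∑ j, softmaxWeight L z j * v j

/-- The smooth maximum `L⁻¹ log ∑ j, exp (L z_j)`. -/
noncomputable def smoothMax (L : ℝ) (z : ι → ℝ) : ℝ :=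
  L⁻¹ * Real.log (∑ k, Real.exp (L * z k))

lemma sum_exp_pos [Nonempty ι] (L : ℝ) (z : ι → ℝ) : 0 < ∑ k, Real.exp (L * z k) :=
  Finset.sum_pos (fun _ _ => Real.exp_pos _) Finset.univ_nonempty

lemma softmaxWeight_nonneg (L : ℝ) (z : ι → ℝ) (j : ι) : 0 ≤ softmaxWeight L z j := by
  unfold softmaxWeight; positivity

lemma sum_softmaxWeight [Nonempty ι] (L : ℝ) (z : ι → ℝ) : ∑ j, softmaxWeight L z j = 1 := by
  unfold softmaxWeight
  rw [← Finset.sum_div, div_self (sum_exp_pos L z).ne']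

lemma softmaxWeight_le_one [Nonempty ι] (L : ℝ) (z : ι → ℝ) (j : ι) : softmaxWeight L z j ≤ 1 := by
  rw [← sum_softmaxWeight L z]
  exact Finset.single_le_sum (fun i _ => softmaxWeight_nonneg L z i) (Finset.mem_univ j)

lemma softmaxAvg_const [Nonempty ι] (L : ℝ) (z : ι → ℝ) (c : ℝ) :
    softmaxAvg L z (fun _ => c) = c := by
  simp [softmaxAvg, ← Finset.sum_mul, sum_softmaxWeight]

lemma softmaxAvg_add (L : ℝ) (z v w : ι → ℝ) :
    softmaxAvg L z (fun j => v j + w j) = softmaxAvg L z v + softmaxAvg L z w := by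
  simp [softmaxAvg, mul_add, Finset.sum_add_distrib]

lemma softmaxAvg_sum {κ : Type*} (s : Finset κ) (L : ℝ) (z : ι → ℝ) (c : κ → ℝ)
    (v : κ → ι → ℝ) :
    softmaxAvg L z (fun j => ∑ r ∈ s, c r * v r j) = ∑ r ∈ s, c r * softmaxAvg L z (v r) := by
  simp only [softmaxAvg, Finset.mul_sum]
  rw [Finset.sum_comm]
  exact Finset.sum_congr rfl fun _ _ => Finset.sum_congr rfl fun _ _ => by ring

lemma softmaxAvg_mono (L : ℝ) (z : ι → ℝ) {v w : ι → ℝ} (h : ∀ j, v j ≤ w j) :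
    softmaxAvg L z v ≤ softmaxAvg L z w :=
  Finset.sum_le_sum fun j _ => mul_le_mul_of_nonneg_left (h j) (softmaxWeight_nonneg L z j)

lemma softmaxAvg_nonneg (L : ℝ) (z : ι → ℝ) {v : ι → ℝ} (h : ∀ j, 0 ≤ v j) :
    0 ≤ softmaxAvg L z v :=
  Finset.sum_nonneg fun j _ => mul_nonneg (softmaxWeight_nonneg L z j) (h j)

lemma abs_softmaxAvg_le (L : ℝ) (z v : ι → ℝ) :
    |softmaxAvg L z v| ≤ softmaxAvg L z (fun j => |v j|) := by
  refine (Finset.abs_sum_le_sum_abs _ _).trans (le_of_eq (Finset.sum_congr rfl fun j _ => ?_))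
  rw [abs_mul, abs_of_nonneg (softmaxWeight_nonneg L z j)]

lemma softmaxAvg_le_sum [Nonempty ι] (L : ℝ) (z : ι → ℝ) {v : ι → ℝ} (h : ∀ j, 0 ≤ v j) :
    softmaxAvg L z v ≤ ∑ j, v j :=
  Finset.sum_le_sum fun j _ => mul_le_of_le_one_left (h j) (softmaxWeight_le_one L z j)

lemma hasDerivAt_sum_exp (L : ℝ) (z w : ι → ℝ) (t : ℝ) :
    HasDerivAt (fun t : ℝ => ∑ k, Real.exp (L * (z + t • w) k))
      (∑ k, Real.exp (L * (z + t • w) k) * (L * w k)) t := by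
  apply HasDerivAt.fun_sum
  intro k _
  apply HasDerivAt.exp
  have : HasDerivAt (fun t : ℝ => (z + t • w) k) (w k) t := by
    simpa using ((hasDerivAt_id t).mul_const (w k)).const_add (z k)
  exact this.const_mul L

lemma hasDerivAt_softmaxWeight [Nonempty ι] (L : ℝ) (z w : ι → ℝ) (j : ι) (t : ℝ) :
    HasDerivAt (fun t : ℝ => softmaxWeight L (z + t • w) j)
      (L * (softmaxWeight L (z + t • w) j * w j
        - softmaxWeight L (z + t • w) j * softmaxAvg L (z + t • w) w)) t := by
  have hS := sum_exp_pos L (z + t • w)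
  have h1 : HasDerivAt (fun t : ℝ => Real.exp (L * (z + t • w) j))
      (Real.exp (L * (z + t • w) j) * (L * w j)) t := by
    apply HasDerivAt.exp
    have : HasDerivAt (fun t : ℝ => (z + t • w) j) (w j) t := by
      simpa using ((hasDerivAt_id t).mul_const (w j)).const_add (z j)
    exact this.const_mul L
  refine (h1.div (hasDerivAt_sum_exp L z w t) hS.ne').congr_deriv ?_
  have h3 : ∑ k, Real.exp (L * (z + t • w) k) * (L * w k)
      = L * (∑ k, Real.exp (L * (z + t • w) k)) * softmaxAvg L (z + t • w) w := by
    unfold softmaxAvg softmaxWeight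
    rw [Finset.mul_sum (s := Finset.univ)]
    refine Finset.sum_congr rfl fun k _ => ?_
    field_simp
  rw [h3]
  unfold softmaxWeight
  field_simp

lemma hasDerivAt_softmaxAvg [Nonempty ι] (L : ℝ) (z w v : ι → ℝ) (t : ℝ) :
    HasDerivAt (fun t : ℝ => softmaxAvg L (z + t • w) v)
      (L * (softmaxAvg L (z + t • w) (fun j => v j * w j)
        - softmaxAvg L (z + t • w) v * softmaxAvg L (z + t • w) w)) t := by
  have h := HasDerivAt.fun_sum (u := Finset.univ) fun j _ =>
    (hasDerivAt_softmaxWeight L z w j t).mul_const (v j)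
  refine h.congr_deriv ?_
  rw [softmaxAvg.eq_def L _ v, softmaxAvg.eq_def L _ fun j => v j * w j, Finset.sum_mul,
    ← Finset.sum_sub_distrib, Finset.mul_sum]
  exact Finset.sum_congr rfl fun j _ => by ring

lemma hasDerivAt_smoothMax [Nonempty ι] {L : ℝ} (hL : L ≠ 0) (z w : ι → ℝ) (t : ℝ) :
    HasDerivAt (fun t : ℝ => smoothMax L (z + t • w)) (softmaxAvg L (z + t • w) w) t := by
  have hS := sum_exp_pos L (z + t • w)
  have h := ((hasDerivAt_sum_exp L z w t).log hS.ne').const_mul L⁻¹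
  refine h.congr_deriv ?_
  unfold softmaxAvg softmaxWeight
  rw [Finset.sum_div, Finset.mul_sum]
  refine Finset.sum_congr rfl fun k _ => ?_
  field_simp

lemma le_smoothMax [Nonempty ι] {L : ℝ} (hL : 0 < L) (z : ι → ℝ) (j : ι) : z j ≤ smoothMax L z := by
  unfold smoothMax
  rw [← div_eq_inv_mul, le_div_iff₀ hL, mul_comm, Real.le_log_iff_exp_le (sum_exp_pos L z)]
  exact Finset.single_le_sum (f := fun k => Real.exp (L * z k)) (fun _ _ => (Real.exp_pos _).le)
    (Finset.mem_univ j)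

lemma smoothMax_le [Nonempty ι] {L : ℝ} (hL : 0 < L) (z : ι → ℝ) {a : ℝ} (h : ∀ j, z j ≤ a) :
    smoothMax L z ≤ a + Real.log (Fintype.card ι) / L := by
  unfold smoothMax
  have h1 : ∑ k, Real.exp (L * z k) ≤ Fintype.card ι * Real.exp (L * a) := by
    rw [← nsmul_eq_mul]
    exact Finset.sum_le_card_nsmul _ _ _ fun j _ =>
      Real.exp_le_exp.2 (mul_le_mul_of_nonneg_left (h j) hL.le)
  have h2 := Real.log_le_log (sum_exp_pos L z) h1
  rw [Real.log_mul (by simp) (Real.exp_pos _).ne', Real.log_exp] at h2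
  rw [← div_eq_inv_mul, div_le_iff₀ hL, add_mul, div_mul_cancel₀ _ hL.ne']
  linarith

lemma softmaxWeight_le_exp [Nonempty ι] {L : ℝ} (hL : 0 < L) {z z' : ι → ℝ}
    (h : ∀ j, |z j - z' j| ≤ L⁻¹) (j : ι) :
    softmaxWeight L z j ≤ Real.exp 2 * softmaxWeight L z' j := by
  have hk : ∀ j, L * z j ≤ 1 + L * z' j ∧ L * z' j ≤ 1 + L * z j := by
    intro j
    have h1 := abs_le.1 (h j)
    have h2 : L * L⁻¹ = 1 := mul_inv_cancel₀ hL.ne'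
    constructor <;> nlinarith
  unfold softmaxWeight
  rw [← mul_div_assoc, div_le_div_iff₀ (sum_exp_pos L z) (sum_exp_pos L z')]
  have h1 : Real.exp (L * z j) ≤ Real.exp 1 * Real.exp (L * z' j) := by
    rw [← Real.exp_add]; exact Real.exp_le_exp.2 (hk j).1
  have h2 : ∑ k, Real.exp (L * z' k) ≤ Real.exp 1 * ∑ k, Real.exp (L * z k) := by
    rw [Finset.mul_sum]
    refine Finset.sum_le_sum fun k _ => ?_
    rw [← Real.exp_add]; exact Real.exp_le_exp.2 (hk k).2
  calc _ ≤ (Real.exp 1 * Real.exp (L * z' j)) * (Real.exp 1 * ∑ k, Real.exp (L * z k)) := by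
        gcongr
    _ = (Real.exp 1 * Real.exp 1) * Real.exp (L * z' j) * ∑ k, Real.exp (L * z k) := by ring
    _ = _ := by rw [← Real.exp_add]; norm_num

lemma maxNear_of_smoothMax_mem [Nonempty ι] {L : ℝ} (hL : 0 < L)
    (hcard : Real.log (Fintype.card ι) / L ≤ 1 / 2) {z : ι → ℝ}
    (h : smoothMax L z ∈ Set.Icc (0 : ℝ) 1) : MaxNear 1 z := by
  refine ⟨fun j => (le_smoothMax hL z j).trans h.2, ?_⟩
  by_contra! hc
  have := smoothMax_le hL z (a := -1) fun j => (hc j).le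
  linarith [h.1]

end Softmax

/-- A thrice differentiable function decreasing from `1` on `(-∞, 0]` to `0` on `[1, ∞)`, with its
derivatives and a common bound of them. -/
structure SmoothStep where
  /-- the function -/
  g0 : ℝ → ℝ
  /-- its first derivative -/
  g1 : ℝ → ℝ
  /-- its second derivative -/
  g2 : ℝ → ℝ
  /-- its third derivative -/
  g3 : ℝ → ℝ
  /-- the bound -/
  K : ℝ
  one_le_K : 1 ≤ K
  d0 : ∀ t, HasDerivAt g0 (g1 t) t
  d1 : ∀ t, HasDerivAt g1 (g2 t) t
  d2 : ∀ t, HasDerivAt g2 (g3 t) t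
  g0_nonneg : ∀ t, 0 ≤ g0 t
  g0_le_one : ∀ t, g0 t ≤ 1
  g0_eq_one : ∀ t ≤ 0, g0 t = 1
  g0_eq_zero : ∀ t, 1 ≤ t → g0 t = 0
  g1_le : ∀ t, |g1 t| ≤ K
  g2_le : ∀ t, |g2 t| ≤ K
  g3_le : ∀ t, |g3 t| ≤ K
  g1_supp : ∀ t, t ∉ Set.Icc (0 : ℝ) 1 → g1 t = 0
  g2_supp : ∀ t, t ∉ Set.Icc (0 : ℝ) 1 → g2 t = 0
  g3_supp : ∀ t, t ∉ Set.Icc (0 : ℝ) 1 → g3 t = 0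

theorem nonempty_smoothStep : Nonempty SmoothStep := by
  let g : ℝ → ℝ := fun t => 1 - Real.smoothTransition t
  have hg : ContDiff ℝ 3 g := contDiff_const.sub Real.smoothTransition.contDiff
  have hd : ∀ k : ℕ, k < 3 → ∀ t, HasDerivAt (iteratedDeriv k g) (iteratedDeriv (k + 1) g t) t := by
    intro k hk t
    rw [iteratedDeriv_succ]
    exact (hg.differentiable_iteratedDeriv k (by exact_mod_cast hk) t).hasDerivAt
  have hsupp : ∀ k : ℕ, ∀ t, t ∉ Set.Icc (0 : ℝ) 1 → iteratedDeriv (k + 1) g t = 0 := by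
    intro k t ht
    have hc : ∃ c : ℝ, g =ᶠ[nhds t] fun _ => c := by
      rcases lt_or_ge t 0 with h | h
      · exact ⟨1, by
          filter_upwards [Iio_mem_nhds h] with x hx
          simp [g, Real.smoothTransition.zero_of_nonpos (le_of_lt hx)]⟩
      · have h1 : 1 < t := by
          by_contra! h1
          exact ht ⟨h, h1⟩
        exact ⟨0, by
          filter_upwards [Ioi_mem_nhds h1] with x hx
          simp [g, Real.smoothTransition.one_of_one_le (le_of_lt hx)]⟩
    obtain ⟨c, hc⟩ := hc
    rw [hc.iteratedDeriv_eq]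
    simp [iteratedDeriv_const]
  have hb : ∀ k : ℕ, k < 3 → ∃ C, ∀ t, |iteratedDeriv (k + 1) g t| ≤ C := by
    intro k hk
    have hcont : Continuous (iteratedDeriv (k + 1) g) :=
      hg.continuous_iteratedDeriv (k + 1) (by exact_mod_cast hk)
    obtain ⟨C, hC⟩ := (isCompact_Icc (a := (0 : ℝ)) (b := 1)).exists_bound_of_continuousOn
      hcont.continuousOn
    refine ⟨C, fun t => ?_⟩
    by_cases ht : t ∈ Set.Icc (0 : ℝ) 1
    · exact hC t ht
    · rw [hsupp k t ht, abs_zero]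
      exact (norm_nonneg _).trans (hC 0 (by simp))
  obtain ⟨C1, h1⟩ := hb 0 (by norm_num)
  obtain ⟨C2, h2⟩ := hb 1 (by norm_num)
  obtain ⟨C3, h3⟩ := hb 2 (by norm_num)
  exact ⟨{
    g0 := iteratedDeriv 0 g
    g1 := iteratedDeriv 1 g
    g2 := iteratedDeriv 2 g
    g3 := iteratedDeriv 3 g
    K := max 1 (max C1 (max C2 C3))
    one_le_K := le_max_left _ _
    d0 := hd 0 (by norm_num)
    d1 := hd 1 (by norm_num)
    d2 := hd 2 (by norm_num)
    g0_nonneg := fun t => by simpa [g] using Real.smoothTransition.le_one t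
    g0_le_one := fun t => by simpa [g] using Real.smoothTransition.nonneg t
    g0_eq_one := fun t ht => by simp [g, Real.smoothTransition.zero_of_nonpos ht]
    g0_eq_zero := fun t ht => by simp [g, Real.smoothTransition.one_of_one_le ht]
    g1_le := fun t => (h1 t).trans (by simp)
    g2_le := fun t => (h2 t).trans (by simp)
    g3_le := fun t => (h3 t).trans (by simp)
    g1_supp := hsupp 0
    g2_supp := hsupp 1
    g3_supp := hsupp 2 }⟩

section SmoothIndicator

variable {ι : Type*} [Fintype ι]

/-- The first derivative of `z ↦ g0 (smoothMax L z)` in the direction `x`. -/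
noncomputable def SmoothStep.D1 (g : SmoothStep) (L : ℝ) (z x : ι → ℝ) : ℝ :=
  g.g1 (smoothMax L z) * softmaxAvg L z x

/-- The second derivative of `z ↦ g0 (smoothMax L z)` in the directions `x` and `y`. -/
noncomputable def SmoothStep.D2 (g : SmoothStep) (L : ℝ) (z x y : ι → ℝ) : ℝ :=
  g.g2 (smoothMax L z) * softmaxAvg L z x * softmaxAvg L z y +
    L * g.g1 (smoothMax L z) *
      (softmaxAvg L z (fun j => x j * y j) - softmaxAvg L z x * softmaxAvg L z y)

/-- The third derivative of `z ↦ g0 (smoothMax L z)` in the directions `x`, `y` and `w`. -/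
noncomputable def SmoothStep.D3 (g : SmoothStep) (L : ℝ) (z x y w : ι → ℝ) : ℝ :=
  g.g3 (smoothMax L z) * (softmaxAvg L z w * softmaxAvg L z x * softmaxAvg L z y) +
    L * g.g2 (smoothMax L z) *
      (softmaxAvg L z (fun j => x j * w j) * softmaxAvg L z y
        + softmaxAvg L z (fun j => y j * w j) * softmaxAvg L z x
        + softmaxAvg L z (fun j => x j * y j) * softmaxAvg L z w
        - 3 * (softmaxAvg L z w * softmaxAvg L z x * softmaxAvg L z y)) +
    L ^ 2 * g.g1 (smoothMax L z) *
      (softmaxAvg L z (fun j => x j * y j * w j)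
        - softmaxAvg L z (fun j => x j * w j) * softmaxAvg L z y
        - softmaxAvg L z (fun j => y j * w j) * softmaxAvg L z x
        - softmaxAvg L z (fun j => x j * y j) * softmaxAvg L z w
        + 2 * (softmaxAvg L z w * softmaxAvg L z x * softmaxAvg L z y))

/-- The Hessian matrix of `z ↦ g0 (smoothMax L z)`. -/
noncomputable def SmoothStep.hess [DecidableEq ι] (g : SmoothStep) (L : ℝ) (z : ι → ℝ) (j k : ι) :
    ℝ :=
  g.g2 (smoothMax L z) * softmaxWeight L z j * softmaxWeight L z k +
    L * g.g1 (smoothMax L z) *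
      ((if j = k then softmaxWeight L z j else 0) - softmaxWeight L z j * softmaxWeight L z k)

variable (g : SmoothStep)

lemma SmoothStep.D2_eq_sum [DecidableEq ι] (L : ℝ) (z x y : ι → ℝ) :
    g.D2 L z x y = ∑ j, ∑ k, x j * y k * g.hess L z j k := by
  have h1 : softmaxAvg L z x * softmaxAvg L z y
      = ∑ j, ∑ k, x j * y k * (softmaxWeight L z j * softmaxWeight L z k) := by
    unfold softmaxAvg
    rw [Finset.sum_mul_sum]
    exact Finset.sum_congr rfl fun j _ => Finset.sum_congr rfl fun k _ => by ring
  have h2 : softmaxAvg L z (fun j => x j * y j)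
      = ∑ j, ∑ k, x j * y k * (if j = k then softmaxWeight L z j else 0) := by
    unfold softmaxAvg
    refine Finset.sum_congr rfl fun j _ => ?_
    simp [mul_comm]
  unfold SmoothStep.D2 SmoothStep.hess
  rw [mul_assoc, h1, h2, ← Finset.sum_sub_distrib, Finset.mul_sum, Finset.mul_sum,
    ← Finset.sum_add_distrib]
  refine Finset.sum_congr rfl fun j _ => ?_
  rw [← Finset.sum_sub_distrib, Finset.mul_sum, Finset.mul_sum, ← Finset.sum_add_distrib]
  exact Finset.sum_congr rfl fun k _ => by ring

lemma SmoothStep.hasDerivAt_D1 [Nonempty ι] {L : ℝ} (hL : L ≠ 0) (z w x : ι → ℝ) (t : ℝ) :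
    HasDerivAt (fun t : ℝ => g.D1 L (z + t • w) x) (g.D2 L (z + t • w) x w) t := by
  have h1 := (g.d1 _).comp t (hasDerivAt_smoothMax hL z w t)
  refine (h1.mul (hasDerivAt_softmaxAvg L z w x t)).congr_deriv ?_
  simp only [SmoothStep.D2, Function.comp]
  ring

lemma SmoothStep.hasDerivAt_D2 [Nonempty ι] {L : ℝ} (hL : L ≠ 0) (z w x y : ι → ℝ) (t : ℝ) :
    HasDerivAt (fun t : ℝ => g.D2 L (z + t • w) x y) (g.D3 L (z + t • w) x y w) t := by
  have h1 := (g.d1 _).comp t (hasDerivAt_smoothMax hL z w t)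
  have h2 := (g.d2 _).comp t (hasDerivAt_smoothMax hL z w t)
  have hx := hasDerivAt_softmaxAvg L z w x t
  have hy := hasDerivAt_softmaxAvg L z w y t
  have hxy := hasDerivAt_softmaxAvg L z w (fun j => x j * y j) t
  refine (((h2.mul hx).mul hy).add ((h1.const_mul L).mul (hxy.sub (hx.mul hy)))).congr_deriv ?_
  simp only [SmoothStep.D3, Function.comp, Pi.mul_apply, Pi.sub_apply]
  ring

lemma SmoothStep.D2_sum {κ : Type*} (s : Finset κ) (L : ℝ) (z x : ι → ℝ) (c : κ → ℝ)
    (w : κ → ι → ℝ) :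
    g.D2 L z x (fun j => ∑ r ∈ s, c r * w r j) = ∑ r ∈ s, c r * g.D2 L z x (w r) := by
  have h : (fun j => x j * ∑ r ∈ s, c r * w r j) = fun j => ∑ r ∈ s, c r * (x j * w r j) := by
    funext j
    rw [Finset.mul_sum]
    exact Finset.sum_congr rfl fun r _ => by ring
  simp only [SmoothStep.D2, h]
  rw [softmaxAvg_sum s L z c w, softmaxAvg_sum s L z c fun r j => x j * w r j]
  simp only [Finset.mul_sum, ← Finset.sum_sub_distrib, ← Finset.sum_add_distrib]
  exact Finset.sum_congr rfl fun r _ => by ring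

lemma SmoothStep.D3_sum {κ : Type*} (s : Finset κ) (L : ℝ) (z x y : ι → ℝ) (c : κ → ℝ)
    (w : κ → ι → ℝ) :
    g.D3 L z x y (fun j => ∑ r ∈ s, c r * w r j) = ∑ r ∈ s, c r * g.D3 L z x y (w r) := by
  have h : ∀ x : ι → ℝ,
      softmaxAvg L z (fun j => x j * ∑ r ∈ s, c r * w r j)
        = ∑ r ∈ s, c r * softmaxAvg L z (fun j => x j * w r j) := by
    intro x
    rw [← softmaxAvg_sum]
    congr 1
    funext j
    rw [Finset.mul_sum]
    exact Finset.sum_congr rfl fun r _ => by ring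
  simp only [SmoothStep.D3]
  rw [h x, h y, h fun j => x j * y j, softmaxAvg_sum s L z c w]
  simp only [Finset.mul_sum, Finset.sum_mul, ← Finset.sum_sub_distrib, ← Finset.sum_add_distrib]
  exact Finset.sum_congr rfl fun r _ => by ring

lemma mul_mul_le_cube_add {a b c : ℝ} (ha : 0 ≤ a) (hb : 0 ≤ b) (hc : 0 ≤ c) :
    a * b * c ≤ a ^ 3 + b ^ 3 + c ^ 3 := by
  nlinarith [mul_nonneg (add_nonneg (add_nonneg ha hb) hc)
    (add_nonneg (add_nonneg (sq_nonneg (a - b)) (sq_nonneg (b - c))) (sq_nonneg (a - c))),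
    mul_nonneg (mul_nonneg ha hb) hc]

lemma softmaxAvg_pow_three_le [Nonempty ι] (L : ℝ) (z : ι → ℝ) {v : ι → ℝ} (hv : ∀ j, 0 ≤ v j) :
    softmaxAvg L z v ^ 3 ≤ softmaxAvg L z (fun j => v j ^ 3) :=
  Real.pow_arith_mean_le_arith_mean_pow Finset.univ _ _ (fun j _ => softmaxWeight_nonneg L z j)
    (sum_softmaxWeight L z) (fun j _ => hv j) 3

lemma abs_softmaxAvg_cumulant_le [Nonempty ι] (L : ℝ) (z x y w : ι → ℝ) :
    |softmaxAvg L z x * softmaxAvg L z y * softmaxAvg L z w| ≤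
        softmaxAvg L z (fun j => |x j| ^ 3) + softmaxAvg L z (fun j => |y j| ^ 3)
          + softmaxAvg L z (fun j => |w j| ^ 3) ∧
    |softmaxAvg L z (fun j => x j * y j) * softmaxAvg L z w| ≤
        softmaxAvg L z (fun j => |x j| ^ 3) + softmaxAvg L z (fun j => |y j| ^ 3)
          + softmaxAvg L z (fun j => |w j| ^ 3) ∧
    |softmaxAvg L z (fun j => x j * y j * w j)| ≤
        softmaxAvg L z (fun j => |x j| ^ 3) + softmaxAvg L z (fun j => |y j| ^ 3)
          + softmaxAvg L z (fun j => |w j| ^ 3) := by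
  have hJ : ∀ v : ι → ℝ, |softmaxAvg L z v| ^ 3 ≤ softmaxAvg L z (fun j => |v j| ^ 3) := fun v =>
    (pow_le_pow_left₀ (abs_nonneg _) (abs_softmaxAvg_le L z v) 3).trans
      (softmaxAvg_pow_three_le L z fun j => abs_nonneg _)
  refine ⟨?_, ?_, ?_⟩
  · rw [abs_mul, abs_mul]
    exact (mul_mul_le_cube_add (abs_nonneg _) (abs_nonneg _) (abs_nonneg _)).trans
      (add_le_add (add_le_add (hJ x) (hJ y)) (hJ w))
  · rw [abs_mul]
    have h1 := mul_le_mul_of_nonneg_right (abs_softmaxAvg_le L z fun j => x j * y j)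
      (abs_nonneg (softmaxAvg L z w))
    refine h1.trans ?_
    have h2 : softmaxAvg L z (fun j => |x j * y j|) * |softmaxAvg L z w|
        = softmaxAvg L z (fun j => |x j| * |y j| * |softmaxAvg L z w|) := by
      generalize |softmaxAvg L z w| = c
      unfold softmaxAvg
      rw [Finset.sum_mul]
      exact Finset.sum_congr rfl fun j _ => by simp only [abs_mul]; ring
    rw [h2]
    refine (softmaxAvg_mono L z fun j =>
      mul_mul_le_cube_add (abs_nonneg _) (abs_nonneg _) (abs_nonneg _)).trans ?_
    rw [softmaxAvg_add L z (fun j => |x j| ^ 3 + |y j| ^ 3) fun _ => |softmaxAvg L z w| ^ 3,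
      softmaxAvg_add, softmaxAvg_const]
    gcongr
    exact hJ w
  · refine (abs_softmaxAvg_le L z _).trans ?_
    rw [← softmaxAvg_add, ← softmaxAvg_add]
    refine softmaxAvg_mono L z fun j => ?_
    rw [abs_mul, abs_mul]
    exact mul_mul_le_cube_add (abs_nonneg _) (abs_nonneg _) (abs_nonneg _)

open Classical in
/-- The softmax average of `v`, restricted to the points `z` whose maximum is within `a` of `0`. -/
noncomputable def localAvg (a L : ℝ) (z v : ι → ℝ) : ℝ :=
  if MaxNear a z then softmaxAvg L z v else 0

lemma localAvg_nonneg (a L : ℝ) (z : ι → ℝ) {v : ι → ℝ} (h : ∀ j, 0 ≤ v j) :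
    0 ≤ localAvg a L z v := by
  unfold localAvg
  split_ifs
  · exact softmaxAvg_nonneg L z h
  · exact le_rfl

lemma localAvg_le_sum [Nonempty ι] (a L : ℝ) (z : ι → ℝ) {v : ι → ℝ} (h : ∀ j, 0 ≤ v j) :
    localAvg a L z v ≤ ∑ j, v j := by
  unfold localAvg
  split_ifs
  · exact softmaxAvg_le_sum L z h
  · exact Finset.sum_nonneg fun j _ => h j

lemma localAvg_le_of_close [Nonempty ι] {L : ℝ} (hL : 1 ≤ L) {z z' v : ι → ℝ} (hv : ∀ j, 0 ≤ v j)
    (h : ∀ j, |z j - z' j| ≤ L⁻¹) : localAvg 1 L z v ≤ Real.exp 2 * localAvg 2 L z' v := by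
  by_cases hz : MaxNear 1 z
  · have hz' : MaxNear 2 z' := by
      have := hz.of_close fun j => (h j).trans (inv_le_one_of_one_le₀ hL)
      norm_num at this
      exact this
    rw [localAvg, localAvg, if_pos hz, if_pos hz', softmaxAvg, softmaxAvg, Finset.mul_sum]
    refine Finset.sum_le_sum fun j _ => ?_
    rw [← mul_assoc]
    exact mul_le_mul_of_nonneg_right (softmaxWeight_le_exp (by linarith) h j) (hv j)
  · rw [localAvg, if_neg hz]
    exact mul_nonneg (Real.exp_pos _).le (localAvg_nonneg _ _ _ hv)

lemma SmoothStep.abs_D3_le [Nonempty ι] {L : ℝ} (hL : 1 ≤ L)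
    (hcard : Real.log (Fintype.card ι) / L ≤ 1 / 2) (z x y w : ι → ℝ) :
    |g.D3 L z x y w| ≤ 16 * g.K * L ^ 2 * (localAvg 1 L z (fun j => |x j| ^ 3)
      + localAvg 1 L z (fun j => |y j| ^ 3) + localAvg 1 L z (fun j => |w j| ^ 3)) := by
  have hK := g.one_le_K
  by_cases hz : smoothMax L z ∈ Set.Icc (0 : ℝ) 1
  · have hm := maxNear_of_smoothMax_mem (by linarith) hcard hz
    simp only [localAvg, if_pos hm]
    obtain ⟨h1, h2, h3⟩ := abs_softmaxAvg_cumulant_le L z x y w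
    obtain ⟨-, h4, -⟩ := abs_softmaxAvg_cumulant_le L z x w y
    obtain ⟨-, h5, -⟩ := abs_softmaxAvg_cumulant_le L z y w x
    set A := softmaxAvg L z (fun j => |x j| ^ 3) + softmaxAvg L z (fun j => |y j| ^ 3)
          + softmaxAvg L z (fun j => |w j| ^ 3) with hA
    have hA0 : 0 ≤ A := (abs_nonneg _).trans h1
    have h1' : |softmaxAvg L z w * softmaxAvg L z x * softmaxAvg L z y| ≤ A := by
      convert h1 using 2; ring
    have h4' : |softmaxAvg L z (fun j => x j * w j) * softmaxAvg L z y| ≤ A := by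
      linarith
    have h5' : |softmaxAvg L z (fun j => y j * w j) * softmaxAvg L z x| ≤ A := by
      linarith
    unfold SmoothStep.D3
    set p := softmaxAvg L z w * softmaxAvg L z x * softmaxAvg L z y
    set q1 := softmaxAvg L z (fun j => x j * w j) * softmaxAvg L z y
    set q2 := softmaxAvg L z (fun j => y j * w j) * softmaxAvg L z x
    set q3 := softmaxAvg L z (fun j => x j * y j) * softmaxAvg L z w
    have e1 : |q1 + q2 + q3 - 3 * p| ≤ 6 * A := by
      rw [abs_le] at *
      constructor <;> linarith
    have e2 : |softmaxAvg L z (fun j => x j * y j * w j) - q1 - q2 - q3 + 2 * p| ≤ 6 * A := by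
      rw [abs_le] at *
      constructor <;> linarith
    have hL2 : L ≤ L ^ 2 := by nlinarith
    have hL3 : 1 ≤ L ^ 2 := by nlinarith
    have b1 : |g.g3 (smoothMax L z) * p| ≤ g.K * L ^ 2 * A := by
      rw [abs_mul]
      calc _ ≤ g.K * A := mul_le_mul (g.g3_le _) h1' (abs_nonneg _) (by linarith)
        _ = g.K * 1 * A := by ring
        _ ≤ _ := by gcongr
    have b2 : |L * g.g2 (smoothMax L z) * (q1 + q2 + q3 - 3 * p)| ≤ g.K * L ^ 2 * (6 * A) := by
      rw [abs_mul, abs_mul, abs_of_pos (by linarith : 0 < L)]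
      calc _ ≤ L ^ 2 * g.K * (6 * A) := by
            gcongr
            exact g.g2_le _
        _ = _ := by ring
    have b3 : |L ^ 2 * g.g1 (smoothMax L z) *
        (softmaxAvg L z (fun j => x j * y j * w j) - q1 - q2 - q3 + 2 * p)|
        ≤ g.K * L ^ 2 * (6 * A) := by
      rw [abs_mul, abs_mul, abs_of_pos (by positivity : 0 < L ^ 2)]
      calc _ ≤ L ^ 2 * g.K * (6 * A) := by
            gcongr
            exact g.g1_le _
        _ = _ := by ring
    refine (abs_add_three _ _ _).trans ((add_le_add (add_le_add b1 b2) b3).trans ?_)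
    have : 0 ≤ g.K * L ^ 2 * A := by positivity
    linarith
  · have h0 : g.D3 L z x y w = 0 := by
      simp [SmoothStep.D3, g.g1_supp _ hz, g.g2_supp _ hz, g.g3_supp _ hz]
    rw [h0, abs_zero]
    have hx := fun v : ι → ℝ => localAvg_nonneg 1 L z (v := fun j => |v j| ^ 3)
      fun j => by positivity
    have := hx x
    have := hx y
    have := hx w
    positivity

lemma SmoothStep.abs_D1_le [Nonempty ι] (L : ℝ) (z x : ι → ℝ) :
    |g.D1 L z x| ≤ g.K * ∑ j, |x j| := by
  rw [SmoothStep.D1, abs_mul]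
  exact mul_le_mul (g.g1_le _) ((abs_softmaxAvg_le L z x).trans
    (softmaxAvg_le_sum L z fun j => abs_nonneg _)) (abs_nonneg _) (by linarith [g.one_le_K])

lemma SmoothStep.abs_hess_le [Nonempty ι] [DecidableEq ι] {L : ℝ} (hL : 1 ≤ L) (z : ι → ℝ)
    (j k : ι) : |g.hess L z j k| ≤ 2 * g.K * L := by
  have hK := g.one_le_K
  have h0 := softmaxWeight_nonneg L z
  have h1 := softmaxWeight_le_one L z
  have hp : softmaxWeight L z j * softmaxWeight L z k ≤ 1 := mul_le_one₀ (h1 j) (h0 k) (h1 k)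
  have hp0 := mul_nonneg (h0 j) (h0 k)
  unfold SmoothStep.hess
  have b1 : |g.g2 (smoothMax L z) * softmaxWeight L z j * softmaxWeight L z k| ≤ g.K := by
    rw [mul_assoc, abs_mul, abs_of_nonneg hp0]
    calc _ ≤ g.K * 1 := mul_le_mul (g.g2_le _) hp hp0 (by linarith)
      _ = _ := mul_one _
  have b2 : |L * g.g1 (smoothMax L z) * ((if j = k then softmaxWeight L z j else 0)
      - softmaxWeight L z j * softmaxWeight L z k)| ≤ L * g.K := by
    rw [abs_mul, abs_mul, abs_of_pos (by linarith : 0 < L)]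
    have : |(if j = k then softmaxWeight L z j else 0)
      - softmaxWeight L z j * softmaxWeight L z k| ≤ 1 := by
      have hd : 0 ≤ (if j = k then softmaxWeight L z j else 0) ∧
        (if j = k then softmaxWeight L z j else 0) ≤ 1 := by
        split_ifs
        · exact ⟨h0 j, h1 j⟩
        · exact ⟨le_rfl, zero_le_one⟩
      rw [abs_le]
      constructor <;> linarith [hd.1, hd.2]
    calc _ ≤ L * g.K * 1 := by
          gcongr
          exact g.g1_le _
      _ = _ := mul_one _
  refine (abs_add_le _ _).trans ?_
  nlinarith

lemma continuous_softmaxWeight [Nonempty ι] (L : ℝ) (j : ι) :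
    Continuous fun z : ι → ℝ => softmaxWeight L z j := by
  unfold softmaxWeight
  exact Continuous.div (by fun_prop) (by fun_prop) fun z => (sum_exp_pos L z).ne'

lemma continuous_smoothMax [Nonempty ι] (L : ℝ) : Continuous fun z : ι → ℝ => smoothMax L z := by
  unfold smoothMax
  exact continuous_const.mul (Continuous.log (by fun_prop) fun z => (sum_exp_pos L z).ne')

lemma continuous_softmaxAvg [Nonempty ι] (L : ℝ) :
    Continuous fun z : (ι → ℝ) × (ι → ℝ) => softmaxAvg L z.1 z.2 := by
  unfold softmaxAvg
  exact continuous_finsetSum _ fun j _ =>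
    ((continuous_softmaxWeight L j).comp continuous_fst).mul (by fun_prop)

lemma SmoothStep.continuous_g0 : Continuous g.g0 :=
  continuous_iff_continuousAt.2 fun t => (g.d0 t).continuousAt

lemma SmoothStep.continuous_g1 : Continuous g.g1 :=
  continuous_iff_continuousAt.2 fun t => (g.d1 t).continuousAt

lemma SmoothStep.continuous_g2 : Continuous g.g2 :=
  continuous_iff_continuousAt.2 fun t => (g.d2 t).continuousAt

lemma SmoothStep.continuous_D1 [Nonempty ι] (L : ℝ) :
    Continuous fun z : (ι → ℝ) × (ι → ℝ) => g.D1 L z.1 z.2 := by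
  unfold SmoothStep.D1
  exact ((g.continuous_g1.comp ((continuous_smoothMax L).comp continuous_fst))).mul
    (continuous_softmaxAvg L)

lemma SmoothStep.continuous_hess [Nonempty ι] [DecidableEq ι] (L : ℝ) (j k : ι) :
    Continuous fun z : ι → ℝ => g.hess L z j k := by
  unfold SmoothStep.hess
  have h1 := g.continuous_g1.comp (continuous_smoothMax (ι := ι) L)
  have h2 := g.continuous_g2.comp (continuous_smoothMax (ι := ι) L)
  have hj := continuous_softmaxWeight L j
  have hk := continuous_softmaxWeight L k
  refine ((h2.mul hj).mul hk).add ((continuous_const.mul h1).mul (Continuous.sub ?_ (hj.mul hk)))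
  split_ifs
  · exact hj
  · exact continuous_const

lemma measurableSet_maxNear (a : ℝ) : MeasurableSet {z : ι → ℝ | MaxNear a z} := by
  unfold MaxNear
  simp only [Set.ofPred_and, Set.ofPred_forall, Set.ofPred_exists]
  refine (MeasurableSet.iInter fun j => ?_).inter (MeasurableSet.iUnion fun j => ?_)
  · exact measurableSet_le (measurable_pi_apply j) measurable_const
  · exact measurableSet_le measurable_const (measurable_pi_apply j)

end SmoothIndicator

section Stein

lemma integral_id_mul_gaussianReal {v : NNReal} (hv : v ≠ 0) {f f' : ℝ → ℝ} {K : ℝ}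
    (hd : ∀ t, HasDerivAt f (f' t) t) (hf : ∀ t, |f t| ≤ K) (hf' : ∀ t, |f' t| ≤ K) :
    ∫ t, t * f t ∂(gaussianReal 0 v) = v * ∫ t, f' t ∂(gaussianReal 0 v) := by
  have hv0 : (0 : ℝ) < v := by positivity
  have hfm : Measurable f :=
    (continuous_iff_continuousAt.2 fun t => (hd t).continuousAt).measurable
  have hf'm : Measurable f' := by
    have : f' = deriv f := funext fun t => ((hd t).deriv).symm
    rw [this]
    exact measurable_deriv f
  rw [integral_gaussianReal_eq_integral_smul hv, integral_gaussianReal_eq_integral_smul hv]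
  have hp : ∀ t, HasDerivAt (gaussianPDFReal 0 v) (-(t / v) * gaussianPDFReal 0 v t) t := by
    intro t
    unfold gaussianPDFReal
    have h1 : HasDerivAt (fun x : ℝ => -(x - 0) ^ 2 / (2 * v)) (-(t / v)) t := by
      have := ((((hasDerivAt_id t).sub_const 0).pow 2).neg).div_const (2 * (v : ℝ))
      refine this.congr_deriv ?_
      simp
      field_simp
    refine (h1.exp.const_mul _).congr_deriv ?_
    ring
  have i1 : Integrable (fun t => gaussianPDFReal 0 v t * f' t) :=
    (integrable_gaussianPDFReal 0 v).mul_bdd (c := K) hf'm.aestronglyMeasurable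
      (Filter.Eventually.of_forall hf')
  have i2 : Integrable (fun t => gaussianPDFReal 0 v t * f t) :=
    (integrable_gaussianPDFReal 0 v).mul_bdd (c := K) hfm.aestronglyMeasurable
      (Filter.Eventually.of_forall hf)
  have i3 : Integrable (fun t => t * gaussianPDFReal 0 v t) := by
    have h := (integrable_mul_exp_neg_mul_sq (b := (2 * (v : ℝ))⁻¹) (by positivity)).const_mul
      ((Real.sqrt (2 * Real.pi * v))⁻¹)
    refine h.congr (Filter.Eventually.of_forall fun t => ?_)
    simp only [gaussianPDFReal]
    rw [show -(t - 0) ^ 2 / (2 * (v : ℝ)) = -(2 * (v : ℝ))⁻¹ * t ^ 2 by field_simp; ring]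
    ring
  have i4 : Integrable (fun t => (t * gaussianPDFReal 0 v t) * f t) :=
    i3.mul_bdd (c := K) hfm.aestronglyMeasurable (Filter.Eventually.of_forall hf)
  have key := integral_eq_zero_of_hasDerivAt_of_integrable (f := fun t => gaussianPDFReal 0 v t * f t)
    (f' := fun t => gaussianPDFReal 0 v t * f' t - (v : ℝ)⁻¹ * ((t * gaussianPDFReal 0 v t) * f t))
    (fun t => ((hp t).mul (hd t)).congr_deriv (by field_simp; ring)) (i1.sub (i4.const_mul _)) i2
  rw [integral_sub i1 (i4.const_mul _), integral_const_mul] at key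
  have h3 : ∫ t, gaussianPDFReal 0 v t • (t * f t) = ∫ t, (t * gaussianPDFReal 0 v t) * f t :=
    integral_congr_ae (Filter.Eventually.of_forall fun t => by simp; ring)
  rw [h3]
  simp only [smul_eq_mul]
  field_simp at key
  linarith

lemma _root_.ProbabilityTheory.IndepFun.integral_comp_eq_integral_integral
    {Ω 𝓤 𝓥 : Type*} [MeasurableSpace Ω] [MeasurableSpace 𝓤]
    [MeasurableSpace 𝓥] {P : Measure Ω} [IsProbabilityMeasure P] {U : Ω → 𝓤} {V : Ω → 𝓥}
    (hUV : IndepFun U V P) (hU : Measurable U) (hV : Measurable V) {f : 𝓤 × 𝓥 → ℝ}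
    (hf : Measurable f) (hint : Integrable (fun ω => f (U ω, V ω)) P) :
    ∫ ω, f (U ω, V ω) ∂P = ∫ ω, ∫ ω', f (U ω, V ω') ∂P ∂P := by
  have hmap := (indepFun_iff_map_prod_eq_prod_map_map hU.aemeasurable hV.aemeasurable).1 hUV
  have := Measure.isProbabilityMeasure_map (μ := P) hU.aemeasurable
  have := Measure.isProbabilityMeasure_map (μ := P) hV.aemeasurable
  have h1 : ∫ ω, f (U ω, V ω) ∂P = ∫ z, f z ∂(P.map fun ω => (U ω, V ω)) :=
    (integral_map (hU.prodMk hV).aemeasurable hf.aestronglyMeasurable).symm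
  have h2 : Integrable f (P.map fun ω => (U ω, V ω)) :=
    (integrable_map_measure hf.aestronglyMeasurable (hU.prodMk hV).aemeasurable).2 hint
  rw [hmap] at h1 h2
  rw [h1, integral_prod _ h2, integral_map hU.aemeasurable
    (h2.integral_prod_left.aestronglyMeasurable)]
  congr 1
  funext ω
  exact integral_map hV.aemeasurable (hf.comp measurable_prodMk_left).aestronglyMeasurable

variable {ι : Type*} [Fintype ι] [DecidableEq ι]

lemma hasGaussianLaw_eval {Ω : Type*} [MeasurableSpace Ω] {P : Measure Ω}
    {S : Matrix ι ι ℝ} {G : Ω → EuclideanSpace ℝ ι} (hG : HasLaw G (multivariateGaussian 0 S) P) :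
    HasGaussianLaw (fun ω (j : ι) => G ω j) P :=
  hG.hasGaussianLaw.map_equiv_fun (PiLp.continuousLinearEquiv 2 ℝ (fun _ : ι => ℝ))

lemma covariance_multivariateGaussian_coord {Ω : Type*} [MeasurableSpace Ω] {P : Measure Ω}
    {S : Matrix ι ι ℝ} (hS : S.PosSemidef) {G : Ω → EuclideanSpace ℝ ι}
    (hG : HasLaw G (multivariateGaussian 0 S) P) (j k : ι) :
    cov[fun ω => G ω j, fun ω => G ω k; P] = S j k := by
  rw [← covariance_eval_multivariateGaussian (μ := 0) hS j k]
  exact hG.covariance_fun_comp (f := fun x => x j) (g := fun x => x k) (by fun_prop) (by fun_prop)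

lemma hasLaw_multivariateGaussian_coord {Ω : Type*} [MeasurableSpace Ω] {P : Measure Ω}
    {S : Matrix ι ι ℝ} (hS : S.PosSemidef) {G : Ω → EuclideanSpace ℝ ι}
    (hG : HasLaw G (multivariateGaussian 0 S) P) (j : ι) :
    HasLaw (fun ω => G ω j) (gaussianReal 0 (S j j).toNNReal) P := by
  have := (measurePreserving_eval_multivariateGaussian (μ := 0) hS (i := j)).fun_comp_hasLaw hG
  simpa using this

lemma integral_coord_mul_multivariateGaussian {Ω : Type*} [MeasurableSpace Ω] {P : Measure Ω}
    [IsProbabilityMeasure P] {S : Matrix ι ι ℝ} (hS : S.PosSemidef) {G : Ω → EuclideanSpace ℝ ι}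
    (hGm : Measurable G) (hG : HasLaw G (multivariateGaussian 0 S) P) {j : ι} (hj : 0 < S j j)
    {f : (ι → ℝ) → ℝ} {f' : ι → (ι → ℝ) → ℝ} {K : ℝ}
    (hfm : Measurable f) (hf'm : ∀ k, Measurable (f' k)) (hf : ∀ z, |f z| ≤ K)
    (hf' : ∀ k z, |f' k z| ≤ K)
    (hd : ∀ z w : ι → ℝ, ∀ t : ℝ,
      HasDerivAt (fun t : ℝ => f (z + t • w)) (∑ k, w k * f' k (z + t • w)) t) :
    ∫ ω, G ω j * f (fun k => G ω k) ∂P = ∑ k, S j k * ∫ ω, f' k (fun k => G ω k) ∂P := by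
  set ρ : ι → ℝ := fun k => S j k / S j j with hρ
  set R : Ω → ι → ℝ := fun ω k => G ω k - ρ k * G ω j with hR
  have hgl := hasGaussianLaw_eval hG
  have hm2 : ∀ k, MemLp (fun ω => G ω k) 2 P := fun k => (hgl.eval k).memLp_two
  have hGc : ∀ k, Measurable fun ω => G ω k := fun k => by fun_prop
  have hRm : Measurable R := by
    refine measurable_pi_lambda _ fun k => (hGc k).sub ((hGc j).const_mul _)
  have hind0 : IndepFun (fun ω k => R ω k) (fun ω (_ : Unit) => G ω j) P := by
    refine HasGaussianLaw.indepFun_of_covariance_eval (X := fun k ω => R ω k)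
      (Y := fun _ ω => G ω j) ?_ ?_
    · let A : (ι → ℝ) →L[ℝ] (ι → ℝ) × (Unit → ℝ) :=
        (ContinuousLinearMap.pi fun k => ContinuousLinearMap.proj (R := ℝ) (φ := fun _ : ι => ℝ) k
          - ρ k • ContinuousLinearMap.proj (R := ℝ) (φ := fun _ : ι => ℝ) j).prod
        (ContinuousLinearMap.pi fun _ => ContinuousLinearMap.proj (R := ℝ) (φ := fun _ : ι => ℝ) j)
      exact hgl.map_fun A
    · intro k _
      have h1 : (fun ω => R ω k) = (fun ω => G ω k) - fun ω => ρ k * G ω j := rfl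
      rw [h1, covariance_sub_left (hm2 k) ((hm2 j).const_mul _) (hm2 j),
        covariance_const_mul_left, covariance_multivariateGaussian_coord hS hG,
        covariance_multivariateGaussian_coord hS hG]
      have hsym : S k j = S j k := by
        have := hS.1.apply k j
        simpa using this.symm
      rw [hsym, hρ]
      field_simp
      ring
  have hind : IndepFun R (fun ω => G ω j) P :=
    hind0.comp (φ := id) (ψ := fun u : Unit → ℝ => u ()) measurable_id (measurable_pi_apply _)
  have hdec : ∀ ω, (fun k => G ω k) = R ω + G ω j • ρ := by
    intro ω
    funext k
    simp [hR]
    ring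
  have hint : Integrable (fun ω => G ω j) P := (hm2 j).integrable (by norm_num)
  have hsum : Measurable fun p : (ι → ℝ) × ℝ => p.1 + p.2 • ρ := by fun_prop
  have e1 : ∫ ω, G ω j * f (fun k => G ω k) ∂P
      = ∫ ω, ∫ ω', G ω' j * f (R ω + G ω' j • ρ) ∂P ∂P := by
    have h := hind.integral_comp_eq_integral_integral hRm (hGc j)
      (f := fun p => p.2 * f (p.1 + p.2 • ρ)) (measurable_snd.mul (hfm.comp hsum)) ?_
    · refine (integral_congr_ae (Filter.Eventually.of_forall fun ω => ?_)).trans h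
      exact congrArg (fun z => G ω j * f z) (hdec ω)
    · refine hint.mul_bdd (c := K) ?_ (Filter.Eventually.of_forall fun ω => hf _)
      exact (hfm.comp (hsum.comp (hRm.prodMk (hGc j)))).aestronglyMeasurable
  have e2 : ∀ k, ∫ ω, f' k (fun k => G ω k) ∂P
      = ∫ ω, ∫ ω', f' k (R ω + G ω' j • ρ) ∂P ∂P := by
    intro k
    have h := hind.integral_comp_eq_integral_integral hRm (hGc j)
      (f := fun p => f' k (p.1 + p.2 • ρ)) ((hf'm k).comp hsum) ?_
    · refine (integral_congr_ae (Filter.Eventually.of_forall fun ω => ?_)).trans h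
      exact congrArg _ (hdec ω)
    · refine Integrable.of_bound (C := K) ?_ (Filter.Eventually.of_forall fun ω => hf' _ _)
      exact ((hf'm k).comp (hsum.comp (hRm.prodMk (hGc j)))).aestronglyMeasurable
  have hlaw := hasLaw_multivariateGaussian_coord hS hG j
  have e3 : ∀ z : ι → ℝ, ∫ ω', G ω' j * f (z + G ω' j • ρ) ∂P
      = ∑ k, S j k * ∫ ω', f' k (z + G ω' j • ρ) ∂P := by
    intro z
    have hv : (S j j).toNNReal ≠ 0 := by
      simpa using hj
    have hz : Measurable fun t : ℝ => z + t • ρ := by fun_prop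
    have hbk : ∀ t : ℝ, |∑ k, ρ k * f' k (z + t • ρ)| ≤ ∑ k, |ρ k| * K := fun t =>
      (Finset.abs_sum_le_sum_abs _ _).trans (Finset.sum_le_sum fun k _ => by
        rw [abs_mul]; exact mul_le_mul_of_nonneg_left (hf' _ _) (abs_nonneg _))
    have h := integral_id_mul_gaussianReal hv (f := fun t => f (z + t • ρ))
      (f' := fun t => ∑ k, ρ k * f' k (z + t • ρ)) (K := max K (∑ k, |ρ k| * K)) (fun t => hd z ρ t)
      (fun t => (hf _).trans (le_max_left _ _)) (fun t => (hbk t).trans (le_max_right _ _))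
    have h4 := hlaw.integral_comp (f := fun t => t * f (z + t • ρ))
      ((measurable_id.mul (hfm.comp hz)).aestronglyMeasurable)
    have h5 : ∀ k, _ := fun k => hlaw.integral_comp (f := fun t => f' k (z + t • ρ))
      (((hf'm k).comp hz).aestronglyMeasurable)
    simp only [Function.comp_def] at h4 h5
    rw [h4, h, integral_finsetSum, Finset.mul_sum]
    · refine Finset.sum_congr rfl fun k _ => ?_
      rw [h5, integral_const_mul, Real.coe_toNNReal _ hj.le, ← mul_assoc, hρ]
      congr 1
      field_simp
    · intro k _
      refine (Integrable.of_bound (C := K) ((hf'm k).comp hz).aestronglyMeasurable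
        (Filter.Eventually.of_forall fun ω => hf' _ _)).const_mul _
  rw [e1]
  simp only [e3, e2]
  rw [integral_finsetSum]
  · exact Finset.sum_congr rfl fun k _ => integral_const_mul _ _
  · intro k _
    refine Integrable.const_mul (Integrable.of_bound (C := K) ?_ ?_) _
    · have : StronglyMeasurable (Function.uncurry fun ω ω' => f' k (R ω + G ω' j • ρ)) :=
        ((hf'm k).comp (hsum.comp ((hRm.comp measurable_fst).prodMk
          ((hGc j).comp measurable_snd)))).stronglyMeasurable
      exact this.integral_prod_right.aestronglyMeasurable
    · refine Filter.Eventually.of_forall fun ω => ?_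
      refine (norm_integral_le_of_norm_le_const (C := K)
        (Filter.Eventually.of_forall fun ω' => hf' _ _)).trans ?_
      simp

/-- Gaussian integration by parts for the coordinates of `fun k => d k * G k`, in the presence of a
random element `Y` that is independent of `G`. -/
theorem integral_coord_mul_of_indepFun {Ω 𝓨 : Type*} [MeasurableSpace Ω] [MeasurableSpace 𝓨]
    {P : Measure Ω} [IsProbabilityMeasure P] {S : Matrix ι ι ℝ} (hS : S.PosSemidef)
    {G : Ω → EuclideanSpace ℝ ι} (hGm : Measurable G) (hG : HasLaw G (multivariateGaussian 0 S) P)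
    (d : ι → ℝ) {Y : Ω → 𝓨} (hYm : Measurable Y) (hYG : IndepFun Y G P) {j : ι} (hj : 0 < S j j)
    {f : 𝓨 → (ι → ℝ) → ℝ} {f' : ι → 𝓨 → (ι → ℝ) → ℝ} {K : ℝ}
    (hfm : Measurable (Function.uncurry f)) (hf'm : ∀ k, Measurable (Function.uncurry (f' k)))
    (hf : ∀ y z, |f y z| ≤ K) (hf' : ∀ k y z, |f' k y z| ≤ K)
    (hd : ∀ y, ∀ z w : ι → ℝ, ∀ t : ℝ,
      HasDerivAt (fun t : ℝ => f y (z + t • w)) (∑ k, w k * f' k y (z + t • w)) t) :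
    ∫ ω, (d j * G ω j) * f (Y ω) (fun k => d k * G ω k) ∂P
      = ∑ k, (d j * d k * S j k) * ∫ ω, f' k (Y ω) (fun k => d k * G ω k) ∂P := by
  have hgl := hasGaussianLaw_eval hG
  have hint : Integrable (fun ω => G ω j) P := (hgl.eval j).integrable
  have hGc : ∀ k, Measurable fun ω => G ω k := fun k => by fun_prop
  have hdG : Measurable fun p : 𝓨 × EuclideanSpace ℝ ι => (p.1, fun k => d k * p.2 k) := by
    refine measurable_fst.prodMk (measurable_pi_lambda _ fun k => ?_)
    fun_prop
  have hdz : Measurable fun z : ι → ℝ => fun k => d k * z k := by fun_prop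
  have e1 : ∫ ω, (d j * G ω j) * f (Y ω) (fun k => d k * G ω k) ∂P
      = ∫ ω, ∫ ω', (d j * G ω' j) * f (Y ω) (fun k => d k * G ω' k) ∂P ∂P := by
    refine hYG.integral_comp_eq_integral_integral hYm hGm
      (f := fun p => (d j * p.2 j) * f p.1 (fun k => d k * p.2 k))
      (Measurable.mul (by fun_prop) (hfm.comp hdG)) ?_
    refine (hint.const_mul (d j)).mul_bdd (c := K) ?_ (Filter.Eventually.of_forall fun ω => hf _ _)
    exact (hfm.comp (hdG.comp (hYm.prodMk hGm))).aestronglyMeasurable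
  have e2 : ∀ k, ∫ ω, f' k (Y ω) (fun k => d k * G ω k) ∂P
      = ∫ ω, ∫ ω', f' k (Y ω) (fun k => d k * G ω' k) ∂P ∂P := by
    intro k
    refine hYG.integral_comp_eq_integral_integral hYm hGm
      (f := fun p => f' k p.1 (fun k => d k * p.2 k)) ((hf'm k).comp hdG) ?_
    refine Integrable.of_bound (C := K) ?_ (Filter.Eventually.of_forall fun ω => hf' _ _ _)
    exact ((hf'm k).comp (hdG.comp (hYm.prodMk hGm))).aestronglyMeasurable
  have e3 : ∀ y, ∫ ω', (d j * G ω' j) * f y (fun k => d k * G ω' k) ∂P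
      = ∑ k, (d j * d k * S j k) * ∫ ω', f' k y (fun k => d k * G ω' k) ∂P := by
    intro y
    have hK : 0 ≤ K := (abs_nonneg _).trans (hf y 0)
    have h := integral_coord_mul_multivariateGaussian hS hGm hG hj
      (f := fun z => f y (fun k => d k * z k)) (f' := fun k z => d k * f' k y (fun k => d k * z k))
      (K := K + ∑ k, |d k| * K)
      (hfm.comp (measurable_const.prodMk hdz))
      (fun k => ((hf'm k).comp (measurable_const.prodMk hdz)).const_mul _)
      (fun z => (hf _ _).trans (le_add_of_nonneg_right (by positivity)))
      (fun k z => by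
        rw [abs_mul]
        refine le_trans (mul_le_mul_of_nonneg_left (hf' k _ _) (abs_nonneg _)) ?_
        refine le_trans (Finset.single_le_sum (f := fun k => |d k| * K) (fun k _ => by positivity)
          (Finset.mem_univ k)) (le_add_of_nonneg_left hK))
      (fun z w t => by
        have h1 := hd y (fun k => d k * z k) (fun k => d k * w k) t
        have h2 : ∀ t : ℝ, (fun k => d k * (z + t • w) k)
            = (fun k => d k * z k) + t • fun k => d k * w k := by
          intro t
          funext k
          simp
          ring
        simp only [h2]
        refine h1.congr_deriv (Finset.sum_congr rfl fun k _ => by ring))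
    simp only [mul_assoc, integral_const_mul] at h ⊢
    rw [h, Finset.mul_sum]
    exact Finset.sum_congr rfl fun k _ => by ring
  rw [e1]
  simp only [e3, e2]
  rw [integral_finsetSum]
  · exact Finset.sum_congr rfl fun k _ => integral_const_mul _ _
  · intro k _
    refine Integrable.const_mul (Integrable.of_bound (C := K) ?_ ?_) _
    · have : StronglyMeasurable
          (Function.uncurry fun ω ω' => f' k (Y ω) (fun k => d k * G ω' k)) :=
        ((hf'm k).comp (hdG.comp ((hYm.comp measurable_fst).prodMk
          (hGm.comp measurable_snd)))).stronglyMeasurable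
      exact this.integral_prod_right.aestronglyMeasurable
    · refine Filter.Eventually.of_forall fun ω => ?_
      refine (norm_integral_le_of_norm_le_const (C := K)
        (Filter.Eventually.of_forall fun ω' => hf' _ _ _)).trans ?_
      simp

end Stein

section AntiConcentration

lemma one_le_two_mul_log {p : ℕ} (hp : 2 ≤ p) : 1 ≤ 2 * Real.log p := by
  have h1 : Real.log 2 ≤ Real.log p := Real.log_le_log (by norm_num) (by exact_mod_cast hp)
  linarith [Real.log_two_gt_d9]

lemma log_div_two_mul_log_le {p : ℕ} (hp : 2 ≤ p) :
    Real.log p / (2 * Real.log p) ≤ 1 / 2 := by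
  have := one_le_two_mul_log hp
  rw [div_le_div_iff₀ (by linarith) (by norm_num)]
  linarith

lemma abs_le_add_exp {l y : ℝ} (hl : 0 < l) :
    |y| ≤ l + l⁻¹ * Real.exp (-l ^ 2) * (Real.exp (l * y) + Real.exp (-l * y)) := by
  have h1 : l * (|y| - l) + 1 ≤ Real.exp (l * (|y| - l)) := Real.add_one_le_exp _
  have h2 : Real.exp (l * |y|) ≤ Real.exp (l * y) + Real.exp (-l * y) := by
    rcases abs_cases y with ⟨h, -⟩ | ⟨h, -⟩ <;> rw [h]
    · linarith [Real.exp_pos (-l * y)]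
    · rw [mul_neg, ← neg_mul]
      linarith [Real.exp_pos (l * y)]
  have h3 : Real.exp (l * (|y| - l)) = Real.exp (-l ^ 2) * Real.exp (l * |y|) := by
    rw [← Real.exp_add]; congr 1; ring
  have h4 : Real.exp (-l ^ 2) * Real.exp (l * |y|)
      ≤ Real.exp (-l ^ 2) * (Real.exp (l * y) + Real.exp (-l * y)) := by gcongr
  have h5 : l * (|y| - l) ≤ Real.exp (-l ^ 2) * (Real.exp (l * y) + Real.exp (-l * y)) := by
    linarith
  have h6 : |y| - l ≤ l⁻¹ * (Real.exp (-l ^ 2) * (Real.exp (l * y) + Real.exp (-l * y))) := by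
    rw [← div_eq_inv_mul, le_div_iff₀ hl]
    linarith
  linarith

variable {ι : Type*} [Fintype ι] [DecidableEq ι]

lemma integrable_exp_mul_coord {Ω : Type*} [MeasurableSpace Ω] {P : Measure Ω}
    {S : Matrix ι ι ℝ} (hS : S.PosSemidef) {G : Ω → EuclideanSpace ℝ ι}
    (hG : HasLaw G (multivariateGaussian 0 S) P) (j : ι) (t : ℝ) :
    Integrable (fun ω => Real.exp (t * G ω j)) P ∧
      ∫ ω, Real.exp (t * G ω j) ∂P = Real.exp (S j j * t ^ 2 / 2) := by
  have h := mgf_gaussianReal (hasLaw_multivariateGaussian_coord hS hG j).map_eq t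
  rw [Real.coe_toNNReal _ (hS.diag_nonneg), zero_mul, zero_add] at h
  refine ⟨?_, h⟩
  by_contra hc
  rw [mgf_undef hc] at h
  exact (Real.exp_pos _).ne h

/-- The logistic function. -/
noncomputable def logistic (t : ℝ) : ℝ := (1 + Real.exp (-t))⁻¹

lemma logistic_pos (t : ℝ) : 0 < logistic t := by unfold logistic; positivity

lemma logistic_le_one (t : ℝ) : logistic t ≤ 1 :=
  inv_le_one_of_one_le₀ (by linarith [Real.exp_pos (-t)])

lemma hasDerivAt_logistic (t : ℝ) :
    HasDerivAt logistic (logistic t * (1 - logistic t)) t := by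
  have h1 : HasDerivAt (fun t : ℝ => 1 + Real.exp (-t)) (-Real.exp (-t)) t := by
    have := ((hasDerivAt_id t).neg.exp).const_add 1
    exact this.congr_deriv (by simp)
  have hpos : 0 < 1 + Real.exp (-t) := by positivity
  refine (h1.inv hpos.ne').congr_deriv ?_
  unfold logistic
  field_simp
  ring

lemma continuous_logistic : Continuous logistic :=
  continuous_iff_continuousAt.2 fun t => (hasDerivAt_logistic t).continuousAt

lemma le_logistic_mul {t : ℝ} (h0 : 0 ≤ t) (h1 : t ≤ 3 / 2) :
    1 / 12 ≤ logistic t * (1 - logistic t) := by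
  have he : Real.exp (-t) ≤ 1 := Real.exp_le_one_iff.2 (by linarith)
  have he2 : 1 / 5 ≤ Real.exp (-t) := by
    have h2 : Real.exp (-(3 / 2)) ≤ Real.exp (-t) := Real.exp_le_exp.2 (by linarith)
    have h3 : Real.exp (3 / 2) ≤ 5 := by
      have h4 : Real.exp (3 / 2) ^ 2 ≤ 5 ^ 2 := by
        rw [← Real.exp_nat_mul]
        have h5 : Real.exp (((2 : ℕ) : ℝ) * (3 / 2)) = Real.exp 1 ^ 3 := by
          rw [← Real.exp_nat_mul]; norm_num
        rw [h5]
        have := Real.exp_one_lt_d9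
        calc Real.exp 1 ^ 3 ≤ 2.7182818286 ^ 3 := by gcongr
          _ ≤ _ := by norm_num
      exact le_of_sq_le_sq h4 (by norm_num)
    rw [Real.exp_neg] at h2
    have : 1 / 5 ≤ (Real.exp (3 / 2))⁻¹ := by
      rw [← one_div]
      exact one_div_le_one_div_of_le (Real.exp_pos _) h3
    linarith
  unfold logistic
  set x := Real.exp (-t)
  have hx : 0 < 1 + x := by linarith
  have : (1 + x)⁻¹ * (1 - (1 + x)⁻¹) = x / (1 + x) ^ 2 := by
    field_simp
    ring
  rw [this, div_le_div_iff₀ (by norm_num) (by positivity)]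
  nlinarith

lemma posSemidef_mul_le {S : Matrix ι ι ℝ} (hS : S.PosSemidef) (d : ι → ℝ) (j k : ι) :
    2 * (d j * d k * S j k) ≤ d j * d j * S j j + d k * d k * S k k := by
  have h := hS.dotProduct_mulVec_nonneg (d j • Pi.single j 1 - d k • Pi.single k 1)
  have hsym : S k j = S j k := by
    have := hS.1.apply k j
    simpa using this.symm
  simp [Matrix.mulVec_sub, sub_dotProduct, dotProduct_sub, Matrix.mulVec_smul, hsym] at h
  linarith

/-- Anti-concentration of Gaussian vectors on orthants (an inequality of Nazarov). -/
theorem gaussian_orthant_antiConcentration {Ω : Type*} [MeasurableSpace Ω] {P : Measure Ω}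
    [IsProbabilityMeasure P] (hp : 2 ≤ Fintype.card ι) {S : Matrix ι ι ℝ} (hS : S.PosSemidef)
    {G : Ω → EuclideanSpace ℝ ι} (hGm : Measurable G)
    (hG : HasLaw G (multivariateGaussian 0 S) P) {v : ℝ} (hv : 0 < v) (hvS : ∀ j, v ≤ S j j)
    (u : ι → ℝ) {ε : ℝ} (hε : 0 < ε) :
    P.real {ω | ∀ j, G ω j ≤ u j + ε} - P.real {ω | ∀ j, G ω j ≤ u j}
      ≤ 36 * Real.sqrt (2 * Real.log (Fintype.card ι)) * ε / Real.sqrt v := by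
  have hne : Nonempty ι := Fintype.card_pos_iff.1 (by omega)
  set L := 2 * Real.log (Fintype.card ι) with hLdef
  have hL : 1 ≤ L := one_le_two_mul_log hp
  have hcard : Real.log (Fintype.card ι) / L ≤ 1 / 2 := log_div_two_mul_log_le hp
  set a := Real.sqrt v / ε with ha
  have ha0 : 0 < a := by positivity
  have hSj : ∀ j, 0 < S j j := fun j => hv.trans_le (hvS j)
  set d : ι → ℝ := fun j => a / Real.sqrt (S j j) with hd
  have hd0 : ∀ j, 0 < d j := fun j => div_pos ha0 (Real.sqrt_pos.2 (hSj j))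
  have hdd : ∀ j, d j * d j * S j j = a ^ 2 := by
    intro j
    have h1 := Real.mul_self_sqrt (hSj j).le
    have h2 : 0 < Real.sqrt (S j j) := Real.sqrt_pos.2 (hSj j)
    simp only [hd]
    field_simp
    nlinarith
  have hde : ∀ j, d j * ε ≤ 1 := by
    intro j
    have h2 : 0 < Real.sqrt (S j j) := Real.sqrt_pos.2 (hSj j)
    have h3 : Real.sqrt v ≤ Real.sqrt (S j j) := Real.sqrt_le_sqrt (hvS j)
    simp only [hd, ha]
    rw [div_div, div_mul_eq_mul_div, div_le_one (by positivity)]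
    nlinarith
  set U : ι → ℝ := fun j => d j * u j with hU
  set V : Ω → ι → ℝ := fun ω j => d j * G ω j with hV
  have hVm : Measurable V := by
    refine measurable_pi_lambda _ fun j => ?_
    simp only [hV]
    fun_prop
  have hVUm : Measurable fun ω => V ω - U := hVm.sub_const U
  let F : (ι → ℝ) → ℝ := fun z => smoothMax L z
  let w : (ι → ℝ) → ι → ℝ := fun z => softmaxWeight L z
  let f : ι → Unit → (ι → ℝ) → ℝ := fun j _ z => w (z - U) j * logistic (F (z - U))
  let f' : ι → ι → Unit → (ι → ℝ) → ℝ := fun j k _ z =>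
    L * ((if j = k then w (z - U) j else 0) - w (z - U) j * w (z - U) k) * logistic (F (z - U))
      + w (z - U) j * w (z - U) k * (logistic (F (z - U)) * (1 - logistic (F (z - U))))
  have hw0 : ∀ z j, 0 ≤ w z j := fun z j => softmaxWeight_nonneg L z j
  have hw1 : ∀ z j, w z j ≤ 1 := fun z j => softmaxWeight_le_one L z j
  have hwc : ∀ j, Continuous fun z => w z j := continuous_softmaxWeight L
  have hFc : Continuous F := continuous_smoothMax L
  have hsub : Continuous fun z : ι → ℝ => z - U := by fun_prop
  have hwc' : ∀ j, Continuous fun z => w (z - U) j := fun j => (hwc j).comp hsub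
  have hlc' : Continuous fun z => logistic (F (z - U)) :=
    continuous_logistic.comp (hFc.comp hsub)
  have hfc : ∀ j, Continuous (f j ()) := fun j => (hwc' j).mul hlc'
  have hf'c : ∀ j k, Continuous (f' j k ()) := by
    intro j k
    refine ((continuous_const.mul (Continuous.sub ?_ ((hwc' j).mul (hwc' k)))).mul hlc').add
      (((hwc' j).mul (hwc' k)).mul (hlc'.mul (continuous_const.sub hlc')))
    split_ifs
    · exact hwc' j
    · exact continuous_const
  have hfb : ∀ j y z, |f j y z| ≤ 1 := by
    intro j y z
    simp only [f]
    rw [abs_of_nonneg (mul_nonneg (hw0 _ _) (logistic_pos _).le)]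
    exact mul_le_one₀ (hw1 _ _) (logistic_pos _).le (logistic_le_one _)
  have hf'b : ∀ j k y z, |f' j k y z| ≤ L + 1 := by
    intro j k y z
    have h1 : |L * ((if j = k then w (z - U) j else 0) - w (z - U) j * w (z - U) k)
        * logistic (F (z - U))| ≤ L * 1 * 1 := by
      rw [abs_mul, abs_mul, abs_of_pos (by linarith : 0 < L), abs_of_pos (logistic_pos _)]
      have : |(if j = k then w (z - U) j else 0) - w (z - U) j * w (z - U) k| ≤ 1 := by
        have hp1 : w (z - U) j * w (z - U) k ≤ 1 := mul_le_one₀ (hw1 _ _) (hw0 _ _) (hw1 _ _)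
        have hp0 := mul_nonneg (hw0 (z - U) j) (hw0 (z - U) k)
        have h0 := hw0 (z - U) j
        have h1 := hw1 (z - U) j
        split_ifs <;> rw [abs_le] <;> constructor <;> linarith
      have hl := logistic_le_one (F (z - U))
      have hl0 := (logistic_pos (F (z - U))).le
      gcongr
    have h2 : |w (z - U) j * w (z - U) k * (logistic (F (z - U)) * (1 - logistic (F (z - U))))|
        ≤ 1 := by
      have hl := logistic_le_one (F (z - U))
      have hl0 := (logistic_pos (F (z - U))).le
      rw [abs_of_nonneg (mul_nonneg (mul_nonneg (hw0 _ _) (hw0 _ _))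
        (mul_nonneg hl0 (by linarith)))]
      refine mul_le_one₀ (mul_le_one₀ (hw1 _ _) (hw0 _ _) (hw1 _ _))
        (mul_nonneg hl0 (by linarith)) (mul_le_one₀ hl (by linarith) (by linarith))
    refine (abs_add_le _ _).trans ?_
    linarith
  have hstein : ∀ j, ∫ ω, V ω j * f j () (V ω) ∂P
      = ∑ k, (d j * d k * S j k) * ∫ ω, f' j k () (V ω) ∂P := by
    intro j
    refine integral_coord_mul_of_indepFun hS hGm hG d (Y := fun _ => ()) (f := f j) (f' := f' j)
      (K := L + 1) measurable_const (indepFun_const_left _ _) (hSj j)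
      ((hfc j).measurable.comp measurable_snd) (fun k => (hf'c j k).measurable.comp measurable_snd)
      (fun y z => (hfb j y z).trans (by linarith)) (hf'b j) ?_
    intro _ z x t
    have e : ∀ t : ℝ, z + t • x - U = (z - U) + t • x := fun t => by abel
    have h1 := hasDerivAt_softmaxWeight L (z - U) x j t
    have h2 := (hasDerivAt_logistic _).comp t (hasDerivAt_smoothMax (L := L) (by linarith) (z - U) x t)
    simp only [f, f', w, F, e]
    refine (h1.mul h2).congr_deriv ?_
    simp only [Function.comp]
    set π := softmaxWeight L (z - U + t • x)
    set l := logistic (smoothMax L (z - U + t • x))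
    have h3 : softmaxAvg L (z - U + t • x) x = ∑ k, π k * x k := rfl
    have h4 : π j * x j = ∑ k, x k * (if j = k then π j else 0) := by simp [mul_comm]
    rw [h3, h4, Finset.mul_sum, ← Finset.sum_sub_distrib, Finset.mul_sum, Finset.sum_mul,
      Finset.mul_sum, Finset.mul_sum, ← Finset.sum_add_distrib]
    exact Finset.sum_congr rfl fun k _ => by ring
  have hVint : ∀ j, Integrable (fun ω => V ω j) P := fun j =>
    ((hasGaussianLaw_eval hG).eval j).integrable.const_mul _
  have hVf : ∀ j, Integrable (fun ω => V ω j * f j () (V ω)) P := fun j =>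
    (hVint j).mul_bdd (c := 1) ((hfc j).measurable.comp hVm).aestronglyMeasurable
      (Filter.Eventually.of_forall fun ω => hfb j () _)
  have hf'int : ∀ j k, Integrable (fun ω => f' j k () (V ω)) P := fun j k =>
    Integrable.of_bound (C := L + 1) ((hf'c j k).measurable.comp hVm).aestronglyMeasurable
      (Filter.Eventually.of_forall fun ω => hf'b j k () _)
  set A : Set Ω := {ω | ∀ j, G ω j ≤ u j + ε} with hA
  set A0 : Set Ω := {ω | ∀ j, G ω j ≤ u j} with hA0
  have hmeas : ∀ c : ι → ℝ, MeasurableSet {ω | ∀ j, G ω j ≤ c j} := by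
    intro c
    rw [Set.ofPred_forall]
    exact MeasurableSet.iInter fun j => measurableSet_le (by fun_prop) measurable_const
  have hAm : MeasurableSet A := hmeas _
  have hA0m : MeasurableSet A0 := hmeas _
  have hsubset : A0 ⊆ A := fun ω h j => (h j).trans (by linarith)
  -- the quadratic form dominates the indicator of `A \ A0`
  have hlow : ∀ ω, (a ^ 2 / 12) * (A \ A0).indicator (fun _ => (1 : ℝ)) ω
      ≤ ∑ j, ∑ k, (d j * d k * S j k) * f' j k () (V ω) := by
    intro ω
    set z := V ω - U with hz
    set l := logistic (F z) with hl
    have hl0 : 0 < l := logistic_pos _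
    have hl1 : l ≤ 1 := logistic_le_one _
    have hw := sum_softmaxWeight L z
    set q := ∑ j, ∑ k, (d j * d k * S j k) * (w z j * w z k) with hq
    have e1 : ∑ j, ∑ k, (d j * d k * S j k) * f' j k () (V ω)
        = L * l * (a ^ 2 - q) + l * (1 - l) * q := by
      have h1 : ∑ j, ∑ k, (d j * d k * S j k) * (if j = k then w z j else 0) = a ^ 2 := by
        simp only [mul_ite, mul_zero, Finset.sum_ite_eq, Finset.mem_univ, if_true, hdd]
        rw [← Finset.mul_sum]
        simp only [w]
        rw [hw, mul_one]
      rw [← h1, hq, mul_sub, Finset.mul_sum, Finset.mul_sum, Finset.mul_sum,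
        ← Finset.sum_sub_distrib, ← Finset.sum_add_distrib]
      refine Finset.sum_congr rfl fun j _ => ?_
      rw [Finset.mul_sum, Finset.mul_sum, Finset.mul_sum, ← Finset.sum_sub_distrib,
        ← Finset.sum_add_distrib]
      refine Finset.sum_congr rfl fun k _ => ?_
      simp only [f', ← hz, ← hl]
      ring
    have hqa : q ≤ a ^ 2 := by
      calc q ≤ ∑ j, ∑ k, a ^ 2 * (w z j * w z k) := by
            refine Finset.sum_le_sum fun j _ => Finset.sum_le_sum fun k _ => ?_
            refine mul_le_mul_of_nonneg_right ?_ (mul_nonneg (hw0 _ _) (hw0 _ _))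
            have := posSemidef_mul_le hS d j k
            rw [hdd, hdd] at this
            linarith
        _ = a ^ 2 * ((∑ j, w z j) * ∑ k, w z k) := by
            rw [Finset.sum_mul_sum, Finset.mul_sum]
            exact Finset.sum_congr rfl fun j _ => by rw [Finset.mul_sum]
        _ = a ^ 2 := by simp only [w]; rw [hw]; ring
    have e2 : a ^ 2 * (l * (1 - l)) ≤ L * l * (a ^ 2 - q) + l * (1 - l) * q := by
      have h1 : l * (1 - l) ≤ L * l := by nlinarith
      nlinarith [mul_nonneg (sub_nonneg.2 h1) (sub_nonneg.2 hqa)]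
    rw [e1]
    refine le_trans ?_ e2
    by_cases hω : ω ∈ A \ A0
    · rw [Set.indicator_of_mem hω]
      obtain ⟨hωA, hωA0⟩ := hω
      simp only [hA0, Set.mem_ofPred_eq, not_forall, not_le] at hωA0
      obtain ⟨j0, hj0⟩ := hωA0
      have hz1 : ∀ j, z j ≤ 1 := by
        intro j
        have h1 : G ω j ≤ u j + ε := hωA j
        have : z j = d j * (G ω j - u j) := by simp [hz, hV, hU]; ring
        rw [this]
        exact (mul_le_mul_of_nonneg_left (by linarith) (hd0 j).le).trans (hde j)
      have hz0 : 0 < z j0 := by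
        have : z j0 = d j0 * (G ω j0 - u j0) := by simp [hz, hV, hU]; ring
        rw [this]
        exact mul_pos (hd0 _) (by linarith)
      have hF0 : 0 ≤ F z := hz0.le.trans (le_smoothMax (by linarith) z j0)
      have hF1 : F z ≤ 3 / 2 := by
        have := smoothMax_le (by linarith : 0 < L) z hz1
        simp only [F]
        linarith
      have := le_logistic_mul hF0 hF1
      rw [mul_one, div_eq_mul_one_div]
      exact mul_le_mul_of_nonneg_left this (by positivity)
    · rw [Set.indicator_of_notMem hω, mul_zero]
      exact mul_nonneg (by positivity) (mul_nonneg hl0.le (by linarith))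
  -- the first absolute moment of the maximum
  set l := Real.sqrt L with hl
  have hl1 : 1 ≤ l := Real.one_le_sqrt.2 hL
  have hl2 : l ^ 2 = L := Real.sq_sqrt (by linarith)
  set c : ℝ := l⁻¹ * Real.exp (-l ^ 2) with hc
  have hc0 : 0 ≤ c := by positivity
  let s : ι → ℝ := fun k => l / Real.sqrt (S k k)
  let H : Ω → ℝ := fun ω => a * (l + c * ∑ k, (Real.exp (s k * G ω k) + Real.exp (-s k * G ω k)))
  have hup : ∀ ω, ∑ j, V ω j * f j () (V ω) ≤ H ω := by
    intro ω
    set z := V ω - U with hz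
    have hlz := logistic_le_one (F z)
    have hlz0 := (logistic_pos (F z)).le
    have hVb : ∀ j, |V ω j| ≤ H ω := by
      intro j
      have hσ : 0 < Real.sqrt (S j j) := Real.sqrt_pos.2 (hSj j)
      have h1 : |V ω j| = a * |G ω j / Real.sqrt (S j j)| := by
        rw [abs_div, abs_of_pos hσ]
        change |d j * G ω j| = _
        rw [abs_mul, abs_of_pos (hd0 j)]
        simp only [hd]
        ring
      rw [h1]
      refine mul_le_mul_of_nonneg_left ?_ ha0.le
      refine (abs_le_add_exp (l := l) (by linarith)).trans ?_
      rw [← hc]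
      gcongr
      have e1 : l * (G ω j / Real.sqrt (S j j)) = s j * G ω j := by simp only [s]; ring
      have e2 : -l * (G ω j / Real.sqrt (S j j)) = -s j * G ω j := by simp only [s]; ring
      rw [e1, e2]
      exact Finset.single_le_sum
        (f := fun k => Real.exp (s k * G ω k) + Real.exp (-s k * G ω k))
        (fun k _ => by positivity) (Finset.mem_univ j)
    calc ∑ j, V ω j * f j () (V ω) ≤ ∑ j, w z j * H ω := by
          refine Finset.sum_le_sum fun j _ => ?_
          have h1 : V ω j * f j () (V ω) = w z j * (V ω j * logistic (F z)) := by
            simp only [f, ← hz]; ring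
          rw [h1]
          refine mul_le_mul_of_nonneg_left ?_ (hw0 _ _)
          calc V ω j * logistic (F z) ≤ |V ω j| * logistic (F z) :=
                mul_le_mul_of_nonneg_right (le_abs_self _) hlz0
            _ ≤ |V ω j| * 1 := mul_le_mul_of_nonneg_left hlz (abs_nonneg _)
            _ ≤ H ω := by rw [mul_one]; exact hVb j
      _ = H ω := by
          rw [← Finset.sum_mul]
          simp only [w]
          rw [sum_softmaxWeight, one_mul]
  have hexp := fun k t => integrable_exp_mul_coord hS hG k t
  have hEint : ∀ k, Integrable
      (fun ω => Real.exp (s k * G ω k) + Real.exp (-s k * G ω k)) P := fun k =>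
    (hexp k _).1.add (hexp k _).1
  have hcE : Integrable
      (fun ω => c * ∑ k, (Real.exp (s k * G ω k) + Real.exp (-s k * G ω k))) P :=
    (integrable_finsetSum _ fun k _ => hEint k).const_mul _
  have hHint : Integrable H P := ((integrable_const l).add hcE).const_mul a
  have hHval : ∫ ω, H ω ∂P ≤ 3 * a * l := by
    have hs : ∀ k, S k k * s k ^ 2 / 2 = l ^ 2 / 2 := by
      intro k
      have hσ : 0 < Real.sqrt (S k k) := Real.sqrt_pos.2 (hSj k)
      have h1 := Real.sq_sqrt (hSj k).le
      simp only [s, div_pow, h1]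
      field_simp [(hSj k).ne']
    have h1 : ∫ ω, H ω ∂P
        = a * (l + c * (Fintype.card ι * (2 * Real.exp (l ^ 2 / 2)))) := by
      simp only [H]
      rw [integral_const_mul, integral_add (integrable_const _) hcE,
        integral_const_mul, integral_finsetSum _ fun k _ => hEint k]
      simp only [integral_const, probReal_univ, one_smul]
      congr 3
      rw [← nsmul_eq_mul, ← Finset.card_univ, ← Finset.sum_const]
      refine Finset.sum_congr rfl fun k _ => ?_
      rw [integral_add (hexp k _).1 (hexp k _).1, (hexp k _).2, (hexp k _).2, neg_sq, hs]
      ring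
    have h2 : Real.exp (-l ^ 2) * (Fintype.card ι * (2 * Real.exp (l ^ 2 / 2))) = 2 := by
      have hp0 : (0 : ℝ) < Fintype.card ι := by positivity
      have h3 : Real.exp (l ^ 2 / 2) = Fintype.card ι := by
        rw [hl2, hLdef, mul_div_cancel_left₀ _ (by norm_num), Real.exp_log hp0]
      have h4 : Real.exp (-l ^ 2) = (Real.exp (l ^ 2 / 2) * Real.exp (l ^ 2 / 2))⁻¹ := by
        rw [← Real.exp_add, ← Real.exp_neg]; congr 1; ring
      rw [h4, h3]
      field_simp
    rw [h1, hc, mul_assoc l⁻¹, h2]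
    have h5 : l⁻¹ ≤ 1 := inv_le_one_of_one_le₀ hl1
    nlinarith
  have hfinal : a ^ 2 / 12 * P.real (A \ A0) ≤ 3 * a * l := by
    calc a ^ 2 / 12 * P.real (A \ A0)
        = ∫ ω, (a ^ 2 / 12) * (A \ A0).indicator (fun _ => (1 : ℝ)) ω ∂P := by
          rw [integral_const_mul, integral_indicator_const _ (hAm.diff hA0m)]
          simp
      _ ≤ ∫ ω, ∑ j, ∑ k, (d j * d k * S j k) * f' j k () (V ω) ∂P := by
          refine integral_mono (((integrable_const _).indicator (hAm.diff hA0m)).const_mul _) ?_ hlow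
          exact integrable_finsetSum _ fun j _ => integrable_finsetSum _ fun k _ =>
            (hf'int j k).const_mul _
      _ = ∫ ω, ∑ j, V ω j * f j () (V ω) ∂P := by
          rw [integral_finsetSum _ fun j _ => integrable_finsetSum _ fun k _ =>
            (hf'int j k).const_mul _, integral_finsetSum _ fun j _ => hVf j]
          refine Finset.sum_congr rfl fun j _ => ?_
          rw [hstein j, integral_finsetSum _ fun k _ => (hf'int j k).const_mul _]
          exact Finset.sum_congr rfl fun k _ => integral_const_mul _ _
      _ ≤ ∫ ω, H ω ∂P := integral_mono (integrable_finsetSum _ fun j _ => hVf j) hHint hup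
      _ ≤ _ := hHval
  rw [← measureReal_sdiff hsubset hA0m]
  have h7 : a * (a / 12 * P.real (A \ A0)) ≤ a * (3 * l) := by linarith
  have h8 := le_of_mul_le_mul_left h7 ha0
  have h9 : 0 < Real.sqrt v := Real.sqrt_pos.2 hv
  rw [le_div_iff₀ h9]
  have h10 : a * ε = Real.sqrt v := by rw [ha]; field_simp
  rw [← h10]
  nlinarith
end AntiConcentration

section Blocks

variable {ι κ : Type*} [Fintype ι] [Fintype κ] [DecidableEq κ]

lemma hasDerivAt_smoothMax_curve [Nonempty ι] {L : ℝ} (hL : L ≠ 0) {z : ℝ → ι → ℝ} {z' : ι → ℝ}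
    {t : ℝ} (hz : ∀ j, HasDerivAt (fun t => z t j) (z' j) t) :
    HasDerivAt (fun t : ℝ => smoothMax L (z t)) (softmaxAvg L (z t) z') t := by
  have hS := sum_exp_pos L (z t)
  have h0 : HasDerivAt (fun t : ℝ => ∑ k, Real.exp (L * z t k))
      (∑ k, Real.exp (L * z t k) * (L * z' k)) t :=
    HasDerivAt.fun_sum fun k _ => ((hz k).const_mul L).exp
  refine ((h0.log hS.ne').const_mul L⁻¹).congr_deriv ?_
  unfold softmaxAvg softmaxWeight
  rw [Finset.sum_div, Finset.mul_sum]
  refine Finset.sum_congr rfl fun k _ => ?_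
  field_simp

/-- The point `s ∑ r, a r • x r + y`. -/
def blockPoint (s : ℝ) (x : κ → ι → ℝ) (y : ι → ℝ) (a : κ → ℝ) : ι → ℝ :=
  fun j => s * ∑ r, a r * x r j + y j

/-- The weights that are `0` on `R` and `1` elsewhere. -/
def offWeight (R : Finset κ) (r : κ) : ℝ := if r ∈ R then 0 else 1

omit [Fintype κ] in
lemma offWeight_mem (R : Finset κ) (r : κ) : offWeight R r ∈ Set.Icc (0 : ℝ) 1 := by
  unfold offWeight; split_ifs <;> simp

omit [Fintype κ] in
lemma offWeight_of_notMem {R : Finset κ} {r : κ} (h : r ∉ R) : offWeight R r = 1 := by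
  simp [offWeight, h]

omit [Fintype κ] in
lemma offWeight_empty : offWeight (∅ : Finset κ) = fun _ => 1 := by
  funext r; simp [offWeight]

omit [Fintype ι] in
lemma blockPoint_sub_le {s η : ℝ} (hs : |s| ≤ 1) {x : κ → ι → ℝ} (y : ι → ℝ)
    (hη : 0 ≤ η) (hx : ∀ r j, |x r j| ≤ η) {R R' : Finset κ} {a a' : κ → ℝ}
    (ha : ∀ r, a r ∈ Set.Icc (0 : ℝ) 1) (ha' : ∀ r, a' r ∈ Set.Icc (0 : ℝ) 1)
    (haR : ∀ r ∉ R, a r = 1) (haR' : ∀ r ∉ R', a' r = 1) (j : ι) :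
    |blockPoint s x y a j - blockPoint s x y a' j| ≤ (R.card + R'.card : ℕ) * η := by
  have h1 : blockPoint s x y a j - blockPoint s x y a' j
      = s * ∑ r ∈ R ∪ R', (a r - a' r) * x r j := by
    have h2 : ∑ r ∈ R ∪ R', (a r - a' r) * x r j = ∑ r, (a r - a' r) * x r j := by
      refine Finset.sum_subset (Finset.subset_univ _) fun r _ hr => ?_
      rw [Finset.mem_union, not_or] at hr
      rw [haR r hr.1, haR' r hr.2, sub_self, zero_mul]
    rw [h2]
    simp only [blockPoint, sub_mul, Finset.sum_sub_distrib]
    ring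
  rw [h1, abs_mul]
  have h3 : |∑ r ∈ R ∪ R', (a r - a' r) * x r j| ≤ ∑ _r ∈ R ∪ R', η := by
    refine (Finset.abs_sum_le_sum_abs _ _).trans (Finset.sum_le_sum fun r _ => ?_)
    rw [abs_mul]
    have h4 : |a r - a' r| ≤ 1 := by
      have := ha r
      have := ha' r
      rw [Set.mem_Icc] at *
      rw [abs_le]
      constructor <;> linarith
    calc |a r - a' r| * |x r j| ≤ 1 * η := mul_le_mul h4 (hx r j) (abs_nonneg _) zero_le_one
      _ = η := one_mul _
  rw [Finset.sum_const, nsmul_eq_mul] at h3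
  have h5 : ((R ∪ R').card : ℝ) * η ≤ (R.card + R'.card : ℕ) * η := by
    have : (R ∪ R').card ≤ R.card + R'.card := Finset.card_union_le _ _
    have : ((R ∪ R').card : ℝ) ≤ (R.card + R'.card : ℕ) := by exact_mod_cast this
    gcongr
  calc |s| * |∑ r ∈ R ∪ R', (a r - a' r) * x r j|
      ≤ 1 * |∑ r ∈ R ∪ R', (a r - a' r) * x r j| := by gcongr
    _ ≤ _ := by linarith

omit [Fintype ι] [DecidableEq κ] in
lemma blockPoint_segment (s : ℝ) (x : κ → ι → ℝ) (y : ι → ℝ) (a a' : κ → ℝ) (t : ℝ) :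
    blockPoint s x y (fun r => a r + t * (a' r - a r))
      = blockPoint s x y a + t • fun j => ∑ r, (s * (a' r - a r)) * x r j := by
  funext j
  simp only [blockPoint, Pi.add_apply, Pi.smul_apply, smul_eq_mul]
  have : ∑ r, (a r + t * (a' r - a r)) * x r j
      = ∑ r, a r * x r j + t * ∑ r, (a' r - a r) * x r j := by
    rw [Finset.mul_sum, ← Finset.sum_add_distrib]
    exact Finset.sum_congr rfl fun r _ => by ring
  rw [this, mul_add, mul_left_comm, Finset.mul_sum (s := Finset.univ) (a := s)
    (f := fun r => (a' r - a r) * x r j)]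
  simp only [mul_assoc]
  ring

lemma segment_mem {a a' t : ℝ} (ha : a ∈ Set.Icc (0 : ℝ) 1) (ha' : a' ∈ Set.Icc (0 : ℝ) 1)
    (ht : t ∈ Set.Icc (0 : ℝ) 1) : a + t * (a' - a) ∈ Set.Icc (0 : ℝ) 1 := by
  rw [Set.mem_Icc] at *
  constructor
  · nlinarith [mul_nonneg ht.1 ha'.1, mul_nonneg (sub_nonneg.2 ht.2) ha.1]
  · nlinarith [mul_nonneg ht.1 (sub_nonneg.2 ha'.2), mul_nonneg (sub_nonneg.2 ht.2)
      (sub_nonneg.2 ha.2)]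

variable (g : SmoothStep)

omit [DecidableEq κ] in
lemma SmoothStep.D2_blockPoint_sub_le [Nonempty ι] {L : ℝ} (hL : 1 ≤ L)
    (hcard : Real.log (Fintype.card ι) / L ≤ 1 / 2) {s : ℝ} (hs : |s| ≤ 1) (x : κ → ι → ℝ)
    (y : ι → ℝ) {R : Finset κ} {a a' : κ → ℝ} (ha : ∀ r, a r ∈ Set.Icc (0 : ℝ) 1)
    (ha' : ∀ r, a' r ∈ Set.Icc (0 : ℝ) 1) (haR : ∀ r ∉ R, a r = 1) (haR' : ∀ r ∉ R, a' r = 1)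
    (v w : ι → ℝ) {Mv Mw : ℝ} {M : κ → ℝ}
    (hMv : ∀ a, (∀ r, a r ∈ Set.Icc (0 : ℝ) 1) → (∀ r ∉ R, a r = 1) →
      localAvg 1 L (blockPoint s x y a) (fun j => |v j| ^ 3) ≤ Mv)
    (hMw : ∀ a, (∀ r, a r ∈ Set.Icc (0 : ℝ) 1) → (∀ r ∉ R, a r = 1) →
      localAvg 1 L (blockPoint s x y a) (fun j => |w j| ^ 3) ≤ Mw)
    (hM : ∀ q ∈ R, ∀ a, (∀ r, a r ∈ Set.Icc (0 : ℝ) 1) → (∀ r ∉ R, a r = 1) →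
      localAvg 1 L (blockPoint s x y a) (fun j => |x q j| ^ 3) ≤ M q) :
    |g.D2 L (blockPoint s x y a') v w - g.D2 L (blockPoint s x y a) v w|
      ≤ ∑ r ∈ R, 16 * g.K * L ^ 2 * (Mv + Mw + M r) := by
  have hK := g.one_le_K
  set W : ι → ℝ := fun j => ∑ r, (s * (a' r - a r)) * x r j with hW
  have hWR : W = fun j => ∑ r ∈ R, (s * (a' r - a r)) * x r j := by
    funext j
    symm
    refine Finset.sum_subset (Finset.subset_univ _) fun r _ hr => ?_
    rw [haR r hr, haR' r hr, sub_self, mul_zero, zero_mul]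
  let f : ℝ → ℝ := fun t => g.D2 L (blockPoint s x y a + t • W) v w
  have hf : ∀ t, HasDerivAt f (g.D3 L (blockPoint s x y a + t • W) v w W) t := fun t =>
    g.hasDerivAt_D2 (by linarith) _ W v w t
  have h01 := norm_image_sub_le_of_norm_deriv_le_segment_01' (f := f)
    (C := ∑ r ∈ R, 16 * g.K * L ^ 2 * (Mv + Mw + M r))
    (fun t _ => (hf t).hasDerivWithinAt) ?_
  · have e1 : f 1 = g.D2 L (blockPoint s x y a') v w := by
      simp only [f]
      rw [hW, ← blockPoint_segment]
      congr 2
      funext r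
      ring
    have e0 : f 0 = g.D2 L (blockPoint s x y a) v w := by simp [f]
    rwa [e1, e0, Real.norm_eq_abs] at h01
  · intro t ht
    have ht' : t ∈ Set.Icc (0 : ℝ) 1 := Set.Ico_subset_Icc_self ht
    rw [Real.norm_eq_abs]
    conv_lhs => rw [hWR, g.D3_sum]
    refine (Finset.abs_sum_le_sum_abs _ _).trans (Finset.sum_le_sum fun r hr => ?_)
    rw [← hWR, hW, ← blockPoint_segment, abs_mul]
    set at' : κ → ℝ := fun r => a r + t * (a' r - a r) with hat
    have hat1 : ∀ r, at' r ∈ Set.Icc (0 : ℝ) 1 := fun r => segment_mem (ha r) (ha' r) ht'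
    have hat2 : ∀ r ∉ R, at' r = 1 := fun r hr => by simp [hat, haR r hr, haR' r hr]
    have h1 : |s * (a' r - a r)| ≤ 1 := by
      rw [abs_mul]
      refine mul_le_one₀ hs (abs_nonneg _) ?_
      have := ha r
      have := ha' r
      rw [Set.mem_Icc] at *
      rw [abs_le]
      constructor <;> linarith
    calc _ ≤ 1 * |g.D3 L (blockPoint s x y at') v w (x r)| :=
          mul_le_mul_of_nonneg_right h1 (abs_nonneg _)
      _ ≤ _ := by
          rw [one_mul]
          refine (g.abs_D3_le hL hcard _ _ _ _).trans ?_
          gcongr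
          · exact hMv _ hat1 hat2
          · exact hMw _ hat1 hat2
          · exact hM r hr _ hat1 hat2

lemma SmoothStep.D1_blockPoint_expansion [Nonempty ι] {L : ℝ} (hL : 1 ≤ L)
    (hcard : Real.log (Fintype.card ι) / L ≤ 1 / 2) {s : ℝ} (hs : |s| ≤ 1) (x : κ → ι → ℝ)
    (y : ι → ℝ) (N : κ → Finset κ) {i : κ} (hi : i ∈ N i) (hN : ∀ l, l ∈ N l) {M : κ → ℝ}
    (hM : ∀ l ∈ N i, ∀ q ∈ N i ∪ N l, ∀ a, (∀ r, a r ∈ Set.Icc (0 : ℝ) 1) →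
      (∀ r ∉ N i ∪ N l, a r = 1) →
      localAvg 1 L (blockPoint s x y a) (fun j => |x q j| ^ 3) ≤ M q) :
    |g.D1 L (blockPoint s x y fun _ => 1) (x i) - g.D1 L (blockPoint s x y (offWeight (N i))) (x i)
        - s * ∑ l ∈ N i, g.D2 L (blockPoint s x y (offWeight (N i ∪ N l))) (x i) (x l)|
      ≤ ∑ l ∈ N i, ∑ r ∈ N i ∪ N l, 16 * g.K * L ^ 2 * (M i + M l + M r) := by
  set a : κ → ℝ := offWeight (N i) with ha
  set W : ι → ℝ := fun j => ∑ r, (s * (1 - a r)) * x r j with hW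
  have hWN : W = fun j => ∑ r ∈ N i, s * x r j := by
    funext j
    symm
    rw [hW]
    refine (Finset.sum_congr rfl fun r hr => ?_).trans
      (Finset.sum_subset (Finset.subset_univ (N i)) fun r _ hr => ?_)
    · simp [ha, offWeight, hr]
    · simp [ha, offWeight, hr]
  let f : ℝ → ℝ := fun t => g.D1 L (blockPoint s x y a + t • W) (x i)
  have hf : ∀ t, HasDerivAt f (g.D2 L (blockPoint s x y a + t • W) (x i) W) t := fun t =>
    g.hasDerivAt_D1 (by linarith) _ W (x i) t
  obtain ⟨t, ht, hft⟩ := exists_hasDerivAt_eq_slope f _ zero_lt_one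
    (fun t _ => (hf t).continuousAt.continuousWithinAt) (fun t _ => hf t)
  have ht' : t ∈ Set.Icc (0 : ℝ) 1 := Set.Ioo_subset_Icc_self ht
  have e1 : f 1 = g.D1 L (blockPoint s x y fun _ => 1) (x i) := by
    simp only [f]
    rw [hW, ← blockPoint_segment s x y a fun _ => 1]
    congr 2
    funext r
    ring
  have e0 : f 0 = g.D1 L (blockPoint s x y a) (x i) := by simp [f]
  rw [sub_zero, div_one, e1, e0] at hft
  rw [← hft]
  set at' : κ → ℝ := fun r => a r + t * (1 - a r) with hat
  have hpt : blockPoint s x y a + t • W = blockPoint s x y at' := by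
    rw [hW, ← blockPoint_segment s x y a fun _ => 1]
  have hat1 : ∀ r, at' r ∈ Set.Icc (0 : ℝ) 1 := fun r =>
    segment_mem (offWeight_mem _ r) (by simp) ht'
  have hat2 : ∀ r ∉ N i, at' r = 1 := fun r hr => by simp [hat, ha, offWeight_of_notMem hr]
  rw [hpt, hWN, g.D2_sum, ← Finset.mul_sum, ← mul_sub, ← Finset.sum_sub_distrib, abs_mul]
  calc |s| * |∑ l ∈ N i, (g.D2 L (blockPoint s x y at') (x i) (x l)
        - g.D2 L (blockPoint s x y (offWeight (N i ∪ N l))) (x i) (x l))|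
      ≤ 1 * ∑ l ∈ N i, |g.D2 L (blockPoint s x y at') (x i) (x l)
        - g.D2 L (blockPoint s x y (offWeight (N i ∪ N l))) (x i) (x l)| := by
        gcongr
        exact Finset.abs_sum_le_sum_abs _ _
    _ ≤ _ := by
        rw [one_mul]
        refine Finset.sum_le_sum fun l hl => ?_
        refine g.D2_blockPoint_sub_le hL hcard hs x y (fun r => offWeight_mem _ r) hat1
          (fun r hr => offWeight_of_notMem hr)
          (fun r hr => hat2 r fun h => hr (Finset.mem_union_left _ h)) _ _
          (hM l hl i (Finset.mem_union_left _ hi)) (hM l hl l (Finset.mem_union_right _ (hN l)))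
          (hM l hl)

/-- Comparison of local averages at two points that differ in few small blocks; large blocks are
accounted for by the second term. -/
lemma localAvg_blockPoint_le [Nonempty ι] {L : ℝ} (hL : 1 ≤ L) {s η : ℝ} (hs : |s| ≤ 1)
    {x : κ → ι → ℝ} (y : ι → ℝ) {R R' : Finset κ} (hη : 0 ≤ η)
    (hRη : (R.card + R'.card : ℕ) * η ≤ L⁻¹) {bad : ℝ} (hbad0 : 0 ≤ bad)
    (hbad : (∃ r j, η < |x r j|) → bad = 1)
    {a : κ → ℝ} (ha : ∀ r, a r ∈ Set.Icc (0 : ℝ) 1) (haR : ∀ r ∉ R, a r = 1) (v : ι → ℝ) :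
    localAvg 1 L (blockPoint s x y a) (fun j => |v j| ^ 3)
      ≤ 8 * localAvg 2 L (blockPoint s x y (offWeight R')) (fun j => |v j| ^ 3)
        + bad * ∑ j, |v j| ^ 3 := by
  have hv : ∀ j, 0 ≤ |v j| ^ 3 := fun j => by positivity
  have h0 := localAvg_nonneg 2 L (blockPoint s x y (offWeight R')) hv
  by_cases h : ∃ r j, η < |x r j|
  · rw [hbad h, one_mul]
    have := localAvg_le_sum 1 L (blockPoint s x y a) hv
    linarith
  · push Not at h
    have hsum : 0 ≤ bad * ∑ j, |v j| ^ 3 :=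
      mul_nonneg hbad0 (Finset.sum_nonneg fun j _ => hv j)
    have h1 := localAvg_le_of_close hL hv fun j => (blockPoint_sub_le hs y hη h ha
      (fun r => offWeight_mem R' r) haR (fun r hr => offWeight_of_notMem hr) j).trans hRη
    have h2 : Real.exp 2 ≤ 8 := by
      have : Real.exp 2 = Real.exp 1 ^ 2 := by rw [← Real.exp_nat_mul]; norm_num
      rw [this]
      have := Real.exp_one_lt_d9
      calc Real.exp 1 ^ 2 ≤ 2.7182818286 ^ 2 := by gcongr
        _ ≤ 8 := by norm_num
    have h3 := mul_le_mul_of_nonneg_right h2 h0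
    linarith

end Blocks

section LocalDependence

/-- Centred random vectors `ξ i` with exponential moments at scale `b`, each independent of the
vectors outside its neighbourhood `N i` and of the additional vector `Y`; similarly for neighbouring
pairs. -/
structure IsLocallyDependent {Ω κ ι : Type*} [MeasurableSpace Ω] [Fintype κ] [DecidableEq κ]
    (P : Measure Ω) (ξ : κ → Ω → ι → ℝ) (Y : Ω → ι → ℝ) (N : κ → Finset κ) (b : ℝ) : Prop where
  b_pos : 0 < b
  meas : ∀ i, Measurable (ξ i)
  measY : Measurable Y
  self_mem : ∀ i, i ∈ N i
  int_exp : ∀ i j, Integrable (fun ω => Real.exp (|ξ i ω j| / b)) P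
  exp_le : ∀ i j, ∫ ω, Real.exp (|ξ i ω j| / b) ∂P ≤ 6
  mean_zero : ∀ i j, ∫ ω, ξ i ω j ∂P = 0
  indep_one : ∀ i, IndepFun (ξ i) (fun ω => (∑ r ∈ (N i)ᶜ, ξ r ω, Y ω)) P
  indep_two : ∀ i, ∀ l ∈ N i,
    IndepFun (fun ω => (ξ i ω, ξ l ω)) (fun ω => (∑ r ∈ (N i ∪ N l)ᶜ, ξ r ω, Y ω)) P

lemma pow_three_le_exp {b x : ℝ} (hb : 0 < b) (hx : 0 ≤ x) :
    x ^ 3 ≤ 48 * b ^ 3 * Real.exp (x / (2 * b)) := by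
  have h := Real.pow_div_factorial_le_exp (x / (2 * b)) (by positivity) 3
  have h2 : (x / (2 * b)) ^ 3 / (Nat.factorial 3 : ℝ) * (48 * b ^ 3) = x ^ 3 := by
    norm_num [Nat.factorial]
    field_simp
    ring
  rw [← h2]
  calc _ ≤ Real.exp (x / (2 * b)) * (48 * b ^ 3) := by gcongr
    _ = _ := by ring

lemma exp_half_mul_exp_half_le {b : ℝ} (x y : ℝ) :
    Real.exp (x / (2 * b)) * Real.exp (y / (2 * b))
      ≤ (Real.exp (x / b) + Real.exp (y / b)) / 2 := by
  have h : ∀ t : ℝ, Real.exp (t / b) = Real.exp (t / (2 * b)) ^ 2 := by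
    intro t
    rw [← Real.exp_nat_mul]
    congr 1
    push_cast
    rw [mul_div_assoc', mul_div_mul_left _ _ (by norm_num)]
  rw [h x, h y]
  nlinarith [sq_nonneg (Real.exp (x / (2 * b)) - Real.exp (y / (2 * b)))]

lemma exp_half_le {b x : ℝ} (hb : 0 < b) (hx : 0 ≤ x) :
    Real.exp (x / (2 * b)) ≤ Real.exp (x / b) :=
  Real.exp_le_exp.2 (div_le_div_of_nonneg_left hx hb (by linarith))

open Classical in
/-- The indicator of the event that some coordinate of some block exceeds `η`. -/
noncomputable def largeBlock {κ ι : Type*} (η : ℝ) (x : κ → ι → ℝ) : ℝ :=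
  if ∃ r j, η < |x r j| then 1 else 0

lemma largeBlock_nonneg {κ ι : Type*} (η : ℝ) (x : κ → ι → ℝ) : 0 ≤ largeBlock η x := by
  unfold largeBlock; split_ifs <;> norm_num

lemma largeBlock_le {κ ι : Type*} [Fintype κ] [Fintype ι] {η b : ℝ} (hb : 0 < b) (x : κ → ι → ℝ) :
    largeBlock η x ≤ ∑ r, ∑ j, Real.exp (-(η / (2 * b))) * Real.exp (|x r j| / (2 * b)) := by
  unfold largeBlock
  split_ifs with h
  · obtain ⟨r, j, hrj⟩ := h
    have h1 : 1 ≤ Real.exp (-(η / (2 * b))) * Real.exp (|x r j| / (2 * b)) := by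
      rw [← Real.exp_add, Real.one_le_exp_iff]
      have : η / (2 * b) ≤ |x r j| / (2 * b) := by gcongr
      linarith
    refine h1.trans ?_
    refine (Finset.single_le_sum (f := fun j => Real.exp (-(η / (2 * b)))
      * Real.exp (|x r j| / (2 * b))) (fun _ _ => by positivity) (Finset.mem_univ j)).trans ?_
    exact Finset.single_le_sum (f := fun r => ∑ j, Real.exp (-(η / (2 * b)))
      * Real.exp (|x r j| / (2 * b))) (fun _ _ => by positivity) (Finset.mem_univ r)
  · positivity

open Classical in
/-- The softmax weight of `j`, restricted to the points whose maximum is within `a` of `0`. -/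
noncomputable def localWeight {ι : Type*} [Fintype ι] (a L : ℝ) (z : ι → ℝ) (j : ι) : ℝ :=
  if MaxNear a z then softmaxWeight L z j else 0

lemma localAvg_eq_sum {ι : Type*} [Fintype ι] (a L : ℝ) (z v : ι → ℝ) :
    localAvg a L z v = ∑ j, localWeight a L z j * v j := by
  unfold localAvg localWeight softmaxAvg
  split_ifs <;> simp

lemma localWeight_nonneg {ι : Type*} [Fintype ι] (a L : ℝ) (z : ι → ℝ) (j : ι) :
    0 ≤ localWeight a L z j := by
  unfold localWeight
  split_ifs
  · exact softmaxWeight_nonneg L z j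
  · exact le_rfl

lemma localWeight_le_one {ι : Type*} [Fintype ι] [Nonempty ι] (a L : ℝ) (z : ι → ℝ) (j : ι) :
    localWeight a L z j ≤ 1 := by
  unfold localWeight
  split_ifs
  · exact softmaxWeight_le_one L z j
  · exact zero_le_one

lemma sum_localWeight {ι : Type*} [Fintype ι] [Nonempty ι] (a L : ℝ) (z : ι → ℝ) :
    ∑ j, localWeight a L z j = {z : ι → ℝ | MaxNear a z}.indicator (fun _ => 1) z := by
  unfold localWeight
  by_cases h : MaxNear a z
  · simp [h, sum_softmaxWeight, Set.indicator]
  · simp [h, Set.indicator]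

lemma measurable_localWeight {ι : Type*} [Fintype ι] [Nonempty ι] (a L : ℝ) (j : ι) :
    Measurable fun z : ι → ℝ => localWeight a L z j :=
  Measurable.ite (measurableSet_maxNear a) (continuous_softmaxWeight L j).measurable
    measurable_const

lemma blockPoint_offWeight {ι κ : Type*} [Fintype κ] [DecidableEq κ] (s : ℝ) (x : κ → ι → ℝ)
    (y : ι → ℝ) (R : Finset κ) :
    blockPoint s x y (offWeight R) = s • ∑ r ∈ Rᶜ, x r + y := by
  funext j
  simp only [blockPoint, Pi.add_apply, Pi.smul_apply, Finset.sum_apply, smul_eq_mul]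
  congr 2
  symm
  refine (Finset.sum_congr rfl fun r hr => ?_).trans
    (Finset.sum_subset (Finset.subset_univ Rᶜ) fun r _ hr => ?_)
  · rw [offWeight_of_notMem (Finset.mem_compl.1 hr), one_mul]
  · rw [Finset.mem_compl, not_not] at hr
    simp [offWeight, hr]

namespace IsLocallyDependent

variable {Ω κ ι : Type*} [MeasurableSpace Ω] [Fintype κ] [DecidableEq κ] [Fintype ι]
  {P : Measure Ω} {ξ : κ → Ω → ι → ℝ} {Y : Ω → ι → ℝ}
  {N : κ → Finset κ} {b : ℝ}

section Moments

variable (h : IsLocallyDependent P ξ Y N b)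
include h

omit [Fintype ι] in
lemma measurable_coord (i : κ) (j : ι) : Measurable fun ω => ξ i ω j :=
  (measurable_pi_apply j).comp (h.meas i)

omit [Fintype ι] in
lemma integrable_exp_half (i : κ) (j : ι) :
    Integrable (fun ω => Real.exp (|ξ i ω j| / (2 * b))) P := by
  have hm := h.measurable_coord i j
  refine (h.int_exp i j).mono' (by fun_prop) (Filter.Eventually.of_forall fun ω => ?_)
  rw [Real.norm_eq_abs, abs_of_pos (Real.exp_pos _)]
  exact exp_half_le h.b_pos (abs_nonneg _)

omit [Fintype ι] in
lemma integral_exp_half_le (i : κ) (j : ι) :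
    ∫ ω, Real.exp (|ξ i ω j| / (2 * b)) ∂P ≤ 6 :=
  (integral_mono (h.integrable_exp_half i j) (h.int_exp i j)
    fun _ => exp_half_le h.b_pos (abs_nonneg _)).trans (h.exp_le i j)

omit [Fintype ι] in
lemma integrable_cube (i : κ) (j : ι) : Integrable (fun ω => |ξ i ω j| ^ 3) P := by
  have hm := h.measurable_coord i j
  refine ((h.integrable_exp_half i j).const_mul (48 * b ^ 3)).mono' (by fun_prop)
    (Filter.Eventually.of_forall fun ω => ?_)
  rw [Real.norm_eq_abs, abs_of_nonneg (by positivity)]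
  exact pow_three_le_exp h.b_pos (abs_nonneg _)

omit [Fintype ι] in
lemma integral_cube_le (i : κ) (j : ι) : ∫ ω, |ξ i ω j| ^ 3 ∂P ≤ 288 * b ^ 3 := by
  have hb := h.b_pos
  calc ∫ ω, |ξ i ω j| ^ 3 ∂P ≤ ∫ ω, 48 * b ^ 3 * Real.exp (|ξ i ω j| / (2 * b)) ∂P :=
        integral_mono (h.integrable_cube i j) ((h.integrable_exp_half i j).const_mul _)
          fun ω => pow_three_le_exp h.b_pos (abs_nonneg _)
    _ = 48 * b ^ 3 * ∫ ω, Real.exp (|ξ i ω j| / (2 * b)) ∂P := integral_const_mul _ _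
    _ ≤ 48 * b ^ 3 * 6 := by
        gcongr
        exact h.integral_exp_half_le i j
    _ = _ := by ring

lemma measurable_largeBlock (η : ℝ) : Measurable fun ω => largeBlock η (fun r => ξ r ω) := by
  unfold largeBlock
  refine Measurable.ite ?_ measurable_const measurable_const
  simp only [Set.ofPred_exists]
  exact MeasurableSet.iUnion fun r => MeasurableSet.iUnion fun j =>
    measurableSet_lt measurable_const (h.measurable_coord r j).abs

lemma integrable_largeBlock_bound (η : ℝ) : Integrable (fun ω =>
    ∑ r, ∑ j, Real.exp (-(η / (2 * b))) * Real.exp (|ξ r ω j| / (2 * b))) P :=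
  integrable_finsetSum _ fun r _ => integrable_finsetSum _ fun j _ =>
    (h.integrable_exp_half r j).const_mul _

lemma integrable_largeBlock (η : ℝ) :
    Integrable (fun ω => largeBlock η (fun r => ξ r ω)) P := by
  refine (h.integrable_largeBlock_bound η).mono' (h.measurable_largeBlock η).aestronglyMeasurable
    (Filter.Eventually.of_forall fun ω => ?_)
  rw [Real.norm_eq_abs, abs_of_nonneg (largeBlock_nonneg _ _)]
  exact largeBlock_le h.b_pos _

lemma integral_largeBlock_le (η : ℝ) : ∫ ω, largeBlock η (fun r => ξ r ω) ∂P
    ≤ 6 * (Fintype.card κ * Fintype.card ι * Real.exp (-(η / (2 * b)))) := by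
  calc ∫ ω, largeBlock η (fun r => ξ r ω) ∂P
      ≤ ∫ ω, ∑ r, ∑ j, Real.exp (-(η / (2 * b))) * Real.exp (|ξ r ω j| / (2 * b)) ∂P :=
        integral_mono (h.integrable_largeBlock η) (h.integrable_largeBlock_bound η)
          fun ω => largeBlock_le h.b_pos _
    _ = ∑ r, ∑ j, Real.exp (-(η / (2 * b))) * ∫ ω, Real.exp (|ξ r ω j| / (2 * b)) ∂P := by
        rw [integral_finsetSum _ fun r _ => integrable_finsetSum _ fun j _ =>
          (h.integrable_exp_half r j).const_mul _]
        refine Finset.sum_congr rfl fun r _ => ?_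
        rw [integral_finsetSum _ fun j _ => (h.integrable_exp_half r j).const_mul _]
        exact Finset.sum_congr rfl fun j _ => integral_const_mul _ _
    _ ≤ ∑ _r : κ, ∑ _j : ι, Real.exp (-(η / (2 * b))) * 6 := by
        gcongr with r _ j _
        exact h.integral_exp_half_le r j
    _ = _ := by
        simp only [Finset.sum_const, Finset.card_univ, nsmul_eq_mul]
        ring

lemma largeBlock_mul_cube_le (η : ℝ) (i : κ) (j : ι) (ω : Ω) :
    largeBlock η (fun r => ξ r ω) * |ξ i ω j| ^ 3 ≤ ∑ r, ∑ k, 24 * b ^ 3 *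
      Real.exp (-(η / (2 * b))) * (Real.exp (|ξ i ω j| / b) + Real.exp (|ξ r ω k| / b)) := by
  have hb := h.b_pos
  refine (mul_le_mul (largeBlock_le h.b_pos _) (pow_three_le_exp h.b_pos (abs_nonneg _))
    (by positivity) (by positivity)).trans ?_
  rw [Finset.sum_mul]
  refine Finset.sum_le_sum fun r _ => ?_
  rw [Finset.sum_mul]
  refine Finset.sum_le_sum fun k _ => ?_
  have h1 := exp_half_mul_exp_half_le (b := b) (|ξ i ω j|) (|ξ r ω k|)
  have h2 : 0 ≤ 48 * b ^ 3 * Real.exp (-(η / (2 * b))) := by positivity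
  have h3 := mul_le_mul_of_nonneg_left h1 h2
  calc _ = 48 * b ^ 3 * Real.exp (-(η / (2 * b))) *
        (Real.exp (|ξ i ω j| / (2 * b)) * Real.exp (|ξ r ω k| / (2 * b))) := by ring
    _ ≤ _ := h3
    _ = _ := by ring

lemma integrable_largeBlock_mul_cube_bound (η : ℝ) (i : κ) (j : ι) : Integrable (fun ω =>
    ∑ r, ∑ k, 24 * b ^ 3 * Real.exp (-(η / (2 * b))) *
      (Real.exp (|ξ i ω j| / b) + Real.exp (|ξ r ω k| / b))) P :=
  integrable_finsetSum _ fun r _ => integrable_finsetSum _ fun k _ =>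
    ((h.int_exp i j).add (h.int_exp r k)).const_mul _

lemma integrable_largeBlock_mul_cube (η : ℝ) (i : κ) (j : ι) :
    Integrable (fun ω => largeBlock η (fun r => ξ r ω) * |ξ i ω j| ^ 3) P := by
  have hm := h.measurable_coord i j
  refine (h.integrable_largeBlock_mul_cube_bound η i j).mono'
    ((h.measurable_largeBlock η).mul (by fun_prop)).aestronglyMeasurable
    (Filter.Eventually.of_forall fun ω => ?_)
  rw [Real.norm_eq_abs, abs_of_nonneg (mul_nonneg (largeBlock_nonneg _ _) (by positivity))]
  exact h.largeBlock_mul_cube_le η i j ω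

lemma integral_largeBlock_mul_cube_le (η : ℝ) (i : κ) (j : ι) :
    ∫ ω, largeBlock η (fun r => ξ r ω) * |ξ i ω j| ^ 3 ∂P
      ≤ 288 * b ^ 3 * (Fintype.card κ * Fintype.card ι * Real.exp (-(η / (2 * b)))) := by
  have hb := h.b_pos
  calc _ ≤ ∫ ω, ∑ r, ∑ k, 24 * b ^ 3 * Real.exp (-(η / (2 * b))) *
        (Real.exp (|ξ i ω j| / b) + Real.exp (|ξ r ω k| / b)) ∂P :=
        integral_mono (h.integrable_largeBlock_mul_cube η i j)
          (h.integrable_largeBlock_mul_cube_bound η i j) (h.largeBlock_mul_cube_le η i j)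
    _ = ∑ r, ∑ k, 24 * b ^ 3 * Real.exp (-(η / (2 * b))) *
        (∫ ω, Real.exp (|ξ i ω j| / b) ∂P + ∫ ω, Real.exp (|ξ r ω k| / b) ∂P) := by
        have hI : ∀ r k, Integrable (fun ω => 24 * b ^ 3 * Real.exp (-(η / (2 * b))) *
            (Real.exp (|ξ i ω j| / b) + Real.exp (|ξ r ω k| / b))) P := fun r k =>
          ((h.int_exp i j).add (h.int_exp r k)).const_mul _
        rw [integral_finsetSum _ fun r _ => integrable_finsetSum _ fun k _ => hI r k]
        refine Finset.sum_congr rfl fun r _ => ?_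
        rw [integral_finsetSum _ fun k _ => hI r k]
        refine Finset.sum_congr rfl fun k _ => ?_
        rw [integral_const_mul, integral_add (h.int_exp i j) (h.int_exp r k)]
    _ ≤ ∑ _r : κ, ∑ _k : ι, 24 * b ^ 3 * Real.exp (-(η / (2 * b))) * (6 + 6) := by
        gcongr with r _ k _
        · exact h.exp_le i j
        · exact h.exp_le r k
    _ = _ := by
        simp only [Finset.sum_const, Finset.card_univ, nsmul_eq_mul]
        ring

omit [Fintype ι] in
lemma integrable_coord (i : κ) (j : ι) : Integrable (fun ω => ξ i ω j) P := by
  have hb := h.b_pos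
  have hm := h.measurable_coord i j
  refine ((h.int_exp i j).const_mul b).mono' (by fun_prop) (Filter.Eventually.of_forall fun ω => ?_)
  rw [Real.norm_eq_abs]
  have h1 := Real.add_one_le_exp (|ξ i ω j| / b)
  have h2 : |ξ i ω j| / b ≤ Real.exp (|ξ i ω j| / b) := by linarith
  rwa [div_le_iff₀ hb, mul_comm] at h2

omit [Fintype ι] in
lemma integrable_mul_coord (i l : κ) (j k : ι) : Integrable (fun ω => ξ i ω j * ξ l ω k) P := by
  have hb := h.b_pos
  have hm := h.measurable_coord i j
  have hm' := h.measurable_coord l k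
  refine (((h.int_exp i j).add (h.int_exp l k)).const_mul (2 * b ^ 2)).mono' (by fun_prop)
    (Filter.Eventually.of_forall fun ω => ?_)
  rw [Real.norm_eq_abs, abs_mul]
  have h0 : ∀ x : ℝ, 0 ≤ x → x ≤ 2 * b * Real.exp (x / (2 * b)) := by
    intro x hx
    have h1 := Real.add_one_le_exp (x / (2 * b))
    have h2 : x / (2 * b) ≤ Real.exp (x / (2 * b)) := by linarith
    rw [div_le_iff₀ (by positivity)] at h2
    linarith
  have h1 := exp_half_mul_exp_half_le (b := b) (|ξ i ω j|) (|ξ l ω k|)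
  have h2 := mul_le_mul (h0 _ (abs_nonneg (ξ i ω j))) (h0 _ (abs_nonneg (ξ l ω k))) (abs_nonneg _)
    (by positivity)
  refine h2.trans ?_
  calc _ = 4 * b ^ 2 *
        (Real.exp (|ξ i ω j| / (2 * b)) * Real.exp (|ξ l ω k| / (2 * b))) := by ring
    _ ≤ 4 * b ^ 2 * ((Real.exp (|ξ i ω j| / b) + Real.exp (|ξ l ω k| / b)) / 2) := by gcongr
    _ = _ := by simp only [Pi.add_apply]; ring

end Moments

end IsLocallyDependent

end LocalDependence

section LocalDependence

/-- The gradient of `z ↦ g0 (smoothMax L z)`. -/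
noncomputable def SmoothStep.grad {ι : Type*} [Fintype ι] (g : SmoothStep) (L : ℝ) (z : ι → ℝ)
    (j : ι) : ℝ :=
  g.g1 (smoothMax L z) * softmaxWeight L z j

lemma SmoothStep.D1_eq_sum {ι : Type*} [Fintype ι] (g : SmoothStep) (L : ℝ) (z x : ι → ℝ) :
    g.D1 L z x = ∑ j, x j * g.grad L z j := by
  unfold SmoothStep.D1 SmoothStep.grad softmaxAvg
  rw [Finset.mul_sum]
  exact Finset.sum_congr rfl fun j _ => by ring

lemma SmoothStep.abs_grad_le {ι : Type*} [Fintype ι] [Nonempty ι] (g : SmoothStep) (L : ℝ)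
    (z : ι → ℝ) (j : ι) : |g.grad L z j| ≤ g.K := by
  unfold SmoothStep.grad
  rw [abs_mul, abs_of_nonneg (softmaxWeight_nonneg L z j)]
  calc _ ≤ g.K * 1 := mul_le_mul (g.g1_le _) (softmaxWeight_le_one L z j)
        (softmaxWeight_nonneg L z j) (by linarith [g.one_le_K])
    _ = _ := mul_one _

lemma SmoothStep.continuous_grad {ι : Type*} [Fintype ι] [Nonempty ι] (g : SmoothStep) (L : ℝ)
    (j : ι) : Continuous fun z : ι → ℝ => g.grad L z j :=
  (g.continuous_g1.comp (continuous_smoothMax L)).mul (continuous_softmaxWeight L j)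

/-- The interpolation `s ∑ ξ r + c Y - u`, without the blocks in `R`. -/
def partialPoint {Ω κ ι : Type*} [Fintype κ] [DecidableEq κ] (ξ : κ → Ω → ι → ℝ) (Y : Ω → ι → ℝ)
    (s c : ℝ) (u : ι → ℝ) (R : Finset κ) (ω : Ω) : ι → ℝ :=
  blockPoint s (fun r => ξ r ω) (c • Y ω - u) (offWeight R)

namespace IsLocallyDependent

variable {Ω κ ι : Type*} [MeasurableSpace Ω] [Fintype κ] [DecidableEq κ] [Fintype ι]
  [Nonempty ι] {P : Measure Ω} [IsProbabilityMeasure P] {ξ : κ → Ω → ι → ℝ} {Y : Ω → ι → ℝ}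
  {N : κ → Finset κ} {b : ℝ}

variable (h : IsLocallyDependent P ξ Y N b)
include h

omit [Fintype ι] [Nonempty ι] [IsProbabilityMeasure P] in
lemma measurable_partialPoint (s c : ℝ) (u : ι → ℝ) (R : Finset κ) :
    Measurable (partialPoint ξ Y s c u R) := by
  refine measurable_pi_lambda _ fun j => ?_
  have hY : Measurable fun ω => Y ω j := (measurable_pi_apply j).comp h.measY
  unfold partialPoint blockPoint
  simp only [Pi.sub_apply, Pi.smul_apply, smul_eq_mul]
  exact ((Finset.measurable_sum _ fun r _ => (h.measurable_coord r j).const_mul _).const_mul _).add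
    ((hY.const_mul c).sub_const _)

omit [Fintype ι] [Nonempty ι] [IsProbabilityMeasure P] in
lemma indep_partialPoint_one (s c : ℝ) (u : ι → ℝ) (i : κ) :
    IndepFun (ξ i) (partialPoint ξ Y s c u (N i)) P := by
  have h1 := (h.indep_one i).comp (φ := id)
    (ψ := fun q : (ι → ℝ) × (ι → ℝ) => s • q.1 + (c • q.2 - u)) measurable_id (by fun_prop)
  have e : partialPoint ξ Y s c u (N i) = (fun q : (ι → ℝ) × (ι → ℝ) => s • q.1 + (c • q.2 - u)) ∘
      fun ω => (∑ r ∈ (N i)ᶜ, ξ r ω, Y ω) := by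
    funext ω
    simp [partialPoint, blockPoint_offWeight]
  rw [e]
  exact h1

omit [Fintype ι] [Nonempty ι] [IsProbabilityMeasure P] in
lemma indep_partialPoint_two (s c : ℝ) (u : ι → ℝ) {i l : κ} (hl : l ∈ N i) :
    IndepFun (fun ω => (ξ i ω, ξ l ω)) (partialPoint ξ Y s c u (N i ∪ N l)) P := by
  have h1 := (h.indep_two i l hl).comp (φ := id)
    (ψ := fun q : (ι → ℝ) × (ι → ℝ) => s • q.1 + (c • q.2 - u)) measurable_id (by fun_prop)
  have e : partialPoint ξ Y s c u (N i ∪ N l) = (fun q : (ι → ℝ) × (ι → ℝ) => s • q.1 + (c • q.2 - u)) ∘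
      fun ω => (∑ r ∈ (N i ∪ N l)ᶜ, ξ r ω, Y ω) := by
    funext ω
    simp [partialPoint, blockPoint_offWeight]
  rw [e]
  exact h1

omit [Nonempty ι] in
lemma prob_maxNear_partialPoint_le {s : ℝ} (hs : |s| ≤ 1) (c : ℝ) (u : ι → ℝ) {η : ℝ}
    (hη : 0 ≤ η) {R : Finset κ} (hR : (R.card : ℝ) * η ≤ 1) :
    P.real {ω | MaxNear 2 (partialPoint ξ Y s c u R ω)}
      ≤ P.real {ω | MaxNear 3 (partialPoint ξ Y s c u ∅ ω)}
        + 6 * (Fintype.card κ * Fintype.card ι * Real.exp (-(η / (2 * b)))) := by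
  have hm : ∀ a R, MeasurableSet {ω | MaxNear a (partialPoint ξ Y s c u R ω)} := fun a R =>
    h.measurable_partialPoint s c u R (measurableSet_maxNear a)
  have hi : ∀ a R, P.real {ω | MaxNear a (partialPoint ξ Y s c u R ω)}
      = ∫ ω, {ω | MaxNear a (partialPoint ξ Y s c u R ω)}.indicator (fun _ => (1 : ℝ)) ω ∂P :=
    fun a R => by rw [integral_indicator_const _ (hm a R)]; simp
  have hint : ∀ a R, Integrable
      ({ω | MaxNear a (partialPoint ξ Y s c u R ω)}.indicator (fun _ => (1 : ℝ))) P :=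
    fun a R => (integrable_const _).indicator (hm a R)
  refine le_trans ?_ (add_le_add_right (h.integral_largeBlock_le η) _)
  rw [hi, hi, ← integral_add (hint _ _) (h.integrable_largeBlock η)]
  refine integral_mono (hint _ _) ((hint _ _).add (h.integrable_largeBlock η)) fun ω => ?_
  have h0 := largeBlock_nonneg η fun r => ξ r ω
  have h1 : 0 ≤ {ω | MaxNear 3 (partialPoint ξ Y s c u ∅ ω)}.indicator (fun _ => (1 : ℝ)) ω :=
    Set.indicator_nonneg (fun _ _ => zero_le_one) _
  by_cases hω : MaxNear 2 (partialPoint ξ Y s c u R ω)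
  · rw [Set.indicator_of_mem (by exact hω)]
    by_cases hb : ∃ r j, η < |ξ r ω j|
    · have : largeBlock η (fun r => ξ r ω) = 1 := by simp [largeBlock, hb]
      linarith
    · push Not at hb
      have h3 : MaxNear 3 (partialPoint ξ Y s c u ∅ ω) := by
        have := hω.of_close fun j => (blockPoint_sub_le hs (c • Y ω - u) hη hb
          (fun r => offWeight_mem R r) (fun r => offWeight_mem ∅ r)
          (fun r hr => offWeight_of_notMem hr) (fun r hr => offWeight_of_notMem hr) j).trans
            (by simpa using hR)
        norm_num at this
        exact this
      rw [Set.indicator_of_mem (by exact h3)]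
      linarith
  · rw [Set.indicator_of_notMem (by exact hω)]
    linarith

omit [IsProbabilityMeasure P] in
lemma integrable_localWeight_mul_cube (a L : ℝ) {Z : Ω → ι → ℝ} (hZ : Measurable Z) (i : κ)
    (j : ι) : Integrable (fun ω => localWeight a L (Z ω) j * |ξ i ω j| ^ 3) P := by
  refine (h.integrable_cube i j).bdd_mul (c := 1)
    ((measurable_localWeight a L j).comp hZ).aestronglyMeasurable
    (Filter.Eventually.of_forall fun ω => ?_)
  rw [Real.norm_eq_abs, abs_of_nonneg (localWeight_nonneg _ _ _ _)]
  exact localWeight_le_one _ _ _ _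

omit h in
lemma integrable_localWeight (a L : ℝ) {Z : Ω → ι → ℝ} (hZ : Measurable Z) (j : ι) :
    Integrable (fun ω => localWeight a L (Z ω) j) P := by
  refine Integrable.of_bound (C := 1) ((measurable_localWeight a L j).comp hZ).aestronglyMeasurable
    (Filter.Eventually.of_forall fun ω => ?_)
  rw [Real.norm_eq_abs, abs_of_nonneg (localWeight_nonneg _ _ _ _)]
  exact localWeight_le_one _ _ _ _

omit h in
lemma sum_integral_localWeight (a L : ℝ) {Z : Ω → ι → ℝ} (hZ : Measurable Z) :
    ∑ j, ∫ ω, localWeight a L (Z ω) j ∂P = P.real {ω | MaxNear a (Z ω)} := by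
  have hm : MeasurableSet {ω | MaxNear a (Z ω)} := hZ (measurableSet_maxNear a)
  rw [← integral_finsetSum _ fun j _ => integrable_localWeight a L hZ j]
  have : P.real {ω | MaxNear a (Z ω)}
      = ∫ ω, {ω | MaxNear a (Z ω)}.indicator (fun _ => (1 : ℝ)) ω ∂P := by
    rw [integral_indicator_const _ hm]; simp
  rw [this]
  refine integral_congr_ae (Filter.Eventually.of_forall fun ω => ?_)
  simp only [sum_localWeight]
  rfl

/-- The random variable dominating the local averages of `|ξ r| ^ 3` at nearby points. -/
noncomputable def _root_.localMajorant {Ω κ ι : Type*} [Fintype κ] [DecidableEq κ] [Fintype ι]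
    (ξ : κ → Ω → ι → ℝ) (Z : Ω → ι → ℝ) (L η : ℝ) (v : Ω → ι → ℝ) (ω : Ω) : ℝ :=
  8 * localAvg 2 L (Z ω) (fun j => |v ω j| ^ 3)
    + largeBlock η (fun r => ξ r ω) * ∑ j, |v ω j| ^ 3

omit [IsProbabilityMeasure P] in
lemma integrable_localMajorant {Z : Ω → ι → ℝ} (hZ : Measurable Z) (L η : ℝ) (i : κ) :
    Integrable (localMajorant ξ Z L η (ξ i)) P := by
  unfold localMajorant
  simp only [localAvg_eq_sum, Finset.mul_sum]
  exact (integrable_finsetSum _ fun j _ =>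
      (h.integrable_localWeight_mul_cube 2 L hZ i j).const_mul _).add
    (integrable_finsetSum _ fun j _ => h.integrable_largeBlock_mul_cube η i j)

lemma integrable_localMajorant_const {Z : Ω → ι → ℝ} (hZ : Measurable Z) (L η : ℝ) (v : ι → ℝ) :
    Integrable (localMajorant ξ Z L η fun _ => v) P := by
  unfold localMajorant
  simp only [localAvg_eq_sum]
  exact ((integrable_finsetSum _ fun j _ =>
      (integrable_localWeight 2 L hZ j).mul_const _).const_mul _).add
    ((h.integrable_largeBlock η).mul_const _)

lemma integral_localMajorant_const {Z : Ω → ι → ℝ} (hZ : Measurable Z) (L η : ℝ) (v : ι → ℝ) :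
    ∫ ω, localMajorant ξ Z L η (fun _ => v) ω ∂P
      = ∑ j, |v j| ^ 3 * (8 * ∫ ω, localWeight 2 L (Z ω) j ∂P
        + ∫ ω, largeBlock η (fun r => ξ r ω) ∂P) := by
  unfold localMajorant
  simp only [localAvg_eq_sum]
  rw [integral_add ((integrable_finsetSum _ fun j _ =>
      (integrable_localWeight 2 L hZ j).mul_const _).const_mul _)
    ((h.integrable_largeBlock η).mul_const _), integral_const_mul, integral_mul_const,
    integral_finsetSum _ fun j _ => (integrable_localWeight 2 L hZ j).mul_const _,
    Finset.mul_sum, Finset.mul_sum, ← Finset.sum_add_distrib]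
  refine Finset.sum_congr rfl fun j _ => ?_
  rw [integral_mul_const]
  ring

lemma integral_localMajorant_le {s : ℝ} (hs : |s| ≤ 1) (c : ℝ) (u : ι → ℝ) (L : ℝ) {η ρ τ : ℝ}
    (hη : 0 ≤ η) (i : κ) (hN : ((N i).card : ℝ) * η ≤ 1)
    (hρ : P.real {ω | MaxNear 3 (partialPoint ξ Y s c u ∅ ω)} ≤ ρ)
    (hτ : Fintype.card κ * (Fintype.card ι : ℝ) ^ 2 * Real.exp (-(η / (2 * b))) ≤ τ) :
    ∫ ω, localMajorant ξ (partialPoint ξ Y s c u (N i)) L η (ξ i) ω ∂P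
      ≤ 16000 * b ^ 3 * (ρ + τ) := by
  have hb := h.b_pos
  have hZ := h.measurable_partialPoint s c u (N i)
  have hind : ∀ j, ∫ ω, localWeight 2 L (partialPoint ξ Y s c u (N i) ω) j * |ξ i ω j| ^ 3 ∂P
      = (∫ ω, localWeight 2 L (partialPoint ξ Y s c u (N i) ω) j ∂P)
        * ∫ ω, |ξ i ω j| ^ 3 ∂P := by
    intro j
    have h1 := (h.indep_partialPoint_one s c u i).symm.comp
      (measurable_localWeight 2 L j) (ψ := fun v : ι → ℝ => |v j| ^ 3) (by fun_prop)
    have hmj := h.measurable_coord i j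
    exact h1.integral_fun_mul_eq_mul_integral
      ((measurable_localWeight 2 L j).comp hZ).aestronglyMeasurable
      (by
        have : Measurable fun ω => |ξ i ω j| ^ 3 := by fun_prop
        exact this.aestronglyMeasurable)
  have h0 : ∀ j, 0 ≤ ∫ ω, localWeight 2 L (partialPoint ξ Y s c u (N i) ω) j ∂P := fun j =>
    integral_nonneg fun ω => localWeight_nonneg _ _ _ _
  have hp := h.prob_maxNear_partialPoint_le hs c u hη hN
  set E := Real.exp (-(η / (2 * b)))
  have hE : 0 < E := Real.exp_pos _
  have hι : (1 : ℝ) ≤ Fintype.card ι := by exact_mod_cast Fintype.card_pos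
  have hκ : (0 : ℝ) ≤ Fintype.card κ := by positivity
  have hτ1 : Fintype.card κ * Fintype.card ι * E ≤ τ := by
    refine le_trans ?_ hτ
    have : (Fintype.card ι : ℝ) ≤ (Fintype.card ι : ℝ) ^ 2 := by nlinarith
    gcongr
  have hρ0 : 0 ≤ ρ := measureReal_nonneg.trans hρ
  have hτ0 : 0 ≤ τ := le_trans (by positivity) hτ1
  calc ∫ ω, localMajorant ξ (partialPoint ξ Y s c u (N i)) L η (ξ i) ω ∂P
      = ∑ j, 8 * ∫ ω, localWeight 2 L (partialPoint ξ Y s c u (N i) ω) j * |ξ i ω j| ^ 3 ∂P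
        + ∑ j, ∫ ω, largeBlock η (fun r => ξ r ω) * |ξ i ω j| ^ 3 ∂P := by
        unfold localMajorant
        simp only [localAvg_eq_sum, Finset.mul_sum]
        rw [integral_add (integrable_finsetSum _ fun j _ =>
            (h.integrable_localWeight_mul_cube 2 L hZ i j).const_mul _)
          (integrable_finsetSum _ fun j _ => h.integrable_largeBlock_mul_cube η i j),
          integral_finsetSum _ fun j _ =>
            (h.integrable_localWeight_mul_cube 2 L hZ i j).const_mul _,
          integral_finsetSum _ fun j _ => h.integrable_largeBlock_mul_cube η i j]
        congr 1
        exact Finset.sum_congr rfl fun j _ => integral_const_mul _ _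
    _ ≤ ∑ j, 8 * ((∫ ω, localWeight 2 L (partialPoint ξ Y s c u (N i) ω) j ∂P) * (288 * b ^ 3))
        + ∑ _j : ι, 288 * b ^ 3 * (Fintype.card κ * Fintype.card ι * E) := by
        simp only [hind]
        gcongr with j _ j _
        · exact h0 j
        · exact h.integral_cube_le i j
        · exact h.integral_largeBlock_mul_cube_le η i j
    _ = 8 * 288 * b ^ 3 * P.real {ω | MaxNear 2 (partialPoint ξ Y s c u (N i) ω)}
        + 288 * b ^ 3 * (Fintype.card κ * (Fintype.card ι : ℝ) ^ 2 * E) := by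
        rw [← Finset.mul_sum, ← Finset.sum_mul, sum_integral_localWeight 2 L hZ]
        simp only [Finset.sum_const, Finset.card_univ, nsmul_eq_mul]
        ring
    _ ≤ 8 * 288 * b ^ 3 * (ρ + 6 * τ) + 288 * b ^ 3 * τ := by
        gcongr
        exact hp.trans (by linarith)
    _ ≤ _ := by
        have : 0 ≤ b ^ 3 := by positivity
        nlinarith [mul_nonneg this hρ0, mul_nonneg this hτ0]

lemma integral_integral_localMajorant_le {s : ℝ} (hs : |s| ≤ 1) (c : ℝ) (u : ι → ℝ) (L : ℝ)
    {η ρ τ : ℝ} (hη : 0 ≤ η) (i : κ)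
    (hρ : P.real {ω | MaxNear 3 (partialPoint ξ Y s c u ∅ ω)} ≤ ρ)
    (hτ : Fintype.card κ * (Fintype.card ι : ℝ) ^ 2 * Real.exp (-(η / (2 * b))) ≤ τ) :
    Integrable (fun ω' => ∫ ω,
        localMajorant ξ (partialPoint ξ Y s c u ∅) L η (fun _ => ξ i ω') ω ∂P) P ∧
    ∫ ω', ∫ ω, localMajorant ξ (partialPoint ξ Y s c u ∅) L η (fun _ => ξ i ω') ω ∂P ∂P
      ≤ 16000 * b ^ 3 * (ρ + τ) := by
  have hb := h.b_pos
  have hZ := h.measurable_partialPoint s c u ∅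
  simp only [h.integral_localMajorant_const hZ]
  refine ⟨integrable_finsetSum _ fun j _ => (h.integrable_cube i j).mul_const _, ?_⟩
  rw [integral_finsetSum _ fun j _ => (h.integrable_cube i j).mul_const _]
  simp only [integral_mul_const]
  have h0 : ∀ j, 0 ≤ ∫ ω, localWeight 2 L (partialPoint ξ Y s c u ∅ ω) j ∂P := fun j =>
    integral_nonneg fun ω => localWeight_nonneg _ _ _ _
  have hl0 : 0 ≤ ∫ ω, largeBlock η (fun r => ξ r ω) ∂P :=
    integral_nonneg fun ω => largeBlock_nonneg _ _
  have hp := h.prob_maxNear_partialPoint_le hs c u hη (R := ∅) (by simp)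
  have hl := h.integral_largeBlock_le η
  set E := Real.exp (-(η / (2 * b)))
  have hE : 0 < E := Real.exp_pos _
  have hι : (1 : ℝ) ≤ Fintype.card ι := by exact_mod_cast Fintype.card_pos
  have hκ : (0 : ℝ) ≤ Fintype.card κ := by positivity
  have hτ1 : Fintype.card κ * Fintype.card ι * E ≤ τ := by
    refine le_trans ?_ hτ
    have : (Fintype.card ι : ℝ) ≤ (Fintype.card ι : ℝ) ^ 2 := by nlinarith
    gcongr
  have hρ0 : 0 ≤ ρ := measureReal_nonneg.trans hρ
  have hτ0 : 0 ≤ τ := le_trans (by positivity) hτ1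
  calc _ ≤ ∑ j, 288 * b ^ 3 * (8 * ∫ ω, localWeight 2 L (partialPoint ξ Y s c u ∅ ω) j ∂P
        + ∫ ω, largeBlock η (fun r => ξ r ω) ∂P) := by
        refine Finset.sum_le_sum fun j _ => mul_le_mul_of_nonneg_right (h.integral_cube_le i j) ?_
        have := h0 j
        positivity
    _ = 288 * b ^ 3 * (8 * P.real {ω | MaxNear 2 (partialPoint ξ Y s c u ∅ ω)}
        + Fintype.card ι * ∫ ω, largeBlock η (fun r => ξ r ω) ∂P) := by
        rw [← Finset.mul_sum, Finset.sum_add_distrib, ← Finset.mul_sum,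
          sum_integral_localWeight 2 L hZ]
        simp only [Finset.sum_const, Finset.card_univ, nsmul_eq_mul]
    _ ≤ 288 * b ^ 3 * (8 * (ρ + 6 * τ) + 6 * τ) := by
        refine mul_le_mul_of_nonneg_left ?_ (by positivity)
        have a1 : Fintype.card ι * ∫ ω, largeBlock η (fun r => ξ r ω) ∂P ≤ 6 * τ := by
          calc _ ≤ (Fintype.card ι : ℝ) * (6 * (Fintype.card κ * Fintype.card ι * E)) :=
                mul_le_mul_of_nonneg_left hl (by linarith)
            _ = 6 * (Fintype.card κ * (Fintype.card ι : ℝ) ^ 2 * E) := by ring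
            _ ≤ _ := by linarith
        linarith
    _ ≤ _ := by
        have : 0 ≤ b ^ 3 := by positivity
        nlinarith [mul_nonneg this hρ0, mul_nonneg this hτ0]

end IsLocallyDependent

end LocalDependence

section LocalDependence

namespace IsLocallyDependent

variable {Ω κ ι : Type*} [MeasurableSpace Ω] [Fintype κ] [DecidableEq κ] [Fintype ι]
  [Nonempty ι] {P : Measure Ω} [IsProbabilityMeasure P] {ξ : κ → Ω → ι → ℝ} {Y : Ω → ι → ℝ}
  {N : κ → Finset κ} {b : ℝ}

variable (h : IsLocallyDependent P ξ Y N b) (g : SmoothStep)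
include h

omit [IsProbabilityMeasure P] in
lemma integrable_coord_mul_grad (L : ℝ) {Z : Ω → ι → ℝ} (hZ : Measurable Z) (i : κ) (j : ι) :
    Integrable (fun ω => ξ i ω j * g.grad L (Z ω) j) P :=
  (h.integrable_coord i j).mul_bdd (c := g.K)
    ((g.continuous_grad L j).measurable.comp hZ).aestronglyMeasurable
    (Filter.Eventually.of_forall fun ω => g.abs_grad_le L (Z ω) j)

omit [IsProbabilityMeasure P] in
lemma integrable_D1 (L : ℝ) {Z : Ω → ι → ℝ} (hZ : Measurable Z) (i : κ) :
    Integrable (fun ω => g.D1 L (Z ω) (ξ i ω)) P := by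
  simp only [g.D1_eq_sum]
  exact integrable_finsetSum _ fun j _ => h.integrable_coord_mul_grad g L hZ i j

omit [IsProbabilityMeasure P] in
lemma integrable_mul_hess [DecidableEq ι] {L : ℝ} (hL : 1 ≤ L) {Z : Ω → ι → ℝ} (hZ : Measurable Z)
    (i l : κ) (j k : ι) : Integrable (fun ω => ξ i ω j * ξ l ω k * g.hess L (Z ω) j k) P :=
  (h.integrable_mul_coord i l j k).mul_bdd (c := 2 * g.K * L)
    ((g.continuous_hess L j k).measurable.comp hZ).aestronglyMeasurable
    (Filter.Eventually.of_forall fun ω => g.abs_hess_le hL (Z ω) j k)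

omit h in
lemma integrable_hess [DecidableEq ι] {L : ℝ} (hL : 1 ≤ L) {Z : Ω → ι → ℝ} (hZ : Measurable Z)
    (j k : ι) : Integrable (fun ω => g.hess L (Z ω) j k) P :=
  Integrable.of_bound (C := 2 * g.K * L)
    ((g.continuous_hess L j k).measurable.comp hZ).aestronglyMeasurable
    (Filter.Eventually.of_forall fun ω => g.abs_hess_le hL (Z ω) j k)

omit [IsProbabilityMeasure P] in
lemma integrable_D2 {L : ℝ} (hL : 1 ≤ L) {Z : Ω → ι → ℝ} (hZ : Measurable Z) (i l : κ) :
    Integrable (fun ω => g.D2 L (Z ω) (ξ i ω) (ξ l ω)) P := by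
  classical
  simp only [g.D2_eq_sum]
  exact integrable_finsetSum _ fun j _ => integrable_finsetSum _ fun k _ =>
    h.integrable_mul_hess g hL hZ i l j k

omit [IsProbabilityMeasure P] in
lemma integral_D1_partialPoint (L s c : ℝ) (u : ι → ℝ) (i : κ) :
    ∫ ω, g.D1 L (partialPoint ξ Y s c u (N i) ω) (ξ i ω) ∂P = 0 := by
  have hZ := h.measurable_partialPoint s c u (N i)
  simp only [g.D1_eq_sum]
  rw [integral_finsetSum _ fun j _ => h.integrable_coord_mul_grad g L hZ i j]
  refine Finset.sum_eq_zero fun j _ => ?_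
  have hφ : Measurable fun v : ι → ℝ => v j := measurable_pi_apply j
  have h1 := (h.indep_partialPoint_one s c u i).comp hφ (g.continuous_grad L j).measurable
  have h2 := h1.integral_fun_mul_eq_mul_integral (h.measurable_coord i j).aestronglyMeasurable
    ((g.continuous_grad L j).measurable.comp hZ).aestronglyMeasurable
  simp only [Function.comp_apply] at h2
  rw [h2, h.mean_zero i j, zero_mul]

omit [IsProbabilityMeasure P] in
lemma integral_D2_partialPoint [DecidableEq ι] {L : ℝ} (hL : 1 ≤ L) (s c : ℝ) (u : ι → ℝ) {i l : κ}
    (hl : l ∈ N i) :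
    ∫ ω, g.D2 L (partialPoint ξ Y s c u (N i ∪ N l) ω) (ξ i ω) (ξ l ω) ∂P
      = ∑ j, ∑ k, (∫ ω, ξ i ω j * ξ l ω k ∂P)
        * ∫ ω, g.hess L (partialPoint ξ Y s c u (N i ∪ N l) ω) j k ∂P := by
  have hZ := h.measurable_partialPoint s c u (N i ∪ N l)
  simp only [g.D2_eq_sum]
  rw [integral_finsetSum _ fun j _ => integrable_finsetSum _ fun k _ =>
    h.integrable_mul_hess g hL hZ i l j k]
  refine Finset.sum_congr rfl fun j _ => ?_
  rw [integral_finsetSum _ fun k _ => h.integrable_mul_hess g hL hZ i l j k]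
  refine Finset.sum_congr rfl fun k _ => ?_
  have h1 := (h.indep_partialPoint_two s c u hl).comp
    (φ := fun v : (ι → ℝ) × (ι → ℝ) => v.1 j * v.2 k) (by fun_prop)
    (g.continuous_hess L j k).measurable
  exact h1.integral_fun_mul_eq_mul_integral
    (((h.measurable_coord i j).mul (h.measurable_coord l k)).aestronglyMeasurable)
    ((g.continuous_hess L j k).measurable.comp hZ).aestronglyMeasurable

/-- The second order terms of the block expansion, with the neighbourhoods put back. -/
lemma abs_sum_cov_mul_hess_sub_le [DecidableEq ι] {L : ℝ} (hL : 1 ≤ L)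
    (hcard : Real.log (Fintype.card ι) / L ≤ 1 / 2) {s : ℝ} (hs : |s| ≤ 1) (c : ℝ) (u : ι → ℝ)
    {η ρ τ : ℝ} (hη : 0 ≤ η) {D : ℕ} (hN : ∀ i, (N i).card ≤ D) (hDη : 3 * D * η ≤ L⁻¹)
    (hρ : P.real {ω | MaxNear 3 (partialPoint ξ Y s c u ∅ ω)} ≤ ρ)
    (hτ : Fintype.card κ * (Fintype.card ι : ℝ) ^ 2 * Real.exp (-(η / (2 * b))) ≤ τ) (i l : κ) :
    |∑ j, ∑ k, (∫ ω, ξ i ω j * ξ l ω k ∂P)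
        * (∫ ω, g.hess L (partialPoint ξ Y s c u (N i ∪ N l) ω) j k ∂P
          - ∫ ω, g.hess L (partialPoint ξ Y s c u ∅ ω) j k ∂P)|
      ≤ ∑ _r ∈ N i ∪ N l, 16 * g.K * L ^ 2 * (3 * (16000 * b ^ 3 * (ρ + τ))) := by
  have hK := g.one_le_K
  have hLi : L⁻¹ ≤ 1 := inv_le_one_of_one_le₀ hL
  set R := N i ∪ N l with hR
  have hRc : R.card ≤ 2 * D := (Finset.card_union_le _ _).trans (by have := hN i; have := hN l; omega)
  have hZR := h.measurable_partialPoint s c u R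
  have hZ0 := h.measurable_partialPoint s c u ∅
  have hcardη : ∀ m : ℕ, m ≤ 3 * D → (m : ℝ) * η ≤ L⁻¹ := fun m hm => by
    have : (m : ℝ) ≤ 3 * D := by exact_mod_cast hm
    exact (mul_le_mul_of_nonneg_right this hη).trans hDη
  set δ : ι → ι → ℝ := fun j k => ∫ ω, g.hess L (partialPoint ξ Y s c u R ω) j k ∂P
          - ∫ ω, g.hess L (partialPoint ξ Y s c u ∅ ω) j k ∂P with hδ
  let M : κ → Ω → ℝ := fun r => localMajorant ξ (partialPoint ξ Y s c u (N r)) L η (ξ r)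
  let C : (ι → ℝ) → Ω → ℝ := fun v => localMajorant ξ (partialPoint ξ Y s c u ∅) L η fun _ => v
  have hMint : ∀ r, Integrable (M r) P := fun r =>
    h.integrable_localMajorant (h.measurable_partialPoint s c u (N r)) L η r
  have hCint : ∀ v, Integrable (C v) P := fun v => h.integrable_localMajorant_const hZ0 L η v
  have hMle : ∀ r, ∫ ω, M r ω ∂P ≤ 16000 * b ^ 3 * (ρ + τ) := fun r =>
    h.integral_localMajorant_le hs c u L hη r
      ((hcardη _ ((hN r).trans (by omega))).trans hLi) hρ hτ
  have hpoint : ∀ v w : ι → ℝ, |∑ j, ∑ k, v j * w k * δ j k|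
      ≤ ∑ r ∈ R, 16 * g.K * L ^ 2 * (∫ ω, C v ω ∂P + ∫ ω, C w ω ∂P + ∫ ω, M r ω ∂P) := by
    intro v w
    have hi : ∀ Z : Ω → ι → ℝ, Measurable Z →
        Integrable (fun ω => g.D2 L (Z ω) v w) P ∧
        ∫ ω, g.D2 L (Z ω) v w ∂P = ∑ j, ∑ k, v j * w k * ∫ ω, g.hess L (Z ω) j k ∂P := by
      intro Z hZ
      simp only [g.D2_eq_sum]
      have hI : ∀ j k, Integrable (fun ω => v j * w k * g.hess L (Z ω) j k) P := fun j k =>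
        (integrable_hess g hL hZ j k).const_mul _
      refine ⟨integrable_finsetSum _ fun j _ => integrable_finsetSum _ fun k _ => hI j k, ?_⟩
      rw [integral_finsetSum _ fun j _ => integrable_finsetSum _ fun k _ => hI j k]
      refine Finset.sum_congr rfl fun j _ => ?_
      rw [integral_finsetSum _ fun k _ => hI j k]
      exact Finset.sum_congr rfl fun k _ => integral_const_mul _ _
    have e1 : ∑ j, ∑ k, v j * w k * δ j k
        = ∫ ω, (g.D2 L (partialPoint ξ Y s c u R ω) v w
          - g.D2 L (partialPoint ξ Y s c u ∅ ω) v w) ∂P := by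
      rw [integral_sub (hi _ hZR).1 (hi _ hZ0).1, (hi _ hZR).2, (hi _ hZ0).2,
        ← Finset.sum_sub_distrib]
      refine Finset.sum_congr rfl fun j _ => ?_
      rw [← Finset.sum_sub_distrib]
      exact Finset.sum_congr rfl fun k _ => by rw [hδ]; ring
    rw [e1]
    refine abs_integral_le_integral_abs.trans ?_
    calc _ ≤ ∫ ω, ∑ r ∈ R, 16 * g.K * L ^ 2 * (C v ω + C w ω + M r ω) ∂P := by
          refine integral_mono ((hi _ hZR).1.sub (hi _ hZ0).1).abs
            (integrable_finsetSum _ fun r _ =>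
              (((hCint v).add (hCint w)).add (hMint r)).const_mul _) fun ω => ?_
          have hbad : (∃ r j, η < |ξ r ω j|) → largeBlock η (fun r => ξ r ω) = 1 := fun hb => by
            simp [largeBlock, hb]
          refine g.D2_blockPoint_sub_le hL hcard hs (fun r => ξ r ω) (c • Y ω - u)
            (fun r => offWeight_mem _ r) (fun r => offWeight_mem _ r)
            (fun r _ => by simp [offWeight]) (fun r hr => offWeight_of_notMem hr) v w ?_ ?_ ?_
          · intro a ha haR
            exact localAvg_blockPoint_le hL hs _ hη (hcardη _ (by simp; omega))
              (largeBlock_nonneg _ _) hbad ha haR v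
          · intro a ha haR
            exact localAvg_blockPoint_le hL hs _ hη (hcardη _ (by simp; omega))
              (largeBlock_nonneg _ _) hbad ha haR w
          · intro q _ a ha haR
            exact localAvg_blockPoint_le hL hs _ hη (hcardη _ (by have := hN q; omega))
              (largeBlock_nonneg _ _) hbad ha haR (ξ q ω)
      _ = _ := by
          have hI : ∀ r, Integrable (fun ω => 16 * g.K * L ^ 2 * (C v ω + C w ω + M r ω)) P :=
            fun r => (((hCint v).add (hCint w)).add (hMint r)).const_mul _
          rw [integral_finsetSum _ fun r _ => hI r]
          refine Finset.sum_congr rfl fun r _ => ?_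
          have hCC : Integrable (fun ω => C v ω + C w ω) P := (hCint v).add (hCint w)
          rw [integral_const_mul, integral_add hCC (hMint r), integral_add (hCint v) (hCint w)]
  have hCi := fun a => h.integral_integral_localMajorant_le hs c u L hη a hρ hτ
  have e2 : ∑ j, ∑ k, (∫ ω, ξ i ω j * ξ l ω k ∂P) * δ j k
      = ∫ ω, ∑ j, ∑ k, ξ i ω j * ξ l ω k * δ j k ∂P := by
    have hI : ∀ j k, Integrable (fun ω => ξ i ω j * ξ l ω k * δ j k) P := fun j k =>
      (h.integrable_mul_coord i l j k).mul_const _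
    rw [integral_finsetSum _ fun j _ => integrable_finsetSum _ fun k _ => hI j k]
    refine Finset.sum_congr rfl fun j _ => ?_
    rw [integral_finsetSum _ fun k _ => hI j k]
    exact Finset.sum_congr rfl fun k _ => (integral_mul_const _ _).symm
  rw [e2]
  refine abs_integral_le_integral_abs.trans ?_
  have hI : ∀ r, Integrable (fun ω' => 16 * g.K * L ^ 2 *
      (∫ ω, C (ξ i ω') ω ∂P + ∫ ω, C (ξ l ω') ω ∂P + ∫ ω, M r ω ∂P)) P := fun r =>
    (((hCi i).1.add (hCi l).1).add (integrable_const _)).const_mul _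
  calc _ ≤ ∫ ω', ∑ r ∈ R, 16 * g.K * L ^ 2 *
        (∫ ω, C (ξ i ω') ω ∂P + ∫ ω, C (ξ l ω') ω ∂P + ∫ ω, M r ω ∂P) ∂P := by
        refine integral_mono (Integrable.abs ?_) (integrable_finsetSum _ fun r _ => hI r)
          fun ω' => hpoint _ _
        exact integrable_finsetSum _ fun j _ => integrable_finsetSum _ fun k _ =>
          (h.integrable_mul_coord i l j k).mul_const _
    _ = ∑ r ∈ R, 16 * g.K * L ^ 2 * (∫ ω', ∫ ω, C (ξ i ω') ω ∂P ∂P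
        + ∫ ω', ∫ ω, C (ξ l ω') ω ∂P ∂P + ∫ ω, M r ω ∂P) := by
        rw [integral_finsetSum _ fun r _ => hI r]
        refine Finset.sum_congr rfl fun r _ => ?_
        have hCC : Integrable (fun ω' => ∫ ω, C (ξ i ω') ω ∂P + ∫ ω, C (ξ l ω') ω ∂P) P :=
          (hCi i).1.add (hCi l).1
        rw [integral_const_mul, integral_add hCC (integrable_const _),
          integral_add (hCi i).1 (hCi l).1, integral_const, probReal_univ, one_smul]
    _ ≤ _ := by
        refine Finset.sum_le_sum fun r _ => mul_le_mul_of_nonneg_left ?_ (by positivity)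
        have a1 := (hCi i).2
        have a2 := (hCi l).2
        have a3 := hMle r
        linarith

/-- One step of the Stein expansion: the contribution of the summand `ξ i` to the first order term
matches its contribution to the covariance. -/
lemma abs_integral_D1_sub_le [DecidableEq ι] {L : ℝ} (hL : 1 ≤ L)
    (hcard : Real.log (Fintype.card ι) / L ≤ 1 / 2) {s : ℝ} (hs : |s| ≤ 1) (c : ℝ) (u : ι → ℝ)
    {η ρ τ : ℝ} (hη : 0 ≤ η) {D : ℕ} (hN : ∀ i, (N i).card ≤ D) (hDη : 3 * D * η ≤ L⁻¹)
    (hρ : P.real {ω | MaxNear 3 (partialPoint ξ Y s c u ∅ ω)} ≤ ρ)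
    (hτ : Fintype.card κ * (Fintype.card ι : ℝ) ^ 2 * Real.exp (-(η / (2 * b))) ≤ τ) (i : κ) :
    |∫ ω, g.D1 L (partialPoint ξ Y s c u ∅ ω) (ξ i ω) ∂P
        - s * ∑ l ∈ N i, ∑ j, ∑ k, (∫ ω, ξ i ω j * ξ l ω k ∂P)
          * ∫ ω, g.hess L (partialPoint ξ Y s c u ∅ ω) j k ∂P|
      ≤ 3072000 * g.K * L ^ 2 * D ^ 2 * b ^ 3 * (ρ + τ) := by
  have hK := g.one_le_K
  have hLi : L⁻¹ ≤ 1 := inv_le_one_of_one_le₀ hL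
  have hb := h.b_pos
  have hρ0 : 0 ≤ ρ := measureReal_nonneg.trans hρ
  have hτ0 : 0 ≤ τ := le_trans (by positivity) hτ
  set A := 16000 * b ^ 3 * (ρ + τ) with hA
  have hA0 : 0 ≤ A := by positivity
  have hcardη : ∀ m : ℕ, m ≤ 3 * D → (m : ℝ) * η ≤ L⁻¹ := fun m hm => by
    have : (m : ℝ) ≤ 3 * D := by exact_mod_cast hm
    exact (mul_le_mul_of_nonneg_right this hη).trans hDη
  have hZ := h.measurable_partialPoint s c u
  let M : κ → Ω → ℝ := fun r => localMajorant ξ (partialPoint ξ Y s c u (N r)) L η (ξ r)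
  have hMint : ∀ r, Integrable (M r) P := fun r => h.integrable_localMajorant (hZ (N r)) L η r
  have hMle : ∀ r, ∫ ω, M r ω ∂P ≤ A := fun r =>
    h.integral_localMajorant_le hs c u L hη r
      ((hcardη _ ((hN r).trans (by omega))).trans hLi) hρ hτ
  set f : Ω → ℝ := fun ω => g.D1 L (partialPoint ξ Y s c u ∅ ω) (ξ i ω)
    - g.D1 L (partialPoint ξ Y s c u (N i) ω) (ξ i ω)
    - s * ∑ l ∈ N i, g.D2 L (partialPoint ξ Y s c u (N i ∪ N l) ω) (ξ i ω) (ξ l ω) with hf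
  have i1 := h.integrable_D1 g L (hZ ∅) i
  have i2 := h.integrable_D1 g L (hZ (N i)) i
  have i3 : ∀ l, Integrable
      (fun ω => g.D2 L (partialPoint ξ Y s c u (N i ∪ N l) ω) (ξ i ω) (ξ l ω)) P := fun l =>
    h.integrable_D2 g hL (hZ _) i l
  have i4 := (integrable_finsetSum (N i) fun l _ => i3 l).const_mul s
  have hfint : Integrable f P := (i1.sub i2).sub i4
  have hfval : ∫ ω, f ω ∂P = ∫ ω, g.D1 L (partialPoint ξ Y s c u ∅ ω) (ξ i ω) ∂P
      - s * ∑ l ∈ N i, ∑ j, ∑ k, (∫ ω, ξ i ω j * ξ l ω k ∂P)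
        * ∫ ω, g.hess L (partialPoint ξ Y s c u (N i ∪ N l) ω) j k ∂P := by
    have i12 : Integrable (fun ω => g.D1 L (partialPoint ξ Y s c u ∅ ω) (ξ i ω)
      - g.D1 L (partialPoint ξ Y s c u (N i) ω) (ξ i ω)) P := i1.sub i2
    rw [hf, integral_sub i12 i4, integral_sub i1 i2, h.integral_D1_partialPoint g, sub_zero,
      integral_const_mul, integral_finsetSum _ fun l _ => i3 l]
    congr 2
    exact Finset.sum_congr rfl fun l hl => h.integral_D2_partialPoint g hL s c u hl
  have hE : ∀ l r, Integrable (fun ω => 16 * g.K * L ^ 2 * (M i ω + M l ω + M r ω)) P := fun l r =>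
    (((hMint i).add (hMint l)).add (hMint r)).const_mul _
  have hfle : |∫ ω, f ω ∂P| ≤ ∑ l ∈ N i, ∑ _r ∈ N i ∪ N l, 16 * g.K * L ^ 2 * (3 * A) := by
    refine abs_integral_le_integral_abs.trans ?_
    calc _ ≤ ∫ ω, ∑ l ∈ N i, ∑ r ∈ N i ∪ N l, 16 * g.K * L ^ 2 * (M i ω + M l ω + M r ω) ∂P := by
          refine integral_mono hfint.abs (integrable_finsetSum _ fun l _ =>
            integrable_finsetSum _ fun r _ => hE l r) fun ω => ?_
          have hbad : (∃ r j, η < |ξ r ω j|) → largeBlock η (fun r => ξ r ω) = 1 := fun hb => by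
            simp [largeBlock, hb]
          have hexp := g.D1_blockPoint_expansion hL hcard hs (fun r => ξ r ω) (c • Y ω - u) N
            (h.self_mem i) h.self_mem (M := fun r => M r ω) ?_
          · rw [← offWeight_empty] at hexp
            exact hexp
          · intro l _ q _ a ha haR
            refine localAvg_blockPoint_le hL hs _ hη (hcardη _ ?_)
              (largeBlock_nonneg _ _) hbad ha haR (ξ q ω)
            have := Finset.card_union_le (N i) (N l)
            have := hN i
            have := hN l
            have := hN q
            omega
      _ = ∑ l ∈ N i, ∑ r ∈ N i ∪ N l,
          16 * g.K * L ^ 2 * (∫ ω, M i ω ∂P + ∫ ω, M l ω ∂P + ∫ ω, M r ω ∂P) := by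
          rw [integral_finsetSum _ fun l _ => integrable_finsetSum _ fun r _ => hE l r]
          refine Finset.sum_congr rfl fun l _ => ?_
          rw [integral_finsetSum _ fun r _ => hE l r]
          refine Finset.sum_congr rfl fun r _ => ?_
          have hMM : Integrable (fun ω => M i ω + M l ω) P := (hMint i).add (hMint l)
          rw [integral_const_mul, integral_add hMM (hMint r), integral_add (hMint i) (hMint l)]
      _ ≤ _ := by
          refine Finset.sum_le_sum fun l _ => Finset.sum_le_sum fun r _ =>
            mul_le_mul_of_nonneg_left ?_ (by positivity)
          have a1 := hMle i
          have a2 := hMle l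
          have a3 := hMle r
          linarith
  have hB : ∑ l ∈ N i, ∑ _r ∈ N i ∪ N l, 16 * g.K * L ^ 2 * (3 * A)
      ≤ D * (2 * D * (16 * g.K * L ^ 2 * (3 * A))) := by
    have hB0 : 0 ≤ 16 * g.K * L ^ 2 * (3 * A) := by positivity
    calc _ ≤ ∑ _l ∈ N i, 2 * D * (16 * g.K * L ^ 2 * (3 * A)) := by
          refine Finset.sum_le_sum fun l _ => ?_
          rw [Finset.sum_const, nsmul_eq_mul]
          refine mul_le_mul_of_nonneg_right ?_ hB0
          have : (N i ∪ N l).card ≤ 2 * D :=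
            (Finset.card_union_le _ _).trans (by have := hN i; have := hN l; omega)
          exact_mod_cast this
      _ ≤ _ := by
          rw [Finset.sum_const, nsmul_eq_mul]
          have : ((N i).card : ℝ) ≤ D := by exact_mod_cast hN i
          gcongr
  have hsecond : |s * ∑ l ∈ N i, ∑ j, ∑ k, (∫ ω, ξ i ω j * ξ l ω k ∂P)
      * (∫ ω, g.hess L (partialPoint ξ Y s c u (N i ∪ N l) ω) j k ∂P
        - ∫ ω, g.hess L (partialPoint ξ Y s c u ∅ ω) j k ∂P)|
      ≤ ∑ l ∈ N i, ∑ _r ∈ N i ∪ N l, 16 * g.K * L ^ 2 * (3 * A) := by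
    rw [abs_mul]
    calc _ ≤ 1 * ∑ l ∈ N i, |∑ j, ∑ k, (∫ ω, ξ i ω j * ξ l ω k ∂P)
          * (∫ ω, g.hess L (partialPoint ξ Y s c u (N i ∪ N l) ω) j k ∂P
            - ∫ ω, g.hess L (partialPoint ξ Y s c u ∅ ω) j k ∂P)| := by
          gcongr
          exact Finset.abs_sum_le_sum_abs _ _
      _ ≤ _ := by
          rw [one_mul]
          exact Finset.sum_le_sum fun l _ =>
            h.abs_sum_cov_mul_hess_sub_le g hL hcard hs c u hη hN hDη hρ hτ i l
  have hsplit : ∫ ω, g.D1 L (partialPoint ξ Y s c u ∅ ω) (ξ i ω) ∂P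
        - s * ∑ l ∈ N i, ∑ j, ∑ k, (∫ ω, ξ i ω j * ξ l ω k ∂P)
          * ∫ ω, g.hess L (partialPoint ξ Y s c u ∅ ω) j k ∂P
      = ∫ ω, f ω ∂P + s * ∑ l ∈ N i, ∑ j, ∑ k, (∫ ω, ξ i ω j * ξ l ω k ∂P)
      * (∫ ω, g.hess L (partialPoint ξ Y s c u (N i ∪ N l) ω) j k ∂P
        - ∫ ω, g.hess L (partialPoint ξ Y s c u ∅ ω) j k ∂P) := by
    rw [hfval]
    simp only [mul_sub, Finset.sum_sub_distrib]
    ring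
  rw [hsplit]
  refine (abs_add_le _ _).trans ((add_le_add (hfle.trans hB) (hsecond.trans hB)).trans ?_)
  rw [hA]
  apply le_of_eq
  ring

end IsLocallyDependent

end LocalDependence

section Interpolation

lemma partialPoint_empty_apply {Ω κ ι : Type*} [Fintype κ] [DecidableEq κ] (ξ : κ → Ω → ι → ℝ)
    (Y : Ω → ι → ℝ) (s c : ℝ) (u : ι → ℝ) (ω : Ω) (j : ι) :
    partialPoint ξ Y s c u ∅ ω j = s * ∑ r, ξ r ω j + (c * Y ω j - u j) := by
  simp [partialPoint, blockPoint, offWeight]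

namespace IsLocallyDependent

variable {Ω κ ι : Type*} [MeasurableSpace Ω] [Fintype κ] [DecidableEq κ] [Fintype ι]
  [Nonempty ι] {P : Measure Ω} [IsProbabilityMeasure P] {ξ : κ → Ω → ι → ℝ} {Y : Ω → ι → ℝ}
  {N : κ → Finset κ} {b : ℝ}

variable (h : IsLocallyDependent P ξ Y N b) (g : SmoothStep)
include h

lemma hasDerivAt_integral_interpolation {L : ℝ} (hL : 1 ≤ L) (u : ι → ℝ)
    (hYint : ∀ j, Integrable (fun ω => Y ω j) P) (θ : ℝ) :
    HasDerivAt
      (fun θ => ∫ ω, g.g0 (smoothMax L (partialPoint ξ Y (Real.sin θ) (Real.cos θ) u ∅ ω)) ∂P)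
      (∫ ω, g.D1 L (partialPoint ξ Y (Real.sin θ) (Real.cos θ) u ∅ ω)
        (fun j => Real.cos θ * ∑ r, ξ r ω j - Real.sin θ * Y ω j) ∂P) θ := by
  have hK := g.one_le_K
  have hYm : ∀ j, Measurable fun ω => Y ω j := fun j => (measurable_pi_apply j).comp h.measY
  have hZ := fun s c => h.measurable_partialPoint s c u ∅
  have hFm : ∀ θ, Measurable fun ω =>
      g.g0 (smoothMax L (partialPoint ξ Y (Real.sin θ) (Real.cos θ) u ∅ ω)) := fun θ =>
    (g.continuous_g0.comp (continuous_smoothMax L)).measurable.comp (hZ _ _)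
  refine (hasDerivAt_integral_of_dominated_loc_of_deriv_le (s := Set.univ)
    (F := fun θ ω => g.g0 (smoothMax L (partialPoint ξ Y (Real.sin θ) (Real.cos θ) u ∅ ω)))
    (F' := fun θ ω => g.D1 L (partialPoint ξ Y (Real.sin θ) (Real.cos θ) u ∅ ω)
        (fun j => Real.cos θ * ∑ r, ξ r ω j - Real.sin θ * Y ω j))
    (bound := fun ω => g.K * ∑ j, (∑ r, |ξ r ω j| + |Y ω j|))
    Filter.univ_mem ?_ ?_ ?_ ?_ ?_ ?_).2
  · exact Filter.Eventually.of_forall fun θ => (hFm θ).aestronglyMeasurable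
  · refine Integrable.of_bound (C := 1) (hFm θ).aestronglyMeasurable
      (Filter.Eventually.of_forall fun ω => ?_)
    rw [Real.norm_eq_abs, abs_of_nonneg (g.g0_nonneg _)]
    exact g.g0_le_one _
  · have hx : Measurable fun ω => fun j => Real.cos θ * ∑ r, ξ r ω j - Real.sin θ * Y ω j :=
      measurable_pi_lambda _ fun j => ((Finset.measurable_sum _ fun r _ =>
        h.measurable_coord r j).const_mul _).sub ((hYm j).const_mul _)
    exact ((g.continuous_D1 L).measurable.comp ((hZ _ _).prodMk hx)).aestronglyMeasurable
  · refine Filter.Eventually.of_forall fun ω θ _ => ?_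
    refine (g.abs_D1_le L _ _).trans ?_
    gcongr with j _
    have h1 : |Real.cos θ * ∑ r, ξ r ω j| ≤ ∑ r, |ξ r ω j| := by
      rw [abs_mul]
      calc _ ≤ 1 * ∑ r, |ξ r ω j| := mul_le_mul (Real.abs_cos_le_one _)
            (Finset.abs_sum_le_sum_abs _ _) (abs_nonneg _) zero_le_one
        _ = _ := one_mul _
    have h2 : |Real.sin θ * Y ω j| ≤ |Y ω j| := by
      rw [abs_mul]
      exact mul_le_of_le_one_left (abs_nonneg _) (Real.abs_sin_le_one _)
    exact (abs_sub _ _).trans (add_le_add h1 h2)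
  · exact (integrable_finsetSum _ fun j _ => (integrable_finsetSum _ fun r _ =>
      (h.integrable_coord r j).abs).add (hYint j).abs).const_mul _
  · refine Filter.Eventually.of_forall fun ω θ _ => ?_
    refine (g.d0 _).comp θ (hasDerivAt_smoothMax_curve (by linarith)
      (z := fun θ => partialPoint ξ Y (Real.sin θ) (Real.cos θ) u ∅ ω) fun j => ?_)
    simp only [partialPoint_empty_apply]
    refine (((Real.hasDerivAt_sin θ).mul_const _).add
      (((Real.hasDerivAt_cos θ).mul_const (Y ω j)).sub_const (u j))).congr_deriv ?_
    ring

/-- Comparison of the smoothed probabilities along the interpolation from `Y` to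
`sin θ ∑ ξ + cos θ Y`. -/
theorem abs_integral_interpolation_sub_le [DecidableEq ι] {L : ℝ} (hL : 1 ≤ L)
    (hcard : Real.log (Fintype.card ι) / L ≤ 1 / 2) (u : ι → ℝ)
    {η ρ τ : ℝ} (hη : 0 ≤ η) {D : ℕ} (hN : ∀ i, (N i).card ≤ D) (hDη : 3 * D * η ≤ L⁻¹)
    (hτ : Fintype.card κ * (Fintype.card ι : ℝ) ^ 2 * Real.exp (-(η / (2 * b))) ≤ τ)
    (hYint : ∀ j, Integrable (fun ω => Y ω j) P)
    (hstein : ∀ s c : ℝ, ∀ j, ∫ ω, Y ω j * g.grad L (partialPoint ξ Y s c u ∅ ω) j ∂P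
      = c * ∑ k, (∑ i, ∑ l ∈ N i, ∫ ω, ξ i ω j * ξ l ω k ∂P)
        * ∫ ω, g.hess L (partialPoint ξ Y s c u ∅ ω) j k ∂P)
    {θ₀ : ℝ} (hθ₀ : 0 ≤ θ₀)
    (hρ : ∀ θ ∈ Set.Icc 0 θ₀,
      P.real {ω | MaxNear 3 (partialPoint ξ Y (Real.sin θ) (Real.cos θ) u ∅ ω)} ≤ ρ) :
    |∫ ω, g.g0 (smoothMax L (partialPoint ξ Y (Real.sin θ₀) (Real.cos θ₀) u ∅ ω)) ∂P
        - ∫ ω, g.g0 (smoothMax L (partialPoint ξ Y 0 1 u ∅ ω)) ∂P|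
      ≤ Fintype.card κ * (3072000 * g.K * L ^ 2 * D ^ 2 * b ^ 3 * (ρ + τ)) * θ₀ := by
  set H : ℝ → ℝ := fun θ =>
    ∫ ω, g.g0 (smoothMax L (partialPoint ξ Y (Real.sin θ) (Real.cos θ) u ∅ ω)) ∂P with hH
  set H' : ℝ → ℝ := fun θ =>
    ∫ ω, g.D1 L (partialPoint ξ Y (Real.sin θ) (Real.cos θ) u ∅ ω)
        (fun j => Real.cos θ * ∑ r, ξ r ω j - Real.sin θ * Y ω j) ∂P with hH'
  have hd : ∀ θ, HasDerivAt H (H' θ) θ := h.hasDerivAt_integral_interpolation g hL u hYint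
  have hbound : ∀ θ ∈ Set.Ico 0 θ₀, ‖H' θ‖
      ≤ Fintype.card κ * (3072000 * g.K * L ^ 2 * D ^ 2 * b ^ 3 * (ρ + τ)) := by
    intro θ hθ
    set s := Real.sin θ
    set c := Real.cos θ
    have hZ := h.measurable_partialPoint s c u ∅
    have iY : ∀ j, Integrable (fun ω => Y ω j * g.grad L (partialPoint ξ Y s c u ∅ ω) j) P :=
      fun j => (hYint j).mul_bdd (c := g.K)
        ((g.continuous_grad L j).measurable.comp hZ).aestronglyMeasurable
        (Filter.Eventually.of_forall fun ω => g.abs_grad_le L _ j)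
    have iξ := fun i => h.integrable_D1 g L hZ i
    have e1 : H' θ = c * ∑ i, (∫ ω, g.D1 L (partialPoint ξ Y s c u ∅ ω) (ξ i ω) ∂P
        - s * ∑ l ∈ N i, ∑ j, ∑ k, (∫ ω, ξ i ω j * ξ l ω k ∂P)
          * ∫ ω, g.hess L (partialPoint ξ Y s c u ∅ ω) j k ∂P) := by
      have e2 : ∀ ω, g.D1 L (partialPoint ξ Y s c u ∅ ω)
          (fun j => c * ∑ r, ξ r ω j - s * Y ω j)
          = c * ∑ i, g.D1 L (partialPoint ξ Y s c u ∅ ω) (ξ i ω)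
            - s * ∑ j, Y ω j * g.grad L (partialPoint ξ Y s c u ∅ ω) j := by
        intro ω
        simp only [g.D1_eq_sum]
        rw [Finset.sum_comm, Finset.mul_sum, Finset.mul_sum, ← Finset.sum_sub_distrib]
        refine Finset.sum_congr rfl fun j _ => ?_
        rw [← Finset.sum_mul]
        ring
      rw [show H' θ = ∫ ω, (c * ∑ i, g.D1 L (partialPoint ξ Y s c u ∅ ω) (ξ i ω)
            - s * ∑ j, Y ω j * g.grad L (partialPoint ξ Y s c u ∅ ω) j) ∂P from
          integral_congr_ae (Filter.Eventually.of_forall e2),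
        integral_sub ((integrable_finsetSum _ fun i _ => iξ i).const_mul _)
        ((integrable_finsetSum _ fun j _ => iY j).const_mul _), integral_const_mul,
        integral_const_mul, integral_finsetSum _ fun i _ => iξ i,
        integral_finsetSum _ fun j _ => iY j, Finset.sum_sub_distrib, mul_sub]
      congr 1
      simp only [hstein]
      rw [← Finset.mul_sum, ← Finset.mul_sum, mul_left_comm]
      congr 2
      simp only [Finset.sum_mul]
      have e3 : ∀ i, ∑ l ∈ N i, ∑ j, ∑ k, (∫ ω, ξ i ω j * ξ l ω k ∂P)
          * ∫ ω, g.hess L (partialPoint ξ Y s c u ∅ ω) j k ∂P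
          = ∑ j, ∑ k, ∑ l ∈ N i, (∫ ω, ξ i ω j * ξ l ω k ∂P)
          * ∫ ω, g.hess L (partialPoint ξ Y s c u ∅ ω) j k ∂P := by
        intro i
        rw [Finset.sum_comm]
        exact Finset.sum_congr rfl fun j _ => Finset.sum_comm
      simp only [e3]
      refine Eq.trans (Finset.sum_congr rfl fun j _ => ?_) Finset.sum_comm
      exact Finset.sum_comm
    rw [e1, Real.norm_eq_abs, abs_mul]
    calc _ ≤ 1 * ∑ i, |∫ ω, g.D1 L (partialPoint ξ Y s c u ∅ ω) (ξ i ω) ∂P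
        - s * ∑ l ∈ N i, ∑ j, ∑ k, (∫ ω, ξ i ω j * ξ l ω k ∂P)
          * ∫ ω, g.hess L (partialPoint ξ Y s c u ∅ ω) j k ∂P| :=
          mul_le_mul (Real.abs_cos_le_one θ) (Finset.abs_sum_le_sum_abs _ _) (abs_nonneg _)
            zero_le_one
      _ ≤ 1 * ∑ _i : κ, 3072000 * g.K * L ^ 2 * D ^ 2 * b ^ 3 * (ρ + τ) := by
          gcongr with i _
          exact h.abs_integral_D1_sub_le g hL hcard (Real.abs_sin_le_one θ) c u hη hN hDη
            (hρ θ (Set.Ico_subset_Icc_self hθ)) hτ i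
      _ = _ := by
          rw [one_mul, Finset.sum_const, Finset.card_univ, nsmul_eq_mul]
  have hmvt := norm_image_sub_le_of_norm_deriv_le_segment'
    (fun θ _ => (hd θ).hasDerivWithinAt) hbound θ₀ (Set.right_mem_Icc.2 hθ₀)
  simp only [hH, Real.sin_zero, Real.cos_zero, sub_zero, Real.norm_eq_abs] at hmvt
  exact hmvt

end IsLocallyDependent

end Interpolation

section Orlicz

variable {Ω : Type*} [MeasurableSpace Ω] {P : Measure Ω}

lemma lintegral_exp_le_of_psiNorm_le [IsProbabilityMeasure P] {γ B : ℝ} (hγ : 1 ≤ γ) (hB : 0 < B)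
    {ξ : Ω → ℝ} (h : psiNorm P γ ξ ≤ ENNReal.ofReal B) :
    ∫⁻ ω, ENNReal.ofReal (Real.exp (|ξ ω| / (2 * B))) ∂P ≤ 6 := by
  have h1 : psiNorm P γ ξ < ENNReal.ofReal (2 * B) :=
    h.trans_lt ((ENNReal.ofReal_lt_ofReal_iff (by linarith)).2 (by linarith))
  obtain ⟨a, ⟨l, hl, rfl, hint⟩, hlt⟩ := sInf_lt_iff.1 h1
  have hlB : l < 2 * B := (ENNReal.ofReal_lt_ofReal_iff (by linarith)).1 hlt
  have hpt : ∀ ω, ENNReal.ofReal (Real.exp (|ξ ω| / (2 * B)))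
      ≤ ENNReal.ofReal (Real.exp 1) *
        (ENNReal.ofReal (Real.exp ((|ξ ω| / l) ^ γ) - 1) + 1) := by
    intro ω
    have hx : 0 ≤ |ξ ω| / l := by positivity
    have hy : 0 ≤ (|ξ ω| / l) ^ γ := Real.rpow_nonneg hx _
    have h2 : |ξ ω| / l ≤ 1 + (|ξ ω| / l) ^ γ := by
      rcases le_total (|ξ ω| / l) 1 with h | h
      · linarith
      · linarith [Real.self_le_rpow_of_one_le h hγ]
    have h3 : |ξ ω| / (2 * B) ≤ |ξ ω| / l := by gcongr
    have h4 : 0 ≤ Real.exp ((|ξ ω| / l) ^ γ) - 1 := by linarith [Real.one_le_exp hy]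
    rw [← ENNReal.ofReal_one, ← ENNReal.ofReal_add h4 zero_le_one,
      ← ENNReal.ofReal_mul (Real.exp_pos _).le]
    apply ENNReal.ofReal_le_ofReal
    rw [sub_add_cancel, ← Real.exp_add]
    exact Real.exp_le_exp.2 (h3.trans h2)
  calc _ ≤ ∫⁻ ω, ENNReal.ofReal (Real.exp 1) *
        (ENNReal.ofReal (Real.exp ((|ξ ω| / l) ^ γ) - 1) + 1) ∂P := lintegral_mono hpt
    _ = ENNReal.ofReal (Real.exp 1) *
        (∫⁻ ω, ENNReal.ofReal (Real.exp ((|ξ ω| / l) ^ γ) - 1) ∂P + 1) := by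
      rw [lintegral_const_mul' _ _ ENNReal.ofReal_ne_top, lintegral_add_right _ measurable_const]
      simp
    _ ≤ ENNReal.ofReal 3 * (1 + 1) := by
      gcongr
      exact Real.exp_one_lt_three.le
    _ = 6 := by
      rw [ENNReal.ofReal_ofNat]
      norm_num

lemma integrable_exp_of_psiNorm_le [IsProbabilityMeasure P] {γ B : ℝ} (hγ : 1 ≤ γ) (hB : 0 < B)
    {ξ : Ω → ℝ} (hξ : Measurable ξ) (h : psiNorm P γ ξ ≤ ENNReal.ofReal B) :
    Integrable (fun ω => Real.exp (|ξ ω| / (2 * B))) P := by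
  refine (lintegral_ofReal_ne_top_iff_integrable (by fun_prop)
    (Filter.Eventually.of_forall fun ω => (Real.exp_pos _).le)).1 ?_
  exact ((lintegral_exp_le_of_psiNorm_le hγ hB h).trans_lt (by norm_num)).ne

lemma integral_exp_le_of_psiNorm_le [IsProbabilityMeasure P] {γ B : ℝ} (hγ : 1 ≤ γ) (hB : 0 < B)
    {ξ : Ω → ℝ} (hξ : Measurable ξ) (h : psiNorm P γ ξ ≤ ENNReal.ofReal B) :
    ∫ ω, Real.exp (|ξ ω| / (2 * B)) ∂P ≤ 6 := by
  rw [integral_eq_lintegral_of_nonneg_ae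
    (Filter.Eventually.of_forall fun ω => (Real.exp_pos _).le) (by fun_prop)]
  refine ENNReal.toReal_le_of_le_ofReal (by norm_num) ?_
  rw [ENNReal.ofReal_ofNat]
  exact lintegral_exp_le_of_psiNorm_le hγ hB h

end Orlicz

section Independence

variable {Ω : Type*} [MeasurableSpace Ω] {P : Measure Ω} [IsProbabilityMeasure P]

lemma IndepFun.prodMk_right_of_indepFun_prodMk {α β γ : Type*} [MeasurableSpace α]
    [MeasurableSpace β] [MeasurableSpace γ] {U : Ω → α} {V : Ω → β} {G : Ω → γ}
    (hU : Measurable U) (hV : Measurable V) (hG : Measurable G) (hUV : IndepFun U V P)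
    (h : IndepFun (fun ω => (U ω, V ω)) G P) : IndepFun U (fun ω => (V ω, G ω)) P := by
  have hVG : IndepFun V G P := h.comp measurable_snd measurable_id
  rw [indepFun_iff_map_prod_eq_prod_map_map hU.aemeasurable (hV.prodMk hG).aemeasurable,
    (indepFun_iff_map_prod_eq_prod_map_map hV.aemeasurable hG.aemeasurable).1 hVG]
  have h1 := (indepFun_iff_map_prod_eq_prod_map_map (hU.prodMk hV).aemeasurable
    hG.aemeasurable).1 h
  rw [(indepFun_iff_map_prod_eq_prod_map_map hU.aemeasurable hV.aemeasurable).1 hUV] at h1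
  have := Measure.isProbabilityMeasure_map (μ := P) hU.aemeasurable
  have := Measure.isProbabilityMeasure_map (μ := P) hV.aemeasurable
  have := Measure.isProbabilityMeasure_map (μ := P) hG.aemeasurable
  have h2 := (measurePreserving_prodAssoc (P.map U) (P.map V) (P.map G)).map_eq
  rw [← h2, ← h1, Measure.map_map (by fun_prop) (by fun_prop)]
  rfl

variable {n p : ℕ} {X : Fin n → Ω → EuclideanSpace ℝ (Fin p)} {G : Ω → EuclideanSpace ℝ (Fin p)}
  {E : SimpleGraph (Fin n)}

lemma IsDependencyGraph.indepFun_comp (hE : IsDependencyGraph P X E) (hX : ∀ t, Measurable (X t))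
    (hG : Measurable G) (hXG : IndepFun (fun ω t => X t ω) G P) {A B : Set (Fin n)}
    (hAB : Disjoint A B) (hadj : ∀ a ∈ A, ∀ b ∈ B, ¬ E.Adj a b) {α β : Type*} [MeasurableSpace α]
    [MeasurableSpace β] {f : (A → EuclideanSpace ℝ (Fin p)) → α}
    {h : (B → EuclideanSpace ℝ (Fin p)) × EuclideanSpace ℝ (Fin p) → β} (hf : Measurable f)
    (hh : Measurable h) :
    IndepFun (fun ω => f fun a => X a ω) (fun ω => h (fun b => X b ω, G ω)) P := by
  have h1 : IndepFun (fun ω (a : A) => X a ω) (fun ω => ((fun b : B => X b ω), G ω)) P := by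
    refine IndepFun.prodMk_right_of_indepFun_prodMk (by fun_prop) (by fun_prop) hG
      (hE A B hAB hadj) ?_
    exact hXG.comp (φ := fun x : Fin n → EuclideanSpace ℝ (Fin p) =>
      ((fun a : A => x a), (fun b : B => x b))) (by fun_prop) measurable_id
  exact h1.comp hf hh

end Independence

section Neighbourhoods

variable {n : ℕ} (E : SimpleGraph (Fin n))

/-- The neighbour nodes of `t`, as a finite set. -/
noncomputable def nbhdFinset (t : Fin n) : Finset (Fin n) := (nbhd E t).toFinite.toFinset

variable {E}

lemma mem_nbhdFinset {s t : Fin n} : s ∈ nbhdFinset E t ↔ s = t ∨ E.Adj t s := by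
  simp [nbhdFinset, nbhd]

variable (E)

lemma card_nbhdFinset_le (t : Fin n) : (nbhdFinset E t).card ≤ maxDegOne E := by
  rw [nbhdFinset, ← Set.ncard_eq_toFinset_card]
  exact Finset.le_sup (f := fun t => (nbhd E t).ncard) (Finset.mem_univ t)

lemma one_le_maxDegOne [NeZero n] : 1 ≤ maxDegOne E := by
  refine le_trans ?_ (card_nbhdFinset_le E 0)
  exact Finset.card_pos.2 ⟨0, mem_nbhdFinset.2 (Or.inl rfl)⟩

lemma maxDegOne_le_maxDegTwo : maxDegOne E ≤ maxDegTwo E := by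
  refine Finset.sup_mono_fun fun t _ => Set.ncard_le_ncard ?_ (Set.toFinite _)
  exact Set.subset_biUnion_of_mem (u := fun l => nbhd E l) (show t ∈ nbhd E t from Or.inl rfl)

end Neighbourhoods

section Covariance

variable {Ω : Type*} [MeasurableSpace Ω] {P : Measure Ω} [IsProbabilityMeasure P]
  {n p : ℕ} {X : Fin n → Ω → EuclideanSpace ℝ (Fin p)} {G : Ω → EuclideanSpace ℝ (Fin p)}
  {E : SimpleGraph (Fin n)}

lemma normSum_apply {Ω : Type*} (X : Fin n → Ω → EuclideanSpace ℝ (Fin p)) (ω : Ω) (j : Fin p) :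
    normSum X ω j = (Real.sqrt n)⁻¹ * ∑ t, X t ω j := by
  simp [normSum]

omit [IsProbabilityMeasure P] in
lemma longRunCov_self (X : Fin n → Ω → EuclideanSpace ℝ (Fin p)) (hX : ∀ t, Measurable (X t))
    (j : Fin p) : longRunCov P X j j = longRunVar P X j := by
  have hm : ∀ t, Measurable fun ω => X t ω j := fun t => by fun_prop
  simp only [longRunCov, longRunVar, Matrix.of_apply, normSum_apply]
  exact covariance_self (by fun_prop)

lemma longRunCov_eq_sum (hX2 : ∀ t j, MemLp (fun ω => X t ω j) 2 P)
    (hX0 : ∀ t j, ∫ ω, X t ω j ∂P = 0) (j k : Fin p) :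
    longRunCov P X j k = (n : ℝ)⁻¹ * ∑ i, ∑ l, ∫ ω, X i ω j * X l ω k ∂P := by
  simp only [longRunCov, Matrix.of_apply, normSum_apply]
  rw [covariance_const_mul_left, covariance_const_mul_right,
    covariance_fun_sum_fun_sum (fun i => hX2 i j) (fun i => hX2 i k), ← mul_assoc, ← mul_inv,
    Real.mul_self_sqrt (Nat.cast_nonneg n)]
  congr 1
  refine Finset.sum_congr rfl fun i _ => Finset.sum_congr rfl fun l _ => ?_
  rw [covariance_eq_sub (hX2 i j) (hX2 l k), hX0, zero_mul, sub_zero]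
  rfl

lemma longRunCov_posSemidef (hX2 : ∀ t j, MemLp (fun ω => X t ω j) 2 P) :
    (longRunCov P X).PosSemidef := by
  have hS : ∀ j, MemLp (fun ω => normSum X ω j) 2 P := fun j => by
    simp only [normSum_apply]
    exact (memLp_finsetSum _ fun i _ => hX2 i j).const_mul _
  refine Matrix.PosSemidef.of_dotProduct_mulVec_nonneg ?_ fun v => ?_
  · ext j k
    simp only [longRunCov, Matrix.conjTranspose_apply, Matrix.of_apply, star_trivial]
    exact covariance_comm _ _
  · have h1 : Var[fun ω => ∑ j, v j * normSum X ω j; P]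
        = star v ⬝ᵥ (longRunCov P X).mulVec v := by
      rw [← covariance_self (Finset.aemeasurable_fun_sum _ fun j _ =>
          (hS j).aestronglyMeasurable.aemeasurable.const_mul _),
        covariance_fun_sum_fun_sum (fun j => (hS j).const_mul _) (fun j => (hS j).const_mul _)]
      simp only [covariance_const_mul_left, covariance_const_mul_right, dotProduct, Matrix.mulVec,
        longRunCov, Matrix.of_apply, star_trivial, Finset.mul_sum]
      exact Finset.sum_congr rfl fun j _ => Finset.sum_congr rfl fun k _ => by ring
    rw [← h1]
    exact variance_nonneg _ _

/-- The block decomposition of the long-run covariances along the dependency graph. -/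
lemma IsDependencyGraph.longRunCov_eq (hE : IsDependencyGraph P X E)
    (hX2 : ∀ t j, MemLp (fun ω => X t ω j) 2 P) (hX0 : ∀ t j, ∫ ω, X t ω j ∂P = 0)
    (j k : Fin p) :
    longRunCov P X j k
      = (n : ℝ)⁻¹ * ∑ i, ∑ l ∈ nbhdFinset E i, ∫ ω, X i ω j * X l ω k ∂P := by
  rw [longRunCov_eq_sum hX2 hX0]
  congr 1
  refine Finset.sum_congr rfl fun i _ => (Finset.sum_subset (Finset.subset_univ _) ?_).symm
  intro l _ hl
  rw [mem_nbhdFinset, not_or] at hl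
  have h1 := hE {i} {l} (Set.disjoint_singleton.2 (Ne.symm hl.1)) (by
    rintro a rfl b rfl
    exact hl.2)
  have h2 : IndepFun (fun ω => X i ω j) (fun ω => X l ω k) P :=
    h1.comp (φ := fun x : ({i} : Set (Fin n)) → EuclideanSpace ℝ (Fin p) => x ⟨i, rfl⟩ j)
      (ψ := fun x : ({l} : Set (Fin n)) → EuclideanSpace ℝ (Fin p) => x ⟨l, rfl⟩ k)
      (by fun_prop) (by fun_prop)
  rw [h2.integral_fun_mul_eq_mul_integral (hX2 i j).aestronglyMeasurable
    (hX2 l k).aestronglyMeasurable, hX0, zero_mul]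

end Covariance

section LocalDependence

variable {Ω : Type*} [MeasurableSpace Ω] {P : Measure Ω} [IsProbabilityMeasure P]
  {n p : ℕ} {X : Fin n → Ω → EuclideanSpace ℝ (Fin p)} {G : Ω → EuclideanSpace ℝ (Fin p)}
  {E : SimpleGraph (Fin n)}

/-- Multiples of the terms of a sequence with a dependency graph are locally dependent. -/
lemma IsDependencyGraph.isLocallyDependent (hE : IsDependencyGraph P X E)
    (hX : ∀ t, Measurable (X t)) (hG : Measurable G) (hXG : IndepFun (fun ω t => X t ω) G P)
    (hX0 : ∀ t j, ∫ ω, X t ω j ∂P = 0) {γ B a φ : ℝ} (hγ : 1 ≤ γ) (hB : 0 < B) (ha : 0 < a)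
    (hψ : ∀ t j, psiNorm P γ (fun ω => X t ω j) ≤ ENNReal.ofReal B) :
    IsLocallyDependent P (fun i ω j => a * X i ω j) (fun ω j => φ * G ω j) (nbhdFinset E)
      (a * (2 * B)) := by
  have hm : ∀ t j, Measurable fun ω => X t ω j := fun t j => by fun_prop
  have habs : ∀ i ω j, |a * X i ω j| / (a * (2 * B)) = |X i ω j| / (2 * B) := fun i ω j => by
    rw [abs_mul, abs_of_pos ha, mul_div_mul_left _ _ ha.ne']
  refine ⟨by positivity, fun i => by fun_prop, by fun_prop, fun i => mem_nbhdFinset.2 (Or.inl rfl),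
    fun i j => ?_, fun i j => ?_, fun i j => ?_, fun i => ?_, fun i l hl => ?_⟩
  · simp only [habs]
    exact integrable_exp_of_psiNorm_le hγ hB (hm i j) (hψ i j)
  · simp only [habs]
    exact integral_exp_le_of_psiNorm_le hγ hB (hm i j) (hψ i j)
  · rw [integral_const_mul, hX0, mul_zero]
  · have h := hE.indepFun_comp hX hG hXG (A := {i}) (B := ((nbhdFinset E i)ᶜ : Finset (Fin n)))
      (by
        rw [Set.disjoint_singleton_left]
        simp [mem_nbhdFinset])
      (by
        rintro _ rfl b hb
        simp only [Finset.coe_compl, Set.mem_compl_iff, Finset.mem_coe, mem_nbhdFinset,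
          not_or] at hb
        exact hb.2)
      (f := fun x => fun j => a * x ⟨i, rfl⟩ j)
      (h := fun x => (∑ r ∈ ((nbhdFinset E i)ᶜ).attach, fun j => a * x.1 ⟨r, r.2⟩ j,
        fun j => φ * x.2 j)) (by fun_prop) (by fun_prop)
    convert h using 3
    exact (Finset.sum_attach _ fun r => fun j => a * X r _ j).symm
  · have h := hE.indepFun_comp hX hG hXG (A := {i, l})
      (B := ((nbhdFinset E i ∪ nbhdFinset E l)ᶜ : Finset (Fin n)))
      (by
        rw [Set.disjoint_left]
        rintro t (rfl | rfl) ht <;> simp [mem_nbhdFinset] at ht)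
      (by
        rintro t ht b hb
        simp only [Finset.coe_compl, Finset.coe_union, Set.mem_compl_iff, Set.mem_union,
          Finset.mem_coe, mem_nbhdFinset, not_or] at hb
        rcases ht with rfl | rfl
        · exact hb.1.2
        · exact hb.2.2)
      (f := fun x => (fun j => a * x ⟨i, Or.inl rfl⟩ j, fun j => a * x ⟨l, Or.inr rfl⟩ j))
      (h := fun x => (∑ r ∈ ((nbhdFinset E i ∪ nbhdFinset E l)ᶜ).attach,
        fun j => a * x.1 ⟨r, r.2⟩ j, fun j => φ * x.2 j)) (by fun_prop) (by fun_prop)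
    convert h using 3
    exact (Finset.sum_attach _ fun r => fun j => a * X r _ j).symm

lemma memLp_two_of_psiNorm_le (hX : ∀ t, Measurable (X t)) {γ B : ℝ} (hγ : 1 ≤ γ) (hB : 0 < B)
    (hψ : ∀ t j, psiNorm P γ (fun ω => X t ω j) ≤ ENNReal.ofReal B) (t : Fin n) (j : Fin p) :
    MemLp (fun ω => X t ω j) 2 P := by
  have hm : Measurable fun ω => X t ω j := by fun_prop
  refine (memLp_two_iff_integrable_sq hm.aestronglyMeasurable).2 ?_
  refine ((integrable_exp_of_psiNorm_le hγ hB hm (hψ t j)).const_mul (8 * B ^ 2)).mono'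
    (by fun_prop) (Filter.Eventually.of_forall fun ω => ?_)
  rw [Real.norm_eq_abs, abs_of_nonneg (sq_nonneg _)]
  have h1 := Real.pow_div_factorial_le_exp (|X t ω j| / (2 * B)) (by positivity) 2
  have h2 : (|X t ω j| / (2 * B)) ^ 2 / (Nat.factorial 2 : ℝ) * (8 * B ^ 2) = X t ω j ^ 2 := by
    norm_num [Nat.factorial]
    field_simp
    rw [sq_abs]
    ring
  rw [← h2, mul_comm]
  gcongr

end LocalDependence

section Stein

variable {Ω : Type*} [MeasurableSpace Ω] {P : Measure Ω} [IsProbabilityMeasure P]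
  {n p : ℕ} [NeZero p] {X : Fin n → Ω → EuclideanSpace ℝ (Fin p)}
  {G : Ω → EuclideanSpace ℝ (Fin p)}

lemma SmoothStep.hasDerivAt_grad (g : SmoothStep) {L : ℝ} (hL : L ≠ 0) (z w : Fin p → ℝ) (j : Fin p)
    (t : ℝ) :
    HasDerivAt (fun t : ℝ => g.grad L (z + t • w) j) (∑ k, w k * g.hess L (z + t • w) j k) t := by
  have h := g.hasDerivAt_D1 hL z w (Pi.single j 1) t
  have e : ∀ z, g.D1 L z (Pi.single j 1) = g.grad L z j := fun z => by
    rw [g.D1_eq_sum]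
    simp [Pi.single_apply]
  simp only [e] at h
  refine h.congr_deriv ?_
  rw [g.D2_eq_sum]
  simp [Pi.single_apply]

lemma integral_coord_mul_grad_partialPoint {S : Matrix (Fin p) (Fin p) ℝ} (hS : S.PosSemidef)
    (hX : ∀ t, Measurable (X t)) (hGm : Measurable G) (hG : HasLaw G (multivariateGaussian 0 S) P)
    (hXG : IndepFun (fun ω t => X t ω) G P) (hSp : ∀ j, 0 < S j j) (g : SmoothStep) {L : ℝ}
    (hL : 1 ≤ L) (a φ : ℝ) (u : Fin p → ℝ) (s c : ℝ) (j : Fin p) :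
    ∫ ω, (φ * G ω j) * g.grad L
        (partialPoint (fun i ω j => a * X i ω j) (fun ω j => φ * G ω j) s c u ∅ ω) j ∂P
      = c * ∑ k, (φ ^ 2 * S j k) * ∫ ω, g.hess L
        (partialPoint (fun i ω j => a * X i ω j) (fun ω j => φ * G ω j) s c u ∅ ω) j k ∂P := by
  have hpt : ∀ ω, partialPoint (fun i ω j => a * X i ω j) (fun ω j => φ * G ω j) s c u ∅ ω
      = fun k => s * ∑ r, a * X r ω k + (c * (φ * G ω k) - u k) := fun ω => by
    ext k
    rw [partialPoint_empty_apply]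
  have hzm : Measurable fun q : (Fin n → EuclideanSpace ℝ (Fin p)) × (Fin p → ℝ) =>
      fun k => s * ∑ r, a * q.1 r k + (c * q.2 k - u k) := by fun_prop
  have h := integral_coord_mul_of_indepFun hS hGm hG (fun _ => φ)
    (Y := fun ω t => X t ω) (by fun_prop) hXG (hSp j)
    (f := fun y z => g.grad L (fun k => s * ∑ r, a * y r k + (c * z k - u k)) j)
    (f' := fun k y z => c * g.hess L (fun k => s * ∑ r, a * y r k + (c * z k - u k)) j k)
    (K := g.K + |c| * (2 * g.K * L))
    ((g.continuous_grad L j).measurable.comp hzm)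
    (fun k => ((g.continuous_hess L j k).measurable.comp hzm).const_mul c)
    (fun y z => (g.abs_grad_le L _ j).trans (by
      have := g.one_le_K
      have : 0 ≤ |c| * (2 * g.K * L) := by positivity
      linarith))
    (fun k y z => by
      have := g.one_le_K
      rw [abs_mul]
      have := mul_le_mul_of_nonneg_left (g.abs_hess_le hL
        (fun k => s * ∑ r, a * y r k + (c * z k - u k)) j k) (abs_nonneg c)
      linarith)
    (fun y z w t => by
      have h1 := g.hasDerivAt_grad (by linarith) (fun k => s * ∑ r, a * y r k + (c * z k - u k))
        (c • w) j t (L := L)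
      have e : ∀ t : ℝ, (fun k => s * ∑ r, a * y r k + (c * z k - u k)) + t • (c • w)
          = fun k => s * ∑ r, a * y r k + (c * (z + t • w) k - u k) := fun t => by
        ext k
        simp only [Pi.add_apply, Pi.smul_apply, smul_eq_mul]
        ring
      simp only [e] at h1
      refine h1.congr_deriv (Finset.sum_congr rfl fun k _ => ?_)
      simp only [Pi.smul_apply, smul_eq_mul]
      ring)
  simp only [hpt]
  rw [h, Finset.mul_sum]
  refine Finset.sum_congr rfl fun k _ => ?_
  rw [integral_const_mul]
  ring

end Stein

section ApproxError

variable {Ω : Type*} [MeasurableSpace Ω] {P : Measure Ω} [IsProbabilityMeasure P]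
  {n p : ℕ} {X : Fin n → Ω → EuclideanSpace ℝ (Fin p)} {G : Ω → EuclideanSpace ℝ (Fin p)}
  {E : SimpleGraph (Fin n)}

lemma abs_measureReal_sub_le_one (s t : Set Ω) : |P.real s - P.real t| ≤ 1 := by
  rw [abs_le]
  constructor <;> linarith [measureReal_nonneg (μ := P) (s := s), measureReal_le_one (μ := P) (s := s),
    measureReal_nonneg (μ := P) (s := t), measureReal_le_one (μ := P) (s := t)]

omit [IsProbabilityMeasure P] in
lemma gaussApproxError_nonneg : 0 ≤ gaussApproxError P X G :=
  Real.iSup_nonneg fun _ => abs_nonneg _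

lemma gaussApproxError_le_one : gaussApproxError P X G ≤ 1 :=
  Real.iSup_le (fun _ => abs_measureReal_sub_le_one _ _) zero_le_one

lemma abs_sub_le_gaussApproxError {θ : ℝ} (hθ : θ ∈ Set.Icc 0 (Real.pi / 2)) (u : Fin p → ℝ) :
    |P.real {ω | ∀ j, Real.sin θ * normSum X ω j + Real.cos θ * G ω j ≤ u j}
      - P.real {ω | ∀ j, G ω j ≤ u j}| ≤ gaussApproxError P X G := by
  have hs : 0 ≤ Real.sin θ := Real.sin_nonneg_of_nonneg_of_le_pi hθ.1 (by linarith [hθ.2, Real.pi_pos])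
  have hc : 0 ≤ Real.cos θ := Real.cos_nonneg_of_neg_pi_div_two_le_of_le
    (by linarith [hθ.1, Real.pi_pos]) hθ.2
  have hbdd : BddAbove (Set.range fun q : EuclideanSpace ℝ (Fin p) × Set.Icc (0 : ℝ) 1 =>
      |P.real {ω | ∀ j, Real.sqrt q.2 * normSum X ω j + Real.sqrt (1 - q.2) * G ω j ≤ q.1 j} -
        P.real {ω | ∀ j, G ω j ≤ q.1 j}|) := by
    refine ⟨1, ?_⟩
    rintro _ ⟨q, rfl⟩
    exact abs_measureReal_sub_le_one _ _
  have h := le_ciSup hbdd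
    (WithLp.toLp 2 u, ⟨Real.sin θ ^ 2, sq_nonneg _, Real.sin_sq_le_one θ⟩)
  have h1 : Real.sqrt (1 - Real.sin θ ^ 2) = Real.cos θ := by
    rw [← Real.cos_sq', Real.sqrt_sq hc]
  simp only [h1, Real.sqrt_sq hs] at h
  exact h

omit [IsProbabilityMeasure P] in
lemma gaussApproxError_le {x : ℝ}
    (h : ∀ θ ∈ Set.Icc 0 (Real.pi / 2), ∀ u : Fin p → ℝ,
      |P.real {ω | ∀ j, Real.sin θ * normSum X ω j + Real.cos θ * G ω j ≤ u j}
        - P.real {ω | ∀ j, G ω j ≤ u j}| ≤ x) :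
    gaussApproxError P X G ≤ x := by
  have : Nonempty (EuclideanSpace ℝ (Fin p) × Set.Icc (0 : ℝ) 1) := ⟨(0, ⟨0, by simp⟩)⟩
  refine ciSup_le fun q => ?_
  have hν := q.2.2
  have h1 : Real.sqrt q.2 ≤ 1 := Real.sqrt_le_one.2 hν.2
  have h0 := Real.sqrt_nonneg (q.2 : ℝ)
  have h2 := h (Real.arcsin (Real.sqrt q.2))
    ⟨Real.arcsin_nonneg.2 h0, Real.arcsin_le_pi_div_two _⟩ (fun j => q.1 j)
  rwa [Real.sin_arcsin (by linarith) h1, Real.cos_arcsin, Real.sq_sqrt hν.1] at h2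

omit [IsProbabilityMeasure P] in
lemma gaussApproxError_congr {G' : Ω → EuclideanSpace ℝ (Fin p)} (h : G =ᵐ[P] G') :
    gaussApproxError P X G = gaussApproxError P X G' := by
  unfold gaussApproxError
  congr 1
  ext q
  congr 2 <;> refine measureReal_congr (Filter.eventuallyEq_set.2 (h.mono fun ω hω => ?_)) <;>
    simp only [Set.mem_ofPred_eq, hω]

end ApproxError

section Smoothing

variable {Ω ι : Type*} [MeasurableSpace Ω] [Fintype ι] [Nonempty ι] {P : Measure Ω}
  [IsProbabilityMeasure P]

lemma SmoothStep.integrable_comp_smoothMax (g : SmoothStep) (L : ℝ) {Z : Ω → ι → ℝ}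
    (hZ : Measurable Z) : Integrable (fun ω => g.g0 (smoothMax L (Z ω))) P :=
  Integrable.of_bound (C := 1)
    ((g.continuous_g0.comp (continuous_smoothMax L)).measurable.comp hZ).aestronglyMeasurable
    (Filter.Eventually.of_forall fun ω => by
      rw [Real.norm_eq_abs, abs_of_nonneg (g.g0_nonneg _)]
      exact g.g0_le_one _)

omit [Nonempty ι] in
lemma measurableSet_forall_le {Z : Ω → ι → ℝ} (hZ : Measurable Z) (u : ι → ℝ) :
    MeasurableSet {ω | ∀ j, Z ω j ≤ u j} := by
  rw [Set.ofPred_forall]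
  exact MeasurableSet.iInter fun j =>
    measurableSet_le ((measurable_pi_apply j).comp hZ) measurable_const

lemma SmoothStep.measureReal_le_integral (g : SmoothStep) {L : ℝ} (hL : 0 < L)
    (hcard : Real.log (Fintype.card ι) / L ≤ 1 / 2) {Z : Ω → ι → ℝ} (hZ : Measurable Z) :
    P.real {ω | ∀ j, Z ω j ≤ -1} ≤ ∫ ω, g.g0 (smoothMax L (Z ω)) ∂P := by
  rw [← integral_indicator_one (measurableSet_forall_le hZ fun _ => -1)]
  refine integral_mono ((integrable_const 1).indicator (measurableSet_forall_le hZ fun _ => -1))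
    (g.integrable_comp_smoothMax L hZ) fun ω => ?_
  by_cases h : ω ∈ {ω | ∀ j, Z ω j ≤ -1}
  · rw [Set.indicator_of_mem h, g.g0_eq_one _ ((smoothMax_le hL _ h).trans (by linarith))]
    rfl
  · rw [Set.indicator_of_notMem h]
    exact g.g0_nonneg _

lemma SmoothStep.integral_le_measureReal (g : SmoothStep) {L : ℝ} (hL : 0 < L) {Z : Ω → ι → ℝ}
    (hZ : Measurable Z) :
    ∫ ω, g.g0 (smoothMax L (Z ω)) ∂P ≤ P.real {ω | ∀ j, Z ω j ≤ 1} := by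
  rw [← integral_indicator_one (measurableSet_forall_le hZ fun _ => 1)]
  refine integral_mono (g.integrable_comp_smoothMax L hZ)
    ((integrable_const 1).indicator (measurableSet_forall_le hZ fun _ => 1)) fun ω => ?_
  by_cases h : ω ∈ {ω | ∀ j, Z ω j ≤ 1}
  · rw [Set.indicator_of_mem h]
    exact g.g0_le_one _
  · rw [Set.indicator_of_notMem h]
    obtain ⟨j, hj⟩ : ∃ j, 1 < Z ω j := by simpa using h
    exact (g.g0_eq_zero _ (hj.le.trans (le_smoothMax hL _ j))).le

end Smoothing

section Comparison

variable {Ω : Type*} [MeasurableSpace Ω] {P : Measure Ω} [IsProbabilityMeasure P]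
  {n p : ℕ} {X : Fin n → Ω → EuclideanSpace ℝ (Fin p)} {G : Ω → EuclideanSpace ℝ (Fin p)}
  {E : SimpleGraph (Fin n)}

lemma partialPoint_empty_apply_normSum {Ω : Type*} {X : Fin n → Ω → EuclideanSpace ℝ (Fin p)}
    {G : Ω → EuclideanSpace ℝ (Fin p)} (a φ s c : ℝ) (ha : a = φ / Real.sqrt n) (u : Fin p → ℝ)
    (ω : Ω) (j : Fin p) :
    partialPoint (fun i ω j => a * X i ω j) (fun ω j => φ * G ω j) s c u ∅ ω j
      = φ * (s * normSum X ω j + c * G ω j) - u j := by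
  rw [partialPoint_empty_apply, ← Finset.mul_sum, normSum_apply, ha]
  ring

lemma measureReal_maxNear_le {φ α : ℝ} (hφ : 0 < φ)
    (hX : ∀ t, Measurable (X t)) (hGm : Measurable G)
    (hα : ∀ u : Fin p → ℝ, ∀ k : ℝ, 0 < k →
      P.real {ω | ∀ j, G ω j ≤ u j + k / φ} - P.real {ω | ∀ j, G ω j ≤ u j} ≤ k * α)
    {θ : ℝ} (hθ : θ ∈ Set.Icc 0 (Real.pi / 2)) (u : Fin p → ℝ) :
    P.real {ω | MaxNear 3 fun j =>
        φ * (Real.sin θ * normSum X ω j + Real.cos θ * G ω j) - u j}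
      ≤ 2 * gaussApproxError P X G + 7 * α := by
  set V : Ω → Fin p → ℝ := fun ω j => Real.sin θ * normSum X ω j + Real.cos θ * G ω j with hV
  have hVm : Measurable V := by
    simp only [hV, normSum_apply]
    fun_prop
  set w : Fin p → ℝ := fun j => (u j - 4) / φ with hw
  have hw7 : ∀ j, w j + 7 / φ = (u j + 3) / φ := fun j => by
    simp only [hw]
    ring
  have h1 := (abs_le.1 (abs_sub_le_gaussApproxError (P := P) (X := X) (G := G) hθ
    fun j => w j + 7 / φ)).2
  have h2 := (abs_le.1 (abs_sub_le_gaussApproxError (P := P) (X := X) (G := G) hθ w)).1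
  have h3 := hα w 7 (by norm_num)
  have hsub : {ω | ∀ j, V ω j ≤ w j} ⊆ {ω | ∀ j, V ω j ≤ w j + 7 / φ} := fun ω h j =>
    (h j).trans (by linarith [show 0 < 7 / φ by positivity])
  have h4 : P.real {ω | MaxNear 3 fun j => φ * V ω j - u j}
      ≤ P.real ({ω | ∀ j, V ω j ≤ w j + 7 / φ} \ {ω | ∀ j, V ω j ≤ w j}) := by
    refine measureReal_mono ?_
    rintro ω ⟨hle, k, hk⟩
    refine ⟨fun j => ?_, fun h => ?_⟩
    · rw [hw7, le_div_iff₀ hφ]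
      linarith [hle j]
    · have h5 : V ω k * φ ≤ u k - 4 := (le_div_iff₀ hφ).1 (h k)
      linarith
  rw [measureReal_sdiff hsub (measurableSet_forall_le hVm w)] at h4
  linarith

/-- Gaussian comparison at a fixed smoothing level `1 / φ`, with the self-referential remainder
already absorbed. -/
theorem IsDependencyGraph.gaussApproxError_le_of_level (g : SmoothStep)
    (hE : IsDependencyGraph P X E) (hX : ∀ t, Measurable (X t)) (hGm : Measurable G)
    (hXG : IndepFun (fun ω t => X t ω) G P) (hX0 : ∀ t j, ∫ ω, X t ω j ∂P = 0) {γ B K₃ : ℝ}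
    (hn : 0 < n) (hp : 2 ≤ p) (hγ : 1 ≤ γ) (hB : 0 < B) (hK₃ : 0 < K₃)
    (hψ : ∀ t j, psiNorm P γ (fun ω => X t ω j) ≤ ENNReal.ofReal B)
    (hvar : ∀ j, K₃ ≤ longRunVar P X j)
    (hG : HasLaw G (multivariateGaussian 0 (longRunCov P X)) P)
    {φ η τ : ℝ} (hφ : 0 < φ) (hη : 0 ≤ η)
    (hQ : 2 * ((n : ℝ) * (3072000 * g.K * (2 * Real.log p) ^ 2 * (maxDegOne E : ℝ) ^ 2 *
      (φ / Real.sqrt n * (2 * B)) ^ 3)) ≤ 1 / 4)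
    (hDη : 3 * (maxDegOne E : ℝ) * η ≤ (2 * Real.log p)⁻¹)
    (hτ : (n : ℝ) * (p : ℝ) ^ 2 * Real.exp (-(η / (2 * (φ / Real.sqrt n * (2 * B))))) ≤ τ) :
    gaussApproxError P X G
      ≤ 8 * (36 * Real.sqrt (2 * Real.log p) / (φ * Real.sqrt K₃)) + τ := by
  have : NeZero p := ⟨by omega⟩
  set L := 2 * Real.log p with hLdef
  set a := φ / Real.sqrt n with hadef
  set α := 36 * Real.sqrt L / (φ * Real.sqrt K₃) with hαdef
  set ϱ := gaussApproxError P X G with hϱ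
  set Q := (n : ℝ) * (3072000 * g.K * L ^ 2 * (maxDegOne E : ℝ) ^ 2 * (a * (2 * B)) ^ 3) with hQdef
  have hn' : (0 : ℝ) < n := Nat.cast_pos.2 hn
  have ha : 0 < a := div_pos hφ (Real.sqrt_pos.2 hn')
  have hL : 1 ≤ L := one_le_two_mul_log hp
  have hL0 : 0 < L := by linarith
  have hcard : Real.log (Fintype.card (Fin p)) / L ≤ 1 / 2 := by
    rw [Fintype.card_fin]
    exact log_div_two_mul_log_le hp
  have hα0 : 0 ≤ α := by positivity
  have hϱ0 : 0 ≤ ϱ := gaussApproxError_nonneg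
  have hτ0 : 0 ≤ τ := le_trans (by positivity) hτ
  have hK := g.one_le_K
  have hQ0 : 0 ≤ Q := by positivity
  have hX2 := memLp_two_of_psiNorm_le hX hγ hB hψ
  have hS := longRunCov_posSemidef hX2
  have hSv : ∀ j, K₃ ≤ longRunCov P X j j := fun j => by
    rw [longRunCov_self X hX]
    exact hvar j
  have hα : ∀ u : Fin p → ℝ, ∀ k : ℝ, 0 < k →
      P.real {ω | ∀ j, G ω j ≤ u j + k / φ} - P.real {ω | ∀ j, G ω j ≤ u j} ≤ k * α := by
    intro u k hk
    refine (gaussian_orthant_antiConcentration (by simpa using hp) hS hGm hG hK₃ hSv u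
      (ε := k / φ) (by positivity)).trans_eq ?_
    rw [Fintype.card_fin, ← hLdef, hαdef]
    field_simp
  have h := hE.isLocallyDependent hX hGm hXG hX0 (φ := φ) hγ hB ha hψ
  have hYint : ∀ j, Integrable (fun ω => φ * G ω j) P := fun j =>
    (((hasGaussianLaw_eval hG).eval j).integrable).const_mul _
  set Z : ℝ → ℝ → (Fin p → ℝ) → Ω → Fin p → ℝ := fun s c u =>
    partialPoint (fun i ω j => a * X i ω j) (fun ω j => φ * G ω j) s c u ∅ with hZ
  have hZm : ∀ s c u, Measurable (Z s c u) := fun s c u => h.measurable_partialPoint s c u ∅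
  have hZa : ∀ s c u ω j, Z s c u ω j = φ * (s * normSum X ω j + c * G ω j) - u j :=
    fun s c u ω j => partialPoint_empty_apply_normSum a φ s c hadef u ω j
  have hcov : ∀ j k, φ ^ 2 * longRunCov P X j k
      = ∑ i, ∑ l ∈ nbhdFinset E i, ∫ ω, (a * X i ω j) * (a * X l ω k) ∂P := by
    intro j k
    have e : ∀ i l, ∫ ω, (a * X i ω j) * (a * X l ω k) ∂P
        = a ^ 2 * ∫ ω, X i ω j * X l ω k ∂P := fun i l => by
      rw [← integral_const_mul]
      congr 1
      ext ω
      ring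
    simp only [e, ← Finset.mul_sum]
    rw [hE.longRunCov_eq hX2 hX0, ← mul_assoc]
    congr 1
    rw [hadef, div_pow, Real.sq_sqrt hn'.le]
    rfl
  have hstein : ∀ u s c j, ∫ ω, (φ * G ω j) * g.grad L (Z s c u ω) j ∂P
      = c * ∑ k, (∑ i, ∑ l ∈ nbhdFinset E i, ∫ ω, (a * X i ω j) * (a * X l ω k) ∂P) *
        ∫ ω, g.hess L (Z s c u ω) j k ∂P := by
    intro u s c j
    simp only [← hcov]
    exact integral_coord_mul_grad_partialPoint hS hX hGm hG hXG
      (fun j => hK₃.trans_le (hSv j)) g hL a φ u s c j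
  have herr : ∀ θ ∈ Set.Icc 0 (Real.pi / 2), ∀ u : Fin p → ℝ,
      |∫ ω, g.g0 (smoothMax L (Z (Real.sin θ) (Real.cos θ) u ω)) ∂P
        - ∫ ω, g.g0 (smoothMax L (Z 0 1 u ω)) ∂P| ≤ 2 * Q * (2 * ϱ + 7 * α + τ) := by
    intro θ hθ u
    have h1 := h.abs_integral_interpolation_sub_le g hL hcard u hη
      (card_nbhdFinset_le E) hDη (τ := τ) (by simpa using hτ) hYint (hstein u) hθ.1
      (ρ := 2 * ϱ + 7 * α) (fun t ht => by
        have h2 := measureReal_maxNear_le hφ hX hGm hα (θ := t) ⟨ht.1, ht.2.trans hθ.2⟩ u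
        refine le_of_eq_of_le ?_ h2
        congr 1
        ext ω
        have e : Z (Real.sin t) (Real.cos t) u ω
            = fun j => φ * (Real.sin t * normSum X ω j + Real.cos t * G ω j) - u j :=
          funext fun j => hZa _ _ _ _ _
        exact iff_of_eq (congrArg (MaxNear 3) e))
    refine h1.trans ?_
    rw [Fintype.card_fin]
    have h3 : θ ≤ 2 := hθ.2.trans (by linarith [Real.pi_le_four])
    calc _ = Q * (2 * ϱ + 7 * α + τ) * θ := by rw [hQdef]; ring
      _ ≤ Q * (2 * ϱ + 7 * α + τ) * 2 := by gcongr
      _ = _ := by ring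
  have hfin : ϱ ≤ 2 * Q * (2 * ϱ + 7 * α + τ) + 2 * α := by
    refine gaussApproxError_le fun θ hθ u => ?_
    rw [abs_le]
    constructor
    · have h1 := (abs_le.1 (herr θ hθ fun j => φ * u j - 1)).1
      have h2 := g.integral_le_measureReal (P := P) hL0
        (hZm (Real.sin θ) (Real.cos θ) fun j => φ * u j - 1)
      have h3 := g.measureReal_le_integral (P := P) hL0 hcard (hZm 0 1 fun j => φ * u j - 1)
      have h4 := hα (fun j => u j - 2 / φ) 2 (by norm_num)
      have e3 : {ω | ∀ j, Z (Real.sin θ) (Real.cos θ) (fun j => φ * u j - 1) ω j ≤ 1}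
          = {ω | ∀ j, Real.sin θ * normSum X ω j + Real.cos θ * G ω j ≤ u j} := by
        ext ω
        refine forall_congr' fun j => ?_
        rw [hZa, ← mul_le_mul_iff_right₀ hφ (b := Real.sin θ * normSum X ω j + Real.cos θ * G ω j)]
        constructor <;> intro h <;> linarith
      have e4 : {ω | ∀ j, Z 0 1 (fun j => φ * u j - 1) ω j ≤ -1}
          = {ω | ∀ j, G ω j ≤ u j - 2 / φ} := by
        ext ω
        refine forall_congr' fun j => ?_
        rw [hZa, ← mul_le_mul_iff_right₀ hφ (b := G ω j), mul_sub φ (u j), mul_div_cancel₀ _ hφ.ne']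
        constructor <;> intro h <;> linarith
      rw [e3] at h2
      rw [e4] at h3
      simp only [sub_add_cancel] at h4
      linarith
    · have h1 := (abs_le.1 (herr θ hθ fun j => φ * u j + 1)).2
      have h2 := g.measureReal_le_integral (P := P) hL0 hcard
        (hZm (Real.sin θ) (Real.cos θ) fun j => φ * u j + 1)
      have h3 := g.integral_le_measureReal (P := P) hL0 (hZm 0 1 fun j => φ * u j + 1)
      have h4 := hα u 2 (by norm_num)
      have e3 : {ω | ∀ j, Z (Real.sin θ) (Real.cos θ) (fun j => φ * u j + 1) ω j ≤ -1}
          = {ω | ∀ j, Real.sin θ * normSum X ω j + Real.cos θ * G ω j ≤ u j} := by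
        ext ω
        refine forall_congr' fun j => ?_
        rw [hZa, ← mul_le_mul_iff_right₀ hφ (b := Real.sin θ * normSum X ω j + Real.cos θ * G ω j)]
        constructor <;> intro h <;> linarith
      have e4 : {ω | ∀ j, Z 0 1 (fun j => φ * u j + 1) ω j ≤ 1}
          = {ω | ∀ j, G ω j ≤ u j + 2 / φ} := by
        ext ω
        refine forall_congr' fun j => ?_
        rw [hZa, ← mul_le_mul_iff_right₀ hφ (b := G ω j), mul_add φ (u j), mul_div_cancel₀ _ hφ.ne']
        constructor <;> intro h <;> linarith
      rw [e3] at h2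
      rw [e4] at h3
      linarith
  have : 2 * Q * (2 * ϱ + 7 * α + τ) ≤ 1 / 4 * (2 * ϱ + 7 * α + τ) := by gcongr
  linarith

end Comparison

section Rate

lemma mul_sq_mul_exp_le_inv {κ n p e : ℝ} (hκ : 0 < κ) (hn : 1 ≤ n) (hp : 1 < p)
    (hnp : n ^ κ ≤ p) (he : (2 + 2 / κ) * Real.log p ≤ e) :
    n * p ^ 2 * Real.exp (-e) ≤ n⁻¹ := by
  have hn0 : 0 < n := by linarith
  have h1 : κ * Real.log n ≤ Real.log p := by
    rw [← Real.log_rpow hn0]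
    exact Real.log_le_log (Real.rpow_pos_of_pos hn0 _) hnp
  have h2 : 2 * Real.log n ≤ 2 / κ * Real.log p := by
    rw [div_mul_eq_mul_div, le_div_iff₀ hκ]
    linarith
  calc n * p ^ 2 * Real.exp (-e) = Real.exp (Real.log n + 2 * Real.log p - e) := by
        rw [sub_eq_add_neg, Real.exp_add, Real.exp_add, Real.exp_log hn0,
          two_mul, Real.exp_add, Real.exp_log (by linarith)]
        ring
    _ ≤ Real.exp (-Real.log n) := Real.exp_le_exp.2 (by linarith)
    _ = n⁻¹ := by rw [Real.exp_neg, Real.exp_log hn0]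

lemma le_of_rate_le {A δ N x w : ℝ} (hA : 0 < A) (hδ : δ = 1 / (2 * A + 1)) (hx : 1 ≤ x)
    (hw : 0 < w) (hw6 : 1 / 2 ≤ w ^ 6) (h : x ^ 2 * w ^ 7 ≤ δ * N ^ 2) :
    A * (x * w ^ 8) ≤ N ^ 4 := by
  have h1 : (2 * A + 1) * (x ^ 2 * w ^ 7) ≤ N ^ 2 := by
    rw [hδ, div_mul_eq_mul_div, one_mul, le_div_iff₀ (by positivity)] at h
    linarith
  have h2 : ((2 * A + 1) * (x ^ 2 * w ^ 7)) ^ 2 ≤ (N ^ 2) ^ 2 := by gcongr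
  have h3 : 1 / 2 ≤ x ^ 3 * w ^ 6 := by
    have := one_le_pow₀ hx (n := 3)
    nlinarith
  have h4 : A ≤ (2 * A + 1) ^ 2 * (x ^ 3 * w ^ 6) := by
    have : (2 * A + 1) ^ 2 * (1 / 2) ≤ (2 * A + 1) ^ 2 * (x ^ 3 * w ^ 6) := by gcongr
    nlinarith
  calc A * (x * w ^ 8) ≤ (2 * A + 1) ^ 2 * (x ^ 3 * w ^ 6) * (x * w ^ 8) := by gcongr
    _ = ((2 * A + 1) * (x ^ 2 * w ^ 7)) ^ 2 := by ring
    _ ≤ (N ^ 2) ^ 2 := h2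
    _ = N ^ 4 := by ring

variable {Ω : Type*} [MeasurableSpace Ω] {P : Measure Ω} [IsProbabilityMeasure P]
  {n p : ℕ} {X : Fin n → Ω → EuclideanSpace ℝ (Fin p)} {G : Ω → EuclideanSpace ℝ (Fin p)}
  {E : SimpleGraph (Fin n)}

/-- The Gaussian approximation bound for `G` measurable, with roots substituted by
`n = N ^ 12`, `log p = w ^ 6` and `D * D' = x ^ 6`. -/
lemma IsDependencyGraph.gaussApproxError_le_of_roots (g : SmoothStep)
    (hE : IsDependencyGraph P X E) (hX : ∀ t, Measurable (X t)) (hGm : Measurable G)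
    (hXG : IndepFun (fun ω t => X t ω) G P) (hX0 : ∀ t j, ∫ ω, X t ω j ∂P = 0)
    {κ γ B K₃ : ℝ} (hκ : 0 < κ) (hn : 0 < n) (hp : 2 ≤ p) (hnp : (n : ℝ) ^ κ ≤ p) (hγ : 1 ≤ γ)
    (hB : 1 ≤ B) (hK₃ : 0 < K₃)
    (hψ : ∀ t j, psiNorm P γ (fun ω => X t ω j) ≤ ENNReal.ofReal B)
    (hvar : ∀ j, K₃ ≤ longRunVar P X j)
    (hG : HasLaw G (multivariateGaussian 0 (longRunCov P X)) P)
    {N x w c A δ : ℝ} (hN : 1 ≤ N) (hx : 1 ≤ x) (hw : 0 < w) (hNn : N ^ 12 = n)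
    (hwp : w ^ 6 = Real.log p) (hxD : (maxDegOne E : ℝ) ^ 2 ≤ x ^ 6)
    (hc : c = 1 / (4 * (196608000 * g.K))) (hA : A = 24 * c * (2 + 2 / κ))
    (hδ : δ = 1 / (2 * A + 1)) :
    gaussApproxError P X G
      ≤ (288 * Real.sqrt 2 / (c * Real.sqrt K₃) + 4 + 1 / δ) * (B * x ^ 2 * w ^ 7 / N ^ 2) := by
  have hK := g.one_le_K
  have hc0 : 0 < c := by rw [hc]; positivity
  have hA0 : 0 < A := by rw [hA]; positivity
  have hδ0 : 0 < δ := by rw [hδ]; positivity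
  have hN0 : 0 < N := by linarith
  have hx0 : 0 < x := by linarith
  have hB0 : 0 < B := by linarith
  have hsK : 0 < Real.sqrt K₃ := Real.sqrt_pos.2 hK₃
  have hw6 : 1 / 2 ≤ w ^ 6 := by
    rw [hwp]
    linarith [one_le_two_mul_log hp]
  set r := B * x ^ 2 * w ^ 7 / N ^ 2 with hr
  have hr0 : 0 < r := by positivity
  rcases le_or_gt δ r with hδr | hδr
  · calc gaussApproxError P X G ≤ 1 := gaussApproxError_le_one
      _ ≤ 1 / δ * r := by rw [div_mul_eq_mul_div, one_mul, one_le_div hδ0]; exact hδr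
      _ ≤ _ := by
        gcongr
        have : 0 ≤ 288 * Real.sqrt 2 / (c * Real.sqrt K₃) := by positivity
        linarith
  · have hNz : NeZero n := ⟨hn.ne'⟩
    have hD1 : (1 : ℝ) ≤ maxDegOne E := by exact_mod_cast one_le_maxDegOne E
    set D : ℝ := (maxDegOne E : ℝ) with hD
    have hD0 : 0 < D := by linarith
    have hDx : D ≤ x ^ 3 := by
      refine le_of_sq_le_sq ?_ (by positivity)
      calc D ^ 2 ≤ x ^ 6 := hxD
        _ = (x ^ 3) ^ 2 := by ring
    have hsn : Real.sqrt n = N ^ 6 := by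
      rw [← hNn, show N ^ 12 = (N ^ 6) ^ 2 by ring, Real.sqrt_sq (by positivity)]
    have hrate : x ^ 2 * w ^ 7 ≤ δ * N ^ 2 := by
      rw [hr, div_lt_iff₀ (by positivity)] at hδr
      refine le_trans ?_ hδr.le
      rw [mul_assoc]
      exact le_mul_of_one_le_left (by positivity) hB
    have hkey := le_of_rate_le hA0 hδ hx hw hw6 hrate
    set φ := c * N ^ 2 / (B * x ^ 2 * w ^ 4) with hφ
    have hφ0 : 0 < φ := by positivity
    have hb : φ / Real.sqrt n * (2 * B) = 2 * c / (N ^ 4 * x ^ 2 * w ^ 4) := by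
      rw [hφ, hsn]
      field_simp
    set η := 1 / (6 * D * w ^ 6) with hη
    have hη0 : 0 < η := by positivity
    have hmain := hE.gaussApproxError_le_of_level g hX hGm hXG hX0 hn hp hγ hB0 hK₃ hψ hvar hG
      (φ := φ) (η := η) (τ := (n : ℝ)⁻¹) hφ0 hη0.le
      (by
        rw [hb, ← hwp, ← hNn, ← hD]
        calc _ = 196608000 * g.K * c ^ 3 * (D ^ 2 / x ^ 6) := by
              field_simp
              norm_num
          _ ≤ 196608000 * g.K * c ^ 3 * 1 := by
              gcongr
              exact (div_le_one (by positivity)).2 hxD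
          _ = 1 / (64 * (196608000 * g.K) ^ 2) := by
              rw [hc]
              field_simp
              norm_num
          _ ≤ 1 / 4 := by
              apply one_div_le_one_div_of_le (by norm_num)
              nlinarith)
      (by
        rw [← hwp, ← hD, hη]
        apply le_of_eq
        field_simp
        norm_num)
      (by
        refine mul_sq_mul_exp_le_inv hκ (by exact_mod_cast hn) (by exact_mod_cast hp) hnp ?_
        rw [hb, ← hwp, hη]
        have e : 1 / (6 * D * w ^ 6) / (2 * (2 * c / (N ^ 4 * x ^ 2 * w ^ 4)))
            = N ^ 4 * x ^ 2 / (24 * c * D * w ^ 2) := by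
          field_simp
          norm_num
        rw [e, le_div_iff₀ (by positivity)]
        calc (2 + 2 / κ) * w ^ 6 * (24 * c * D * w ^ 2) = A * w ^ 8 * D := by rw [hA]; ring
          _ ≤ A * w ^ 8 * x ^ 3 := by gcongr
          _ = A * (x * w ^ 8) * x ^ 2 := by ring
          _ ≤ N ^ 4 * x ^ 2 := by gcongr)
    have h1 : 8 * (36 * Real.sqrt (2 * Real.log p) / (φ * Real.sqrt K₃))
        = 288 * Real.sqrt 2 / (c * Real.sqrt K₃) * r := by
      rw [← hwp, show 2 * w ^ 6 = 2 * (w ^ 3) ^ 2 by ring, Real.sqrt_mul (by norm_num),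
        Real.sqrt_sq (by positivity), hφ, hr]
      field_simp
      norm_num
    have h2 : (n : ℝ)⁻¹ ≤ 4 * r := by
      have hw1 : 1 / 2 ≤ w := by
        by_contra hlt
        push Not at hlt
        have : w ^ 6 < (1 / 2) ^ 6 := by gcongr
        norm_num at this hw6
        linarith
      have hw7 : 1 / 4 ≤ w ^ 7 := by
        calc (1 / 4 : ℝ) = 1 / 2 * (1 / 2) := by norm_num
          _ ≤ w ^ 6 * w := by gcongr
          _ = w ^ 7 := by ring
      have hxB : 1 ≤ B * x ^ 2 := one_le_mul_of_one_le_of_one_le hB (one_le_pow₀ hx)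
      rw [← hNn, hr]
      calc (N ^ 12)⁻¹ ≤ (N ^ 2)⁻¹ := by
            apply inv_anti₀ (by positivity)
            exact pow_le_pow_right₀ hN (by norm_num)
        _ = 4 * (1 * (1 / 4) / N ^ 2) := by ring
        _ ≤ 4 * (B * x ^ 2 * w ^ 7 / N ^ 2) := by gcongr
    rw [h1] at hmain
    have : 0 ≤ 1 / δ * r := by positivity
    calc gaussApproxError P X G ≤ _ := hmain
      _ ≤ 288 * Real.sqrt 2 / (c * Real.sqrt K₃) * r + 4 * r + 1 / δ * r := by linarith
      _ = _ := by ring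

end Rate

theorem theorem2 (κ γ₁ K₃ : ℝ) (hκ : 0 < κ) (hγ₁ : 1 ≤ γ₁) (hK₃ : 0 < K₃) :
    ∃ C : ℝ, 0 < C ∧
      ∀ (n p : ℕ), 0 < n → 2 ≤ p → (n : ℝ) ^ κ ≤ (p : ℝ) →
      ∀ (B : ℝ), 1 ≤ B →
      ∀ (Ω : Type*) [MeasurableSpace Ω] (P : Measure Ω) [IsProbabilityMeasure P]
        (X : Fin n → Ω → EuclideanSpace ℝ (Fin p)) (G : Ω → EuclideanSpace ℝ (Fin p))
        (E : SimpleGraph (Fin n)),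
        -- the random vectors are centred, with dependency graph `E`
        (∀ t, Measurable (X t)) →
        (∀ t j, ∫ ω, X t ω j ∂P = 0) →
        IsDependencyGraph P X E →
        -- sub-exponential moments
        (∀ t j, psiNorm P γ₁ (fun ω => X t ω j) ≤ ENNReal.ofReal B) →
        -- non-degenerate long-run variances
        (∀ j, K₃ ≤ longRunVar P X j) →
        -- `G` is Gaussian with the long-run covariance matrix, and independent of the sequence
        HasLaw G (multivariateGaussian 0 (longRunCov P X)) P →
        IndepFun (fun ω t => X t ω) G P →
        gaussApproxError P X G ≤
          C * (B * ((maxDegOne E : ℝ) * (maxDegTwo E : ℝ)) ^ (1 / 3 : ℝ) *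
            Real.log p ^ (7 / 6 : ℝ) / (n : ℝ) ^ (1 / 6 : ℝ)) := by
  obtain ⟨g⟩ := nonempty_smoothStep
  have hK := g.one_le_K
  obtain ⟨c, hc⟩ : ∃ c, c = 1 / (4 * (196608000 * g.K)) := ⟨_, rfl⟩
  obtain ⟨A, hA⟩ : ∃ A, A = 24 * c * (2 + 2 / κ) := ⟨_, rfl⟩
  obtain ⟨δ, hδ⟩ : ∃ δ, δ = 1 / (2 * A + 1) := ⟨_, rfl⟩
  have hc0 : 0 < c := by rw [hc]; positivity
  have hA0 : 0 < A := by rw [hA]; positivity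
  have hδ0 : 0 < δ := by rw [hδ]; positivity
  refine ⟨288 * Real.sqrt 2 / (c * Real.sqrt K₃) + 4 + 1 / δ, by positivity, ?_⟩
  intro n p hn hp hnp B hB Ω _ P _ X G E hX hX0 hE hψ hvar hG hXG
  have hGae : G =ᵐ[P] hG.aemeasurable.mk G := hG.aemeasurable.ae_eq_mk
  rw [gaussApproxError_congr hGae]
  have : NeZero n := ⟨hn.ne'⟩
  have hn1 : (1 : ℝ) ≤ n := by exact_mod_cast hn
  have hlog : 0 < Real.log p := by linarith [one_le_two_mul_log hp]
  have hD1 : (1 : ℝ) ≤ maxDegOne E := by exact_mod_cast one_le_maxDegOne E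
  have hD2 : (maxDegOne E : ℝ) ≤ maxDegTwo E := by exact_mod_cast maxDegOne_le_maxDegTwo E
  have hD : (maxDegOne E : ℝ) ^ 2 ≤ (maxDegOne E : ℝ) * maxDegTwo E := by
    rw [sq]
    gcongr
  have hΛ : (1 : ℝ) ≤ (maxDegOne E : ℝ) * maxDegTwo E := by nlinarith
  set Λ : ℝ := (maxDegOne E : ℝ) * maxDegTwo E
  have hpow : ∀ {y : ℝ}, 0 ≤ y → ∀ (e : ℝ) (k : ℕ), (y ^ e) ^ k = y ^ (e * k) := fun hy e k => by
    rw [Real.rpow_mul_natCast hy]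
  refine (hE.gaussApproxError_le_of_roots g hX hG.aemeasurable.measurable_mk
    (hXG.congr Filter.EventuallyEq.rfl hGae) hX0 hκ hn hp hnp hγ₁ hB hK₃ hψ hvar
    (hG.congr hGae.symm) (N := (n : ℝ) ^ (1 / 12 : ℝ)) (x := Λ ^ (1 / 6 : ℝ))
    (w := Real.log p ^ (1 / 6 : ℝ)) (Real.one_le_rpow hn1 (by norm_num))
    (Real.one_le_rpow hΛ (by norm_num)) (Real.rpow_pos_of_pos hlog _)
    (by rw [hpow (by linarith)]; norm_num) (by rw [hpow hlog.le]; norm_num)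
    (by rw [hpow (by linarith)]; norm_num; exact hD) hc hA hδ).trans_eq ?_
  rw [hpow (by linarith), hpow hlog.le, hpow (by linarith)]
  norm_num
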